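/- Let $N\ge 2$ be an integer and let $\Omega_N$ be the hierarchical group of order $N$, i.e. the set of sequences $\mathbf x=(x_1,x_2,\dots)$ with $x_i\in\mathbb Z_N$ and $x_i=0$ for all but finitely many $i$, with the hierarchical distance $d(\mathbf x,\mathbf x)=0$ and $d(\mathbf x,\mathbf y)=\max\{i:x_i\ne y_i\}$ for $\mathbf x\neq\mathbf y$. For constants $C_0,C_1\ge 0$, $C_2>0$ and $\alpha>0$, consider the random graph with vertex set $\Omega_N$ in which each pair of points at distance $d(\mathbf x,\mathbf y)=k\ge 1$ is joined by an edge with probability $$p_{\mathbf x,\mathbf y}=\min\left(\frac{c_k}{N^{2k}},1\right),\qquad c_k=C_0+C_1\log k+C_2k^\alpha ,$$ independently for different pairs (this is the critical case $\delta=1$ of the connection probabilities $\min(c_k/N^{(1+\delta)k},1)$). If $\alpha>6$ and $C_2$ is sufficiently large (depending on $N$ and $\alpha$), then, almost surely, every vertex of the graph has finitely many neighbours, the graph has exactly one infinite connected component (the percolation cluster), and the simple random walk on this percolation cluster (which jumps from a vertex to each of its neighbours in the cluster with equal probability) is transient: started from any vertex of the cluster, it returns to that vertex with probability strictly less than $1$.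 -/

import Mathlib

open MeasureTheory ProbabilityTheory

noncomputable section

/-- The hierarchical group `Ω_N`: sequences in `ℤ_N` with only finitely many nonzero coordinates,
added componentwise.  The `i`-th coordinate (`i = 1, 2, …`) is stored at the index `i - 1`. -/
abbrev HierGroup (N : ℕ) : Type := ℕ →₀ ZMod N

namespace HierGroup

/-- The hierarchical distance: `0` if `x = y`, and otherwise the largest `i ∈ {1, 2, …}` such that
the `i`-th coordinates (those at index `i - 1`) of `x` and `y` differ. -/
def hdist {N : ℕ} (x y : HierGroup N) : ℕ := (x - y).support.sup (fun i => i + 1)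

theorem hdist_comm {N : ℕ} (x y : HierGroup N) : hdist x y = hdist y x := by
  unfold hdist
  rw [← neg_sub y x, Finsupp.support_neg]

/-- The hierarchical distance between the two end points of an unordered pair. -/
def edgeLength {N : ℕ} (e : Sym2 (HierGroup N)) : ℕ :=
  Sym2.lift ⟨fun x y => hdist x y, hdist_comm⟩ e

end HierGroup

/-- `c_k = C₀ + C₁ log k + C₂ k ^ α`. -/
def connCoeff (C₀ C₁ C₂ α : ℝ) (k : ℕ) : ℝ := C₀ + C₁ * Real.log k + C₂ * (k : ℝ) ^ α

/-- The connection probability `min (c_k / N ^ (2 k), 1)` of two points at hierarchical distance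
`k ≥ 1`, that is, `min (c_k / N ^ ((1 + δ) k), 1)` with `δ = 1` (`Set.projIcc` truncates to
`[0, 1]`; truncation at `0` plays no role for nonnegative constants). -/
def connProb (N : ℕ) (C₀ C₁ C₂ α : ℝ) (k : ℕ) : unitInterval :=
  Set.projIcc (0 : ℝ) 1 zero_le_one (connCoeff C₀ C₁ C₂ α k / (N : ℝ) ^ (2 * k))

/-- The law of the independent edge variables: every unordered pair `{x, y}` is open (`true`) with
probability `connProb` at `hdist x y`, independently of the other pairs. The diagonal pairs are
dummy coordinates, which `percGraph` ignores. -/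
def percMeasure (N : ℕ) (C₀ C₁ C₂ α : ℝ) : Measure (Sym2 (HierGroup N) → Bool) :=
  Measure.infinitePi fun e : Sym2 (HierGroup N) =>
    bernoulliMeasure true false (connProb N C₀ C₁ C₂ α (HierGroup.edgeLength e))

/-- The graph on `Ω_N` whose edges are the open pairs of distinct points. -/
def percGraph {N : ℕ} (ω : Sym2 (HierGroup N) → Bool) : SimpleGraph (HierGroup N) :=
  SimpleGraph.fromEdgeSet {e | ω e = true}

section SimpleRandomWalk

variable {V : Type*}

open Classical in
/-- The law of one step of the simple random walk on `H` from `x`: uniform on the neighbours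
of `x`. (If `x` has no neighbour, or infinitely many, the walk stays at `x`.) -/
def srwStep [MeasurableSpace V] (H : SimpleGraph V) (x : V) : Measure V :=
  if (H.neighborSet x).Finite ∧ (H.neighborSet x).Nonempty then uniformOn (H.neighborSet x)
  else Measure.dirac x

/-- The one-step Markov kernel of the simple random walk; all subsets of `V` are measurable. -/
def srwKernel (H : SimpleGraph V) : @Kernel V V ⊤ ⊤ :=
  letI : MeasurableSpace V := ⊤
  ⟨fun x => srwStep H x, measurable_from_top⟩

instance srwKernel_isMarkov (H : SimpleGraph V) : @IsMarkovKernel V V ⊤ ⊤ (srwKernel H) := by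
  let _ : MeasurableSpace V := ⊤
  refine ⟨fun x => ?_⟩
  change IsProbabilityMeasure (srwStep H x)
  unfold srwStep
  split_ifs with h
  · exact isProbabilityMeasure_uniformOn h.1 h.2
  · infer_instance

/-- The law, on trajectories `ℕ → V`, of the simple random walk on `H` started at `x`: the Markov
chain with initial law `δ_x` and transition kernel `srwKernel H`. -/
def srwLaw (H : SimpleGraph V) (x : V) : @Measure (ℕ → V) (@MeasurableSpace.pi ℕ _ fun _ => ⊤) :=
  letI : MeasurableSpace V := ⊤
  Kernel.trajMeasure (X := fun _ => V) (Measure.dirac x) fun n =>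
    (srwKernel H).comap (fun path : (i : Finset.Iic n) → V => path ⟨n, by simp⟩)
      (measurable_pi_apply _)

/-- The simple random walk on `H` is transient: from every starting point, the probability of
ever returning to it is less than one. -/
def SRWTransient (H : SimpleGraph V) : Prop :=
  ∀ x : V, srwLaw H x {path | ∃ n : ℕ, 1 ≤ n ∧ path n = x} < 1

end SimpleRandomWalk

end

/-! The proof is a renormalization. Fix 2 < θ < α/3 and radii κ n such that a ball of radius κ (n+1)
consists of about (n+2)^θ balls of radius κ n. A ball of stage n+1 is good if at most one of its
sub-balls of stage n is bad and if, for any two distinct good sub-balls, every nonempty cluster of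
stage n-1 in the first is joined by an open edge to the cluster of stage n of the second. Its
cluster is then the union of the clusters of its sub-balls. A nonempty cluster fills at least half
of its ball, so a given join fails with probability at most exp(-c C₂ n^(α-3θ)). With constants
suppressed, the probabilities of bad balls satisfy b_{n+1} ≤ n^(2θ) b_n² + n^(3θ) exp(-c C₂
n^(α-3θ)), and for large C₂ this gives b_n = O(n^(-2θ)) (`measure_bad_succ_le`, `exists_constants`).
By Borel-Cantelli, around each point all sub-balls are good from some stage on, and the clusters
increase to an infinite connected set.

Transience follows from a bound f(x)² ≤ C·(Dirichlet energy of f) for finitely supported f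
(`srwTransient_of_sq_le`). To get it, f(x) is compared with averages of f over the successive
clusters. Because joins start from every cluster of stage n-1, the averages of stages n and n+1 can
be compared through many edges at once. Their difference is then at most a constant times n^(-θ/2)
times the root of the energy (`sq_hierAvg_sub_le`), which is summable as θ > 2. The averages tend to
0 because f has finite support. The joins from stage n-1 require α > 3θ, and together with θ > 2
this is the condition α > 6.

For uniqueness, an infinite component of x is explored through successive shells around x. The
clusters fill at least half of each block of a shell, and connection probabilities are constant on
blocks, so leaving towards the shell without hitting a cluster has conditional probability at most
1/4 (`measure_inter_missEvent_le`). Almost surely the component therefore meets the clusters of the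
large stages, and those all lie in one component. -/

noncomputable section

/-! ### Ultrametric balls in the hierarchical group. -/

namespace HierGroup

variable {N : ℕ}

theorem hdist_le_iff {x y : HierGroup N} {k : ℕ} :
    hdist x y ≤ k ↔ ∀ i, k ≤ i → x i = y i := by
  unfold hdist
  rw [Finset.sup_le_iff]
  constructor
  · intro h i hi
    by_contra hne
    have := h i (by simpa [sub_eq_zero] using hne)
    omega
  · intro h i hi
    by_contra hlt
    have := h i (by omega)
    simp [this] at hi

variable [NeZero N]

/-- The closed ball of radius `k` in the hierarchical distance, as a finite set. -/
def hball (k : ℕ) (x : HierGroup N) : Finset (HierGroup N) :=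
  ((Finset.range k).finsupp fun _ => Finset.univ).map (addLeftEmbedding x)

theorem mem_hball {k : ℕ} {x y : HierGroup N} : y ∈ hball k x ↔ ∀ i, k ≤ i → x i = y i := by
  unfold hball
  simp only [Finset.mem_map, Finset.mem_finsupp_iff, addLeftEmbedding_apply]
  constructor
  · rintro ⟨z, ⟨hz, -⟩, rfl⟩ i hi
    have : z i = 0 := by
      by_contra h
      have := hz (Finsupp.mem_support_iff.2 h)
      simp at this; omega
    simp [this]
  · intro h
    refine ⟨y - x, ⟨fun i hi => ?_, by simp⟩, by simp⟩
    by_contra hlt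
    have := h i (by simpa using hlt)
    simp [this] at hi

theorem mem_hball_iff_hdist {k : ℕ} {x y : HierGroup N} : y ∈ hball k x ↔ hdist x y ≤ k := by
  rw [mem_hball, hdist_le_iff]

@[simp] theorem card_hball (k : ℕ) (x : HierGroup N) : (hball k x).card = N ^ k := by
  simp [hball, Finset.card_finsupp, ZMod.card]

@[simp] theorem mem_hball_self (k : ℕ) (x : HierGroup N) : x ∈ hball k x := by simp [mem_hball]

@[simp] theorem hball_zero (x : HierGroup N) : hball 0 x = {x} := by
  ext y
  simp only [mem_hball, zero_le, forall_const, Finset.mem_singleton]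
  exact ⟨fun h => (Finsupp.ext h).symm, fun h => by simp [h]⟩

theorem mem_hball_comm {k : ℕ} {x y : HierGroup N} : y ∈ hball k x ↔ x ∈ hball k y := by
  simp only [mem_hball, eq_comm]

theorem hball_eq_of_mem {k : ℕ} {x y : HierGroup N} (h : y ∈ hball k x) :
    hball k y = hball k x := by
  ext z
  simp only [mem_hball] at *
  exact ⟨fun h' i hi => (h i hi).trans (h' i hi), fun h' i hi => (h i hi).symm.trans (h' i hi)⟩

theorem hball_mono {k l : ℕ} (hkl : k ≤ l) (x : HierGroup N) : hball k x ⊆ hball l x := by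
  intro y
  simp only [mem_hball]
  exact fun h i hi => h i (hkl.trans hi)

theorem hball_subset_of_mem {k l : ℕ} (hkl : k ≤ l) {x y : HierGroup N} (h : y ∈ hball l x) :
    hball k y ⊆ hball l x :=
  (hball_mono hkl y).trans (hball_eq_of_mem h).subset

theorem exists_mem_hball (x y : HierGroup N) : ∃ k, y ∈ hball k x :=
  ⟨hdist x y, mem_hball_iff_hdist.2 le_rfl⟩

/-- Ultrametricity: two disjoint balls of the same radius have a single mutual distance. Hence
connection probabilities are constant between blocks. -/
theorem hdist_congr_of_mem {k : ℕ} {x u v w : HierGroup N} (hu : u ∈ hball k x)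
    (hv : v ∉ hball k x) (hw : w ∈ hball k v) : hdist u w = hdist x v := by
  have key : ∀ l, hdist u w ≤ l ↔ hdist x v ≤ l := by
    intro l
    rw [← mem_hball_iff_hdist, ← mem_hball_iff_hdist]
    rcases le_total k l with h | h
    · rw [hball_eq_of_mem (hball_mono h x hu)]
      exact ⟨fun h' => hball_subset_of_mem h h' (mem_hball_comm.1 hw),
        fun h' => hball_subset_of_mem h h' hw⟩
    · constructor
      · intro h'
        have h1 : w ∈ hball k u := hball_mono h u h'
        rw [hball_eq_of_mem hu] at h1
        exact absurd (by rw [← hball_eq_of_mem h1]; exact mem_hball_comm.1 hw) hv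
      · intro h'
        exact absurd (hball_mono h x h') hv
  exact le_antisymm ((key _).2 le_rfl) ((key _).1 le_rfl)

/-- A ball is covered by the expected number of smaller balls. -/
theorem exists_representatives (i j : ℕ) (x : HierGroup N) :
    ∃ t ⊆ hball j x, t.card = N ^ (j - i) ∧ ∀ y ∈ hball j x, ∃ z ∈ t, y ∈ hball i z := by
  refine ⟨((Finset.Ico i j).finsupp fun _ => Finset.univ).map (addLeftEmbedding x), ?_, ?_, ?_⟩
  · unfold hball
    refine Finset.map_subset_map.2 fun z hz => ?_
    rw [Finset.mem_finsupp_iff] at *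
    refine ⟨hz.1.trans fun a ha => ?_, by simp⟩
    simp at *; omega
  · simp [Finset.card_finsupp, ZMod.card]
  · intro y hy
    refine ⟨x + (y - x).filter (fun a => i ≤ a), ?_, ?_⟩
    · refine Finset.mem_map.2 ⟨_, Finset.mem_finsupp_iff.2 ⟨fun a ha => ?_, by simp⟩, rfl⟩
      rw [Finsupp.support_filter, Finset.mem_filter] at ha
      rw [mem_hball] at hy
      refine Finset.mem_Ico.2 ⟨ha.2, ?_⟩
      by_contra h
      have := hy a (by omega)
      simp [this] at ha
    · rw [mem_hball]
      intro a ha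
      simp [ha]

/-- Each `v` lies in the small ball of exactly N^i points `y`. Summing over all points instead of
over sub-balls costs only this factor and avoids choosing representatives. -/
theorem sum_sum_hball {i j : ℕ} (hij : i ≤ j) (x : HierGroup N) (f : HierGroup N → ℝ) :
    ∑ y ∈ hball j x, ∑ v ∈ hball i y, f v = N ^ i * ∑ v ∈ hball j x, f v := by
  rw [Finset.sum_comm' (t' := hball j x) (s' := fun v => hball i v)]
  · simp [Finset.mul_sum]
  · intro y v
    constructor
    · rintro ⟨hy, hv⟩
      exact ⟨mem_hball_comm.1 hv, hball_subset_of_mem hij hy hv⟩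
    · rintro ⟨hy, hv⟩
      exact ⟨hball_subset_of_mem hij hv hy, mem_hball_comm.1 hy⟩

/-! ### Good balls and their clusters. -/

section Clusters

variable (ω : Sym2 (HierGroup N) → Bool) (κ : ℕ → ℕ)

/-- `y` and `z` span clusters of two consecutive stages (the clusters `P y`, `Q y`, `Q z`) which
are joined by an open edge, unless one of the clusters is empty. -/
def Joined (P Q : HierGroup N → Finset (HierGroup N)) (y z : HierGroup N) : Prop :=
  (P y).Nonempty → (Q y).Nonempty → (Q z).Nonempty → ∃ u ∈ P y, ∃ v ∈ Q z, ω s(u, v) = true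

/-- The condition under which the clusters of the sub-balls of radius `r` are merged into a
cluster of the ball of radius `r'` around `x`: at most one of the sub-balls has an empty cluster,
and the nonempty ones are joined. -/
def Merges (r r' : ℕ) (P Q : HierGroup N → Finset (HierGroup N)) (x : HierGroup N) : Prop :=
  (∃ w, ∀ y ∈ hball r' x, Q y = ∅ → y ∈ hball r w) ∧
    ∀ y ∈ hball r' x, ∀ z ∈ hball r' x, z ∉ hball r y → Joined ω P Q y z

open Classical in
/-- The pair of the clusters of stages `n - 1` and `n`. -/
def clusterPair : ℕ → (HierGroup N → Finset (HierGroup N)) × (HierGroup N → Finset (HierGroup N))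
  -- The stage before 0 is taken to be stage 0 again, in agreement with truncated `n - 1`.
  | 0 => (fun x => {x}, fun x => {x})
  | n + 1 => ((clusterPair n).2, fun x =>
      if Merges ω (κ n) (κ (n + 1)) (clusterPair n).1 (clusterPair n).2 x then
        (hball (κ (n + 1)) x).biUnion (clusterPair n).2 else ∅)

/-- The cluster of stage `n` of the ball of radius `κ n` around `x`; it is empty if the ball is
bad. -/
def cluster (n : ℕ) : HierGroup N → Finset (HierGroup N) := (clusterPair ω κ n).2

@[simp] theorem cluster_zero (x : HierGroup N) : cluster ω κ 0 x = {x} := rfl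

theorem clusterPair_fst (n : ℕ) : (clusterPair ω κ n).1 = cluster ω κ (n - 1) := by
  cases n <;> rfl

open Classical in
theorem cluster_succ (n : ℕ) (x : HierGroup N) : cluster ω κ (n + 1) x =
    if Merges ω (κ n) (κ (n + 1)) (cluster ω κ (n - 1)) (cluster ω κ n) x then
      (hball (κ (n + 1)) x).biUnion (cluster ω κ n) else ∅ := by
  rw [← clusterPair_fst]; rfl

variable {ω κ}

theorem merges_of_nonempty {n : ℕ} {x : HierGroup N} (h : (cluster ω κ (n + 1) x).Nonempty) :
    Merges ω (κ n) (κ (n + 1)) (cluster ω κ (n - 1)) (cluster ω κ n) x := by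
  by_contra h'
  rw [cluster_succ, if_neg h'] at h
  simp at h

theorem cluster_succ_of_nonempty {n : ℕ} {x : HierGroup N}
    (h : (cluster ω κ (n + 1) x).Nonempty) :
    cluster ω κ (n + 1) x = (hball (κ (n + 1)) x).biUnion (cluster ω κ n) := by
  classical
  rw [cluster_succ, if_pos (merges_of_nonempty h)]

theorem cluster_subset (hκ : Monotone κ) (n : ℕ) (x : HierGroup N) :
    cluster ω κ n x ⊆ hball (κ n) x := by
  classical
  induction n generalizing x with
  | zero => simp
  | succ n ih =>
    rw [cluster_succ]
    split_ifs
    · refine Finset.biUnion_subset.2 fun y hy => (ih y).trans ?_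
      exact hball_subset_of_mem (hκ n.le_succ) hy
    · simp

theorem cluster_congr (hκ0 : κ 0 = 0) (n : ℕ) {x y : HierGroup N} (h : y ∈ hball (κ n) x) :
    cluster ω κ n y = cluster ω κ n x := by
  classical
  cases n with
  | zero => rw [hκ0] at h; simp at h; rw [h]
  | succ n =>
    have : hball (κ (n + 1)) y = hball (κ (n + 1)) x := hball_eq_of_mem h
    rw [cluster_succ, cluster_succ]
    unfold Merges
    rw [this]

theorem cluster_eq_of_mem (hκ : Monotone κ) (hκ0 : κ 0 = 0) {n : ℕ} {x v : HierGroup N}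
    (h : v ∈ cluster ω κ n x) : cluster ω κ n v = cluster ω κ n x :=
  cluster_congr hκ0 n (cluster_subset hκ n x h)

theorem mem_cluster_self_of_mem (hκ : Monotone κ) (hκ0 : κ 0 = 0) {n : ℕ} {x v : HierGroup N}
    (h : v ∈ cluster ω κ n x) : v ∈ cluster ω κ n v := by
  rwa [cluster_eq_of_mem hκ hκ0 h]

theorem cluster_subset_succ {n : ℕ} {x y : HierGroup N}
    (hy : y ∈ hball (κ (n + 1)) x) (h : (cluster ω κ (n + 1) x).Nonempty) :
    cluster ω κ n y ⊆ cluster ω κ (n + 1) x := by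
  rw [cluster_succ_of_nonempty h]
  exact Finset.subset_biUnion_of_mem _ hy

theorem mem_cluster_of_mem_succ (hκ : Monotone κ) (hκ0 : κ 0 = 0) {n : ℕ} {v : HierGroup N}
    (h : v ∈ cluster ω κ (n + 1) v) : v ∈ cluster ω κ n v := by
  have h' := h
  rw [cluster_succ_of_nonempty ⟨v, h⟩, Finset.mem_biUnion] at h'
  obtain ⟨y, hy, hv⟩ := h'
  exact mem_cluster_self_of_mem hκ hκ0 hv

theorem mem_cluster_pred (hκ : Monotone κ) (hκ0 : κ 0 = 0) {n : ℕ} {v : HierGroup N}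
    (h : v ∈ cluster ω κ n v) : v ∈ cluster ω κ (n - 1) v := by
  cases n with
  | zero => exact h
  | succ n => exact mem_cluster_of_mem_succ hκ hκ0 h

/-- The clusters are connected. -/
theorem cluster_reachable (hκ : Monotone κ) (hκ0 : κ 0 = 0) (n : ℕ) (x : HierGroup N)
    {u v : HierGroup N} (hu : u ∈ cluster ω κ n x) (hv : v ∈ cluster ω κ n x) :
    (percGraph ω).Reachable u v := by
  induction n generalizing x u v with
  | zero => simp at hu hv; rw [hu, hv]
  | succ n ih =>
    have hne : (cluster ω κ (n + 1) x).Nonempty := ⟨u, hu⟩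
    have hM := merges_of_nonempty hne
    rw [cluster_succ_of_nonempty hne, Finset.mem_biUnion] at hu hv
    obtain ⟨y, hy, hu⟩ := hu
    obtain ⟨z, hz, hv⟩ := hv
    by_cases hyz : z ∈ hball (κ n) y
    · rw [cluster_congr hκ0 n hyz] at hv
      exact ih y hu hv
    · have huy := cluster_subset hκ n y hu
      have hu' : u ∈ hball (κ (n + 1)) x := hball_subset_of_mem (hκ n.le_succ) hy huy
      rw [← hball_eq_of_mem huy] at hyz
      have huu := mem_cluster_self_of_mem hκ hκ0 hu
      -- The join is applied with `u` itself as centre, so it starts in the cluster of stage `n - 1`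
      -- containing `u`; that cluster lies in the cluster of stage `n` of `u`, where the induction
      -- hypothesis connects `u` to `a`.
      obtain ⟨a, ha, b, hb, hab⟩ := hM.2 u hu' z hz hyz
        ⟨u, mem_cluster_pred hκ hκ0 huu⟩ ⟨u, huu⟩ ⟨v, hv⟩
      have hau : (percGraph ω).Reachable u a := by
        cases n with
        | zero => simp at ha; rw [ha]
        | succ m =>
          exact ih u huu (cluster_subset_succ (mem_hball_self _ _) ⟨u, huu⟩ ha)
      refine hau.trans (SimpleGraph.Reachable.trans ?_ (ih z hb hv))
      by_cases hne : a = b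
      · rw [hne]
      · refine SimpleGraph.Adj.reachable ?_
        simp [percGraph, hab, hne]

theorem card_filter_cluster_nonempty {n : ℕ} {x : HierGroup N}
    (h : (cluster ω κ (n + 1) x).Nonempty) :
    N ^ κ (n + 1) ≤
      ((hball (κ (n + 1)) x).filter fun y => (cluster ω κ n y).Nonempty).card + N ^ κ n := by
  obtain ⟨w, hw⟩ := (merges_of_nonempty h).1
  rw [← card_hball (κ (n + 1)) x, ← card_hball (κ n) w,
    ← Finset.card_filter_add_card_filter_not (s := hball (κ (n + 1)) x)
      (fun y => (cluster ω κ n y).Nonempty)]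
  gcongr
  intro y hy
  rw [Finset.mem_filter] at hy
  exact hw y hy.1 (Finset.not_nonempty_iff_eq_empty.1 hy.2)

/-- Double counting of pairs (y, v) with v in the cluster of y: at most one sub-ball supplies no y,
and each v is counted at most N^(κ n) times. A density c thus survives up to the loss of one
sub-ball. -/
theorem card_cluster_succ {n : ℕ} {x : HierGroup N} (hκ : Monotone κ) (c : ℝ) (hc : 0 ≤ c)
    (ih : ∀ y, (cluster ω κ n y).Nonempty → c * N ^ κ n ≤ (cluster ω κ n y).card)
    (h : (cluster ω κ (n + 1) x).Nonempty) :
    c * (N ^ κ (n + 1) - N ^ κ n) ≤ (cluster ω κ (n + 1) x).card := by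
  have hpos : (0 : ℝ) < N ^ κ n := pow_pos (Nat.cast_pos.2 (NeZero.pos N)) _
  have h1 : ((N : ℝ) ^ κ (n + 1) - N ^ κ n) ≤
      ((hball (κ (n + 1)) x).filter fun y => (cluster ω κ n y).Nonempty).card := by
    have := card_filter_cluster_nonempty h
    rw [sub_le_iff_le_add]
    exact_mod_cast this
  have h2 : ∑ y ∈ (hball (κ (n + 1)) x).filter (fun y => (cluster ω κ n y).Nonempty),
      (cluster ω κ n y).card ≤ N ^ κ n * (cluster ω κ (n + 1) x).card := by
    rw [← Finset.card_sigma, mul_comm, ← Finset.sum_const_nat (m := N ^ κ n)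
      (s := cluster ω κ (n + 1) x) (f := fun v => (hball (κ n) v).card) (by simp),
      ← Finset.card_sigma]
    refine Finset.card_le_card_of_injOn (fun p => ⟨p.2, p.1⟩) ?_ ?_
    · rintro ⟨y, v⟩ hp
      simp only [Finset.coe_sigma, Set.mem_sigma_iff, Finset.mem_coe, Finset.mem_filter] at hp ⊢
      exact ⟨cluster_subset_succ hp.1.1 h hp.2, mem_hball_comm.1 (cluster_subset hκ n y hp.2)⟩
    · rintro ⟨y, v⟩ _ ⟨y', v'⟩ _ hp
      simp at hp ⊢
      tauto
  have h3 : (((hball (κ (n + 1)) x).filter fun y => (cluster ω κ n y).Nonempty).card : ℝ) *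
      (c * N ^ κ n) ≤ N ^ κ n * (cluster ω κ (n + 1) x).card := by
    refine le_trans ?_ (by exact_mod_cast h2 :
      ∑ y ∈ (hball (κ (n + 1)) x).filter (fun y => (cluster ω κ n y).Nonempty),
      ((cluster ω κ n y).card : ℝ) ≤ _)
    rw [← nsmul_eq_mul]
    exact Finset.card_nsmul_le_sum _ _ _ fun y hy => ih y (Finset.mem_filter.1 hy).2
  have h4 : N ^ κ n * (c * (N ^ κ (n + 1) - N ^ κ n)) ≤
      (N : ℝ) ^ κ n * (cluster ω κ (n + 1) x).card := by
    refine le_trans ?_ h3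
    have : 0 ≤ c * N ^ κ n := by positivity
    nlinarith
  exact le_of_mul_le_mul_left h4 hpos

/-- If the scales grow fast enough, a nonempty cluster fills at least half of its ball. -/
theorem half_le_card_cluster (hκ : Monotone κ) (hκ0 : κ 0 = 0)
    (hM : ∀ n : ℕ, ((n : ℝ) + 2) ^ 2 * N ^ κ n ≤ N ^ κ (n + 1)) (n : ℕ) (x : HierGroup N)
    (h : (cluster ω κ n x).Nonempty) : 1 / 2 * (N : ℝ) ^ κ n ≤ (cluster ω κ n x).card := by
  -- The constant is the telescoping product of 1 - 1/j² for j = 2, …, n+1, since one sub-ball is at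
  -- most a fraction 1/(n+2)² of the ball of stage n+1; it decreases to 1/2.
  have key : ((n : ℝ) + 2) / (2 * (n + 1)) * N ^ κ n ≤ (cluster ω κ n x).card := by
    induction n generalizing x with
    | zero => simp [hκ0]
    | succ n ih =>
      refine le_trans ?_ (card_cluster_succ hκ (((n : ℝ) + 2) / (2 * (n + 1))) (by positivity) ih h)
      have h1 : (N : ℝ) ^ κ n ≤ N ^ κ (n + 1) / (n + 2) ^ 2 := by
        rw [le_div_iff₀ (by positivity), mul_comm]; exact hM n
      have h2 : ((n : ℝ) + 2) / (2 * (n + 1)) *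
          (N ^ κ (n + 1) - N ^ κ (n + 1) / (n + 2) ^ 2) =
          (n + 3) / (2 * (n + 2)) * N ^ κ (n + 1) := by
        field_simp; ring
      have h3 : ((n : ℝ) + 2) / (2 * (n + 1)) *
          (N ^ κ (n + 1) - N ^ κ (n + 1) / (n + 2) ^ 2) ≤ ((n : ℝ) + 2) / (2 * (n + 1)) *
          (N ^ κ (n + 1) - N ^ κ n) := by
        gcongr
      refine le_trans (le_of_eq ?_) h3
      rw [h2]; push_cast; ring
  refine le_trans ?_ key
  refine mul_le_mul_of_nonneg_right ?_ (by positivity)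
  rw [div_le_div_iff₀ (by positivity) (by positivity)]
  linarith

end Clusters

/-! ### A Poincaré-type inequality along the clusters. -/

section Poincare

variable {N : ℕ} [NeZero N]

/-- The contribution of the ordered pair `(u, v)` to the Dirichlet energy of `f`. -/
def edgeEnergy (ω : Sym2 (HierGroup N) → Bool) (f : HierGroup N → ℝ) (u v : HierGroup N) : ℝ :=
  if ω s(u, v) = true then (f u - f v) ^ 2 else 0

/-- The Dirichlet energy of `f` on the open edges inside the ball of radius `k` around `x`,
each edge counted twice. -/
def ballEnergy (ω : Sym2 (HierGroup N) → Bool) (f : HierGroup N → ℝ) (k : ℕ)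
    (x : HierGroup N) : ℝ :=
  ∑ u ∈ hball k x, ∑ v ∈ hball k x, edgeEnergy ω f u v

/-- The points of the ball of radius `k` around `x` whose cluster of stage `n` is nonempty. -/
def goodPoints (ω : Sym2 (HierGroup N) → Bool) (κ : ℕ → ℕ) (n k : ℕ) (x : HierGroup N) :
    Finset (HierGroup N) :=
  (hball k x).filter fun y => (cluster ω κ n y).Nonempty

/-- The hierarchical average of `f` over the cluster of stage `n` around `x`: all the nonempty
clusters of the previous stage have the same weight. -/
def hierAvg (ω : Sym2 (HierGroup N) → Bool) (κ : ℕ → ℕ) (f : HierGroup N → ℝ) :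
    ℕ → HierGroup N → ℝ
  | 0, x => f x
  | n + 1, x => (∑ y ∈ goodPoints ω κ n (κ (n + 1)) x, hierAvg ω κ f n y) /
      (goodPoints ω κ n (κ (n + 1)) x).card

variable {ω : Sym2 (HierGroup N) → Bool} {κ : ℕ → ℕ} {f : HierGroup N → ℝ}

omit [NeZero N] in
theorem edgeEnergy_nonneg (u v : HierGroup N) : 0 ≤ edgeEnergy ω f u v := by
  unfold edgeEnergy
  split_ifs
  · positivity
  · exact le_rfl

theorem ballEnergy_nonneg (k : ℕ) (x : HierGroup N) : 0 ≤ ballEnergy ω f k x :=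
  Finset.sum_nonneg fun _ _ => Finset.sum_nonneg fun _ _ => edgeEnergy_nonneg _ _

theorem ballEnergy_mono {k l : ℕ} (hkl : k ≤ l) (x : HierGroup N) :
    ballEnergy ω f k x ≤ ballEnergy ω f l x := by
  unfold ballEnergy
  refine (Finset.sum_le_sum fun u _ => ?_).trans (Finset.sum_le_sum_of_subset_of_nonneg
    (hball_mono hkl x) fun _ _ _ => Finset.sum_nonneg fun _ _ => edgeEnergy_nonneg _ _)
  exact Finset.sum_le_sum_of_subset_of_nonneg (hball_mono hkl x) fun _ _ _ => edgeEnergy_nonneg _ _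

theorem ballEnergy_congr {k : ℕ} {x y : HierGroup N} (h : y ∈ hball k x) :
    ballEnergy ω f k y = ballEnergy ω f k x := by
  unfold ballEnergy
  rw [hball_eq_of_mem h]

theorem sum_ballEnergy_le {i j : ℕ} (hij : i ≤ j) (x : HierGroup N) :
    ∑ y ∈ hball j x, ballEnergy ω f i y ≤ N ^ i * ballEnergy ω f j x := by
  have h1 : ∀ y, ballEnergy ω f i y = ∑ u ∈ hball i y, ∑ v ∈ hball i u, edgeEnergy ω f u v :=
    fun y => Finset.sum_congr rfl fun u hu => by rw [hball_eq_of_mem hu]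
  simp_rw [h1]
  rw [sum_sum_hball hij]
  refine mul_le_mul_of_nonneg_left (Finset.sum_le_sum fun u hu => ?_) (by positivity)
  exact Finset.sum_le_sum_of_subset_of_nonneg (hball_subset_of_mem hij hu)
    fun _ _ _ => edgeEnergy_nonneg _ _

theorem hierAvg_congr (hκ0 : κ 0 = 0) (n : ℕ) {x y : HierGroup N} (h : y ∈ hball (κ n) x) :
    hierAvg ω κ f n y = hierAvg ω κ f n x := by
  cases n with
  | zero => rw [hκ0] at h; simp at h; rw [h]
  | succ n => simp only [hierAvg, goodPoints, hball_eq_of_mem h]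

theorem sq_sub_average_le {ι : Type*} (s : Finset ι) (hs : s.Nonempty) (q : ι → ℝ) (a : ℝ) :
    (a - (∑ i ∈ s, q i) / s.card) ^ 2 ≤ (∑ i ∈ s, (a - q i) ^ 2) / s.card := by
  have hc : (0 : ℝ) < s.card := by exact_mod_cast hs.card_pos
  have h : a - (∑ i ∈ s, q i) / s.card = (∑ i ∈ s, (a - q i)) / s.card := by
    rw [Finset.sum_sub_distrib, Finset.sum_const, nsmul_eq_mul]; field_simp
  rw [h, div_pow, div_le_div_iff₀ (by positivity) hc]
  have := sq_sum_le_card_mul_sum_sq (s := s) (f := fun i => a - q i)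
  nlinarith

/-- Jensen's inequality, applied once in each variable. The alternative `q z = a` is needed for the
sub-ball whose own average is `a`: no edge links it to itself, but it contributes nothing. -/
theorem sq_sub_average_average_le {ι : Type*} (Y Z : Finset ι) (hY : Y.Nonempty) (hZ : Z.Nonempty)
    (p q A C : ι → ℝ) (B : ι → ι → ℝ) (a : ℝ) (ha : a = (∑ y ∈ Y, p y) / Y.card)
    (hA : ∀ y ∈ Y, 0 ≤ A y) (hB : ∀ y ∈ Y, ∀ z ∈ Z, 0 ≤ B y z) (hC : ∀ z ∈ Z, 0 ≤ C z)
    (h : ∀ z ∈ Z, q z = a ∨ ∀ y ∈ Y, (q z - p y) ^ 2 ≤ 3 * (A y + B y z + C z)) :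
    (a - (∑ z ∈ Z, q z) / Z.card) ^ 2 ≤ 3 * ((∑ y ∈ Y, A y) / Y.card +
      (∑ y ∈ Y, ∑ z ∈ Z, B y z) / (Y.card * Z.card) + (∑ z ∈ Z, C z) / Z.card) := by
  have hcY : (0 : ℝ) < Y.card := by exact_mod_cast hY.card_pos
  have hcZ : (0 : ℝ) < Z.card := by exact_mod_cast hZ.card_pos
  have h1 : ∀ z ∈ Z, (a - q z) ^ 2 ≤ (∑ y ∈ Y, 3 * (A y + B y z + C z)) / Y.card := by
    intro z hz
    rcases h z hz with h' | h'
    · rw [h', sub_self, zero_pow two_ne_zero]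
      refine div_nonneg (Finset.sum_nonneg fun y hy => ?_) hcY.le
      linarith [hA y hy, hB y hy z hz, hC z hz]
    · rw [← neg_sq, neg_sub, ha]
      refine (sq_sub_average_le Y hY p (q z)).trans ?_
      gcongr with y hy
      exact h' y hy
  refine (sq_sub_average_le Z hZ q a).trans ?_
  refine (div_le_div_of_nonneg_right (Finset.sum_le_sum h1) hcZ.le).trans (le_of_eq ?_)
  rw [← Finset.sum_div, Finset.sum_comm]
  simp_rw [← Finset.mul_sum, Finset.sum_add_distrib, Finset.sum_const, nsmul_eq_mul,
    ← Finset.mul_sum]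
  field_simp

theorem card_goodPoints_ge (hdouble : ∀ n, 2 * N ^ κ n ≤ N ^ κ (n + 1)) {n : ℕ} {x : HierGroup N}
    (h : (cluster ω κ (n + 1) x).Nonempty) :
    (N : ℝ) ^ κ (n + 1) / 2 ≤ (goodPoints ω κ n (κ (n + 1)) x).card := by
  have h1 := card_filter_cluster_nonempty h
  have h2 := hdouble n
  have h3 : N ^ κ (n + 1) ≤ 2 * (goodPoints ω κ n (κ (n + 1)) x).card := by
    unfold goodPoints; omega
  rw [div_le_iff₀ two_pos, mul_comm]
  exact_mod_cast h3

/-- Expand the average of stage n over clusters y of stage n-1 and the one of stage n+1 over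
clusters z of stage n. When z lies outside the ball of x, each pair is linked by an open edge uv,
and the difference splits into the oscillation near z, the jump along uv and the oscillation near y.
The oscillations involve energies of smaller balls, which after averaging are of order δ² times the
whole. With only one edge leaving the cluster of x towards each z, the oscillation inside its full
ball would enter without any gain, and the bounds could not be summed over stages. -/
theorem sq_hierAvg_sub_le (hκ : Monotone κ) (hκ0 : κ 0 = 0)
    (hdouble : ∀ n, 2 * N ^ κ n ≤ N ^ κ (n + 1)) {n : ℕ} {x : HierGroup N} {R : ℝ} {δ : ℝ}
    (hδ1 : (N : ℝ) ^ κ (n - 1) ≤ δ ^ 2 * N ^ κ n) (hδ2 : (N : ℝ) ^ κ n ≤ δ ^ 2 * N ^ κ (n + 1))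
    (hδ : 0 ≤ δ) (hδ' : δ ≤ 1)
    (hR1 : ∀ v ∈ cluster ω κ (n - 1) v, (f v - hierAvg ω κ f (n - 1) v) ^ 2 ≤
      R ^ 2 * ballEnergy ω f (κ (n - 1)) v)
    (hR2 : ∀ v ∈ cluster ω κ n v, (f v - hierAvg ω κ f n v) ^ 2 ≤
      R ^ 2 * ballEnergy ω f (κ n) v)
    (hx : (cluster ω κ n x).Nonempty) (hx' : (cluster ω κ (n + 1) x).Nonempty) :
    (hierAvg ω κ f n x - hierAvg ω κ f (n + 1) x) ^ 2 ≤
      12 * (R ^ 2 + 1) * δ ^ 2 * ballEnergy ω f (κ (n + 1)) x := by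
  have hN : (0 : ℝ) < N := Nat.cast_pos.2 (NeZero.pos N)
  set D := ballEnergy ω f (κ (n + 1)) x with hD
  have hD0 : 0 ≤ D := ballEnergy_nonneg _ _
  set Y := goodPoints ω κ (n - 1) (κ n) x with hYdef
  set Z := goodPoints ω κ n (κ (n + 1)) x with hZdef
  have hmono1 : κ (n - 1) ≤ κ n := hκ (Nat.sub_le _ _)
  have hmono2 : κ n ≤ κ (n + 1) := hκ n.le_succ
  -- For `n = 0` the set `Y` is `{x}` and `n - 1` is again 0, so the formula persists.
  have hYavg : hierAvg ω κ f n x = (∑ y ∈ Y, hierAvg ω κ f (n - 1) y) / Y.card := by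
    cases n with
    | zero => simp [hYdef, hκ0, goodPoints, hierAvg]
    | succ m => rfl
  have hYcard : (N : ℝ) ^ κ n / 2 ≤ Y.card := by
    cases n with
    | zero => simp [hYdef, hκ0, goodPoints]; norm_num
    | succ m => exact card_goodPoints_ge hdouble hx
  have hZcard : (N : ℝ) ^ κ (n + 1) / 2 ≤ Z.card := card_goodPoints_ge hdouble hx'
  have hYpos : (0 : ℝ) < Y.card := lt_of_lt_of_le (by positivity) hYcard
  have hZpos : (0 : ℝ) < Z.card := lt_of_lt_of_le (by positivity) hZcard
  have hYsub : Y ⊆ hball (κ n) x := Finset.filter_subset _ _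
  have hZsub : Z ⊆ hball (κ (n + 1)) x := Finset.filter_subset _ _
  set A : HierGroup N → ℝ := fun y => R ^ 2 * ballEnergy ω f (κ (n - 1)) y with hA
  set C : HierGroup N → ℝ := fun z => R ^ 2 * ballEnergy ω f (κ n) z with hC
  set B : HierGroup N → HierGroup N → ℝ := fun y z =>
    ∑ u ∈ hball (κ (n - 1)) y, ∑ v ∈ hball (κ n) z, edgeEnergy ω f u v with hB
  have hA0 : ∀ y, 0 ≤ A y := fun y => mul_nonneg (sq_nonneg _) (ballEnergy_nonneg _ _)
  have hC0 : ∀ z, 0 ≤ C z := fun y => mul_nonneg (sq_nonneg _) (ballEnergy_nonneg _ _)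
  have hB0 : ∀ y z, 0 ≤ B y z := fun y z =>
    Finset.sum_nonneg fun _ _ => Finset.sum_nonneg fun _ _ => edgeEnergy_nonneg _ _
  have hmain := sq_sub_average_average_le Y Z (Finset.card_pos.1 (by exact_mod_cast hYpos))
    (Finset.card_pos.1 (by exact_mod_cast hZpos)) (hierAvg ω κ f (n - 1)) (hierAvg ω κ f n)
    A C B (hierAvg ω κ f n x) hYavg (fun y _ => hA0 y) (fun y _ z _ => hB0 y z) (fun z _ => hC0 z)
    (by
      intro z hz
      rw [hZdef, goodPoints, Finset.mem_filter] at hz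
      by_cases hzx : z ∈ hball (κ n) x
      · exact Or.inl (hierAvg_congr hκ0 n hzx)
      · refine Or.inr fun y hy => ?_
        rw [hYdef, goodPoints, Finset.mem_filter] at hy
        obtain ⟨u, hu, v, hv, huv⟩ := (merges_of_nonempty hx').2 y (hball_mono hmono2 x hy.1) z hz.1
          (by rwa [hball_eq_of_mem hy.1]) hy.2 (by rwa [cluster_congr hκ0 n hy.1]) hz.2
        have hu' := cluster_subset hκ _ _ hu
        have hv' := cluster_subset hκ _ _ hv
        have e1 := hR1 u (mem_cluster_self_of_mem hκ hκ0 hu)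
        have e2 := hR2 v (mem_cluster_self_of_mem hκ hκ0 hv)
        rw [hierAvg_congr hκ0 _ hu', ballEnergy_congr hu'] at e1
        rw [hierAvg_congr hκ0 _ hv', ballEnergy_congr hv'] at e2
        have e3 : (f u - f v) ^ 2 ≤ B y z := by
          have : (f u - f v) ^ 2 = edgeEnergy ω f u v := by simp [edgeEnergy, huv]
          rw [this]
          refine le_trans ?_ (Finset.single_le_sum
            (f := fun u => ∑ v ∈ hball (κ n) z, edgeEnergy ω f u v)
            (fun _ _ => Finset.sum_nonneg fun _ _ => edgeEnergy_nonneg _ _) hu')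
          exact Finset.single_le_sum (f := fun v => edgeEnergy ω f u v)
            (fun _ _ => edgeEnergy_nonneg _ _) hv'
        simp only [hA, hC]
        -- This is (a + b + c)² ≤ 3(a² + b² + c²) for the three parts of the difference.
        nlinarith [sq_nonneg ((f v - hierAvg ω κ f n z) - (f u - f v)),
          sq_nonneg ((f v - hierAvg ω κ f n z) + (f u - hierAvg ω κ f (n - 1) y)),
          sq_nonneg ((f u - f v) + (f u - hierAvg ω κ f (n - 1) y))])
  have hsumA : ∑ y ∈ Y, A y ≤ R ^ 2 * (N ^ κ (n - 1) * D) := by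
    refine (Finset.sum_le_sum_of_subset_of_nonneg hYsub fun y _ _ => hA0 y).trans ?_
    rw [← Finset.mul_sum]
    refine mul_le_mul_of_nonneg_left ((sum_ballEnergy_le hmono1 x).trans ?_) (sq_nonneg _)
    exact mul_le_mul_of_nonneg_left (ballEnergy_mono hmono2 x) (by positivity)
  have hsumC : ∑ z ∈ Z, C z ≤ R ^ 2 * (N ^ κ n * D) := by
    refine (Finset.sum_le_sum_of_subset_of_nonneg hZsub fun y _ _ => hC0 y).trans ?_
    rw [← Finset.mul_sum]
    exact mul_le_mul_of_nonneg_left (sum_ballEnergy_le hmono2 x) (sq_nonneg _)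
  have hsumB : ∑ y ∈ Y, ∑ z ∈ Z, B y z ≤ N ^ κ (n - 1) * (N ^ κ n * D) := by
    calc ∑ y ∈ Y, ∑ z ∈ Z, B y z ≤ ∑ y ∈ hball (κ n) x, ∑ z ∈ hball (κ (n + 1)) x, B y z := by
          refine (Finset.sum_le_sum_of_subset_of_nonneg hYsub
            fun y _ _ => Finset.sum_nonneg fun z _ => hB0 y z).trans ?_
          exact Finset.sum_le_sum fun y _ =>
            Finset.sum_le_sum_of_subset_of_nonneg hZsub fun z _ _ => hB0 y z
      _ = N ^ κ (n - 1) * (N ^ κ n * ∑ u ∈ hball (κ n) x, ∑ v ∈ hball (κ (n + 1)) x,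
            edgeEnergy ω f u v) := by
          simp only [hB]
          have : ∀ y, ∑ z ∈ hball (κ (n + 1)) x, ∑ u ∈ hball (κ (n - 1)) y,
              ∑ v ∈ hball (κ n) z, edgeEnergy ω f u v = ∑ u ∈ hball (κ (n - 1)) y,
              N ^ κ n * ∑ v ∈ hball (κ (n + 1)) x, edgeEnergy ω f u v := by
            intro y
            rw [Finset.sum_comm]
            exact Finset.sum_congr rfl fun u _ => sum_sum_hball hmono2 x _
          simp_rw [this]
          rw [sum_sum_hball hmono1, ← Finset.mul_sum]
      _ ≤ _ := by
          gcongr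
          rw [hD, ballEnergy]
          exact Finset.sum_le_sum_of_subset_of_nonneg (hball_mono hmono2 x)
            fun _ _ _ => Finset.sum_nonneg fun _ _ => edgeEnergy_nonneg _ _
  have hA' : (∑ y ∈ Y, A y) / Y.card ≤ R ^ 2 * (2 * δ ^ 2 * D) := by
    rw [div_le_iff₀ hYpos]
    calc _ ≤ R ^ 2 * (N ^ κ (n - 1) * D) := hsumA
      _ ≤ R ^ 2 * (δ ^ 2 * N ^ κ n * D) := by gcongr
      _ = R ^ 2 * (2 * δ ^ 2 * D) * (N ^ κ n / 2) := by ring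
      _ ≤ _ := by gcongr
  have hC' : (∑ z ∈ Z, C z) / Z.card ≤ R ^ 2 * (2 * δ ^ 2 * D) := by
    rw [div_le_iff₀ hZpos]
    calc _ ≤ R ^ 2 * (N ^ κ n * D) := hsumC
      _ ≤ R ^ 2 * (δ ^ 2 * N ^ κ (n + 1) * D) := by gcongr
      _ = R ^ 2 * (2 * δ ^ 2 * D) * (N ^ κ (n + 1) / 2) := by ring
      _ ≤ _ := by gcongr
  -- Averaging the edge energies over both y and z gains δ⁴; a factor δ² is dropped to match the
  -- other two terms.
  have hB' : (∑ y ∈ Y, ∑ z ∈ Z, B y z) / (Y.card * Z.card) ≤ 4 * δ ^ 2 * D := by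
    rw [div_le_iff₀ (by positivity)]
    calc _ ≤ N ^ κ (n - 1) * (N ^ κ n * D) := hsumB
      _ ≤ (δ ^ 2 * N ^ κ n) * ((δ ^ 2 * N ^ κ (n + 1)) * D) := by gcongr
      _ = 4 * δ ^ 2 * D * (N ^ κ n / 2 * (N ^ κ (n + 1) / 2)) * δ ^ 2 := by ring
      _ ≤ 4 * δ ^ 2 * D * (N ^ κ n / 2 * (N ^ κ (n + 1) / 2)) * 1 := by
          gcongr
          exact pow_le_one₀ hδ hδ'
      _ ≤ _ := by rw [mul_one]; gcongr
  have : hierAvg ω κ f (n + 1) x = (∑ z ∈ Z, hierAvg ω κ f n z) / Z.card := rfl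
  rw [this]
  refine hmain.trans ?_
  linarith

/-- The oscillation constants: `1 + oscConst δ n = ∏ i < n, (1 + 4 δ i)`. -/
def oscConst (δ : ℕ → ℝ) (n : ℕ) : ℝ := ∏ i ∈ Finset.range n, (1 + 4 * δ i) - 1

theorem oscConst_nonneg {δ : ℕ → ℝ} (hδ : ∀ n, 0 ≤ δ n) (n : ℕ) : 0 ≤ oscConst δ n := by
  unfold oscConst
  rw [sub_nonneg]
  induction n with
  | zero => simp
  | succ n ih =>
    rw [Finset.prod_range_succ]
    exact one_le_mul_of_one_le_of_one_le ih (by linarith [hδ n])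

theorem oscConst_succ (δ : ℕ → ℝ) (n : ℕ) :
    oscConst δ (n + 1) = oscConst δ n + 4 * (oscConst δ n + 1) * δ n := by
  unfold oscConst
  rw [Finset.prod_range_succ]; ring

theorem oscConst_mono {δ : ℕ → ℝ} (hδ : ∀ n, 0 ≤ δ n) : Monotone (oscConst δ) :=
  monotone_nat_of_le_succ fun n => by
    rw [oscConst_succ]
    have := mul_nonneg (by linarith [oscConst_nonneg hδ n] : 0 ≤ 4 * (oscConst δ n + 1)) (hδ n)
    linarith

theorem oscConst_le {δ : ℕ → ℝ} (hδ : ∀ n, 0 ≤ δ n) (hs : Summable δ) (n : ℕ) :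
    oscConst δ n ≤ Real.exp (4 * ∑' i, δ i) := by
  unfold oscConst
  have h1 : ∏ i ∈ Finset.range n, (1 + 4 * δ i) ≤ ∏ i ∈ Finset.range n, Real.exp (4 * δ i) :=
    Finset.prod_le_prod (fun i _ => by linarith [hδ i]) fun i _ => by
      linarith [Real.add_one_le_exp (4 * δ i)]
  rw [← Real.exp_sum, ← Finset.mul_sum] at h1
  have h2 : Real.exp (4 * ∑ i ∈ Finset.range n, δ i) ≤ Real.exp (4 * ∑' i, δ i) := by
    gcongr
    exact hs.sum_le_tsum _ fun i _ => hδ i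
  linarith

/-- The oscillation of `f` on the clusters is controlled by the Dirichlet energy. -/
theorem abs_sub_hierAvg_le (hκ : Monotone κ) (hκ0 : κ 0 = 0)
    (hdouble : ∀ n, 2 * N ^ κ n ≤ N ^ κ (n + 1)) {δ : ℕ → ℝ}
    (hδ1 : ∀ n, (N : ℝ) ^ κ (n - 1) ≤ δ n ^ 2 * N ^ κ n)
    (hδ2 : ∀ n, (N : ℝ) ^ κ n ≤ δ n ^ 2 * N ^ κ (n + 1))
    (hδ : ∀ n, 0 ≤ δ n) (hδ' : ∀ n, δ n ≤ 1) (n : ℕ) :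
    ∀ x ∈ cluster ω κ n x,
      |f x - hierAvg ω κ f n x| ≤ oscConst δ n * √(ballEnergy ω f (κ n) x) := by
  induction n using Nat.strong_induction_on with
  | _ n ih =>
  cases n with
  | zero => intro x _; simp [hierAvg, oscConst]
  | succ n =>
    intro x hx
    set R := oscConst δ n with hR
    have hR0 : 0 ≤ R := oscConst_nonneg hδ n
    have hsq : ∀ m ≤ n, ∀ v ∈ cluster ω κ m v, (f v - hierAvg ω κ f m v) ^ 2 ≤
        R ^ 2 * ballEnergy ω f (κ m) v := by
      intro m hm v hv
      have h1 := ih m (by omega) v hv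
      have h2 : |f v - hierAvg ω κ f m v| ≤ R * √(ballEnergy ω f (κ m) v) :=
        h1.trans (mul_le_mul_of_nonneg_right (oscConst_mono hδ hm) (Real.sqrt_nonneg _))
      have h3 := pow_le_pow_left₀ (abs_nonneg _) h2 2
      rwa [sq_abs, mul_pow, Real.sq_sqrt (ballEnergy_nonneg _ _)] at h3
    have hxn := mem_cluster_of_mem_succ hκ hκ0 hx
    have h1 := sq_hierAvg_sub_le (f := f) hκ hκ0 hdouble (hδ1 n) (hδ2 n) (hδ n) (hδ' n)
      (hsq (n - 1) (Nat.sub_le _ _)) (hsq n le_rfl) ⟨x, hxn⟩ ⟨x, hx⟩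
    set D := ballEnergy ω f (κ (n + 1)) x with hD
    have hD0 : 0 ≤ D := ballEnergy_nonneg _ _
    -- From 12(R² + 1) ≤ 16(R + 1)²; this explains the factor 4 in `oscConst`.
    have h2 : |hierAvg ω κ f n x - hierAvg ω κ f (n + 1) x| ≤ 4 * (R + 1) * δ n * √D := by
      refine abs_le_of_sq_le_sq ?_ (by have := hδ n; positivity)
      rw [mul_pow, mul_pow, Real.sq_sqrt hD0]
      refine h1.trans (mul_le_mul_of_nonneg_right ?_ hD0)
      refine mul_le_mul_of_nonneg_right ?_ (sq_nonneg _)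
      nlinarith
    have h3 : |f x - hierAvg ω κ f n x| ≤ R * √D :=
      (ih n (by omega) x hxn).trans (mul_le_mul_of_nonneg_left
        (Real.sqrt_le_sqrt (ballEnergy_mono (hκ n.le_succ) x)) hR0)
    rw [oscConst_succ]
    calc _ ≤ |f x - hierAvg ω κ f n x| + |hierAvg ω κ f n x - hierAvg ω κ f (n + 1) x| :=
          abs_sub_le _ _ _
      _ ≤ _ := by rw [add_mul]; exact add_le_add h3 h2

/-- The density recursion of the clusters, applied to weights: the average is at most about twice
the mean of |f| over the ball. For finitely supported f the averages therefore vanish as the volume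
grows. -/
theorem abs_hierAvg_mul_le (hκ : Monotone κ) (hκ0 : κ 0 = 0)
    (hM : ∀ n : ℕ, ((n : ℝ) + 2) ^ 2 * N ^ κ n ≤ N ^ κ (n + 1)) (n : ℕ) (x : HierGroup N)
    (h : (cluster ω κ n x).Nonempty) :
    |hierAvg ω κ f n x| * (((n : ℝ) + 2) / (2 * (n + 1)) * N ^ κ n) ≤
      ∑ v ∈ hball (κ n) x, |f v| := by
  have hN : (0 : ℝ) < N := Nat.cast_pos.2 (NeZero.pos N)
  induction n generalizing x with
  | zero => simp [hκ0, hierAvg]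
  | succ n ih =>
    set Z := goodPoints ω κ n (κ (n + 1)) x with hZ
    set ρ : ℝ := ((n : ℝ) + 2) / (2 * (n + 1)) with hρ
    have hρ0 : 0 < ρ := by positivity
    have hZcard : (N : ℝ) ^ κ (n + 1) - N ^ κ n ≤ Z.card := by
      rw [sub_le_iff_le_add]
      exact_mod_cast card_filter_cluster_nonempty h
    have h1 : (N : ℝ) ^ κ n ≤ N ^ κ (n + 1) / (n + 2) ^ 2 := by
      rw [le_div_iff₀ (by positivity), mul_comm]; exact hM n
    have h2 : ρ * (N ^ κ (n + 1) - N ^ κ (n + 1) / (n + 2) ^ 2) =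
        ((n + 1 : ℕ) + 2) / (2 * ((n + 1 : ℕ) + 1)) * N ^ κ (n + 1) := by
      rw [hρ]; push_cast
      field_simp; ring
    have h3 : ((n + 1 : ℕ) + 2) / (2 * ((n + 1 : ℕ) + 1)) * (N : ℝ) ^ κ (n + 1) ≤ ρ * Z.card := by
      rw [← h2]
      gcongr
      linarith
    have hZpos : (0 : ℝ) < Z.card := by
      have : (0 : ℝ) < ρ * Z.card := lt_of_lt_of_le (by positivity) h3
      exact (pos_iff_pos_of_mul_pos this).1 hρ0
    have h4 : |hierAvg ω κ f (n + 1) x| * Z.card ≤ ∑ z ∈ Z, |hierAvg ω κ f n z| := by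
      have : hierAvg ω κ f (n + 1) x = (∑ z ∈ Z, hierAvg ω κ f n z) / Z.card := rfl
      rw [this, abs_div, Nat.abs_cast, div_mul_cancel₀ _ hZpos.ne']
      exact Finset.abs_sum_le_sum_abs _ _
    have h5 : (∑ z ∈ Z, |hierAvg ω κ f n z|) * (ρ * N ^ κ n) ≤
        N ^ κ n * ∑ v ∈ hball (κ (n + 1)) x, |f v| := by
      rw [Finset.sum_mul, ← sum_sum_hball (hκ n.le_succ)]
      refine (Finset.sum_le_sum fun z hz => ih z ?_).trans ?_
      · rw [hZ, goodPoints, Finset.mem_filter] at hz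
        exact hz.2
      · exact Finset.sum_le_sum_of_subset_of_nonneg (Finset.filter_subset _ _)
          fun _ _ _ => Finset.sum_nonneg fun _ _ => abs_nonneg _
    have h6 : (∑ z ∈ Z, |hierAvg ω κ f n z|) * ρ ≤ ∑ v ∈ hball (κ (n + 1)) x, |f v| := by
      refine le_of_mul_le_mul_left ?_ (pow_pos hN (κ n))
      calc _ = (∑ z ∈ Z, |hierAvg ω κ f n z|) * (ρ * N ^ κ n) := by ring
        _ ≤ _ := h5
    calc _ ≤ |hierAvg ω κ f (n + 1) x| * (ρ * Z.card) :=
          mul_le_mul_of_nonneg_left h3 (abs_nonneg _)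
      _ = |hierAvg ω κ f (n + 1) x| * Z.card * ρ := by ring
      _ ≤ (∑ z ∈ Z, |hierAvg ω κ f n z|) * ρ := by gcongr
      _ ≤ _ := h6

/-- A finitely supported function is bounded by its Dirichlet energy at the points whose clusters
of all stages are nonempty. -/
theorem abs_le_of_ballEnergy_le (hκ : StrictMono κ) (hκ0 : κ 0 = 0) (hN2 : 2 ≤ N)
    (hM : ∀ n : ℕ, ((n : ℝ) + 2) ^ 2 * N ^ κ n ≤ N ^ κ (n + 1)) {δ : ℕ → ℝ}
    (hδ1 : ∀ n, (N : ℝ) ^ κ (n - 1) ≤ δ n ^ 2 * N ^ κ n)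
    (hδ2 : ∀ n, (N : ℝ) ^ κ n ≤ δ n ^ 2 * N ^ κ (n + 1))
    (hδ : ∀ n, 0 ≤ δ n) (hδ' : ∀ n, δ n ≤ 1) (hs : Summable δ) {x : HierGroup N} {n₀ : ℕ}
    (hx : x ∈ cluster ω κ n₀ x) (hne : ∀ n, n₀ ≤ n → (cluster ω κ n x).Nonempty)
    {D : ℝ} (hD : ∀ k, ballEnergy ω f k x ≤ D) (hf : f.support.Finite) :
    |f x| ≤ Real.exp (4 * ∑' i, δ i) * √D := by
  have hN : (1 : ℝ) < N := by exact_mod_cast hN2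
  have hdouble : ∀ n, 2 * N ^ κ n ≤ N ^ κ (n + 1) := by
    intro n
    have h1 := hM n
    have h2 : (0 : ℝ) ≤ N ^ κ n := by positivity
    have h3 : (2 : ℝ) * N ^ κ n ≤ N ^ κ (n + 1) := by
      refine le_trans ?_ h1
      gcongr
      nlinarith [(Nat.cast_nonneg n : (0 : ℝ) ≤ n)]
    exact_mod_cast h3
  have hmem : ∀ n, n₀ ≤ n → x ∈ cluster ω κ n x := by
    intro n hn
    induction n, hn using Nat.le_induction with
    | base => exact hx
    | succ n hn ih => exact cluster_subset_succ (mem_hball_self _ _) (hne _ (by omega)) ih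
  set L := ∑ v ∈ hf.toFinset, |f v| with hL
  have hsum : ∀ n, ∑ v ∈ hball (κ n) x, |f v| ≤ L := by
    intro n
    rw [hL, ← Finset.sum_filter_ne_zero]
    refine Finset.sum_le_sum_of_subset_of_nonneg (fun v hv => ?_) fun _ _ _ => abs_nonneg _
    simpa using (Finset.mem_filter.1 hv).2
  -- Only N^(κ n) ≥ N^n is used: a strictly increasing κ satisfies κ n ≥ n.
  have havg : ∀ n, n₀ ≤ n → |hierAvg ω κ f n x| ≤ 2 * L * ((1 : ℝ) / N) ^ n := by
    intro n hn
    have h1 := (abs_hierAvg_mul_le (f := f) hκ.monotone hκ0 hM n x (hne n hn)).trans (hsum n)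
    have h2 : (1 : ℝ) / 2 * N ^ n ≤ ((n : ℝ) + 2) / (2 * (n + 1)) * N ^ κ n := by
      have h3 : (1 : ℝ) / 2 ≤ ((n : ℝ) + 2) / (2 * (n + 1)) := by
        rw [div_le_div_iff₀ (by positivity) (by positivity)]
        linarith
      gcongr
      · exact hN.le
      · exact hκ.le_apply
    have h4 : |hierAvg ω κ f n x| * (1 / 2 * N ^ n) ≤ L :=
      (mul_le_mul_of_nonneg_left h2 (abs_nonneg _)).trans h1
    rw [one_div, inv_pow, ← div_eq_mul_inv, le_div_iff₀ (by positivity)]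
    linarith
  have hbound : ∀ n, n₀ ≤ n →
      |f x| ≤ Real.exp (4 * ∑' i, δ i) * √D + 2 * L * ((1 : ℝ) / N) ^ n := by
    intro n hn
    have h1 := abs_sub_hierAvg_le (f := f) hκ.monotone hκ0 hdouble hδ1 hδ2 hδ hδ' n x (hmem n hn)
    have h2 : oscConst δ n * √(ballEnergy ω f (κ n) x) ≤ Real.exp (4 * ∑' i, δ i) * √D :=
      mul_le_mul (oscConst_le hδ hs n) (Real.sqrt_le_sqrt (hD _)) (Real.sqrt_nonneg _)
        (Real.exp_pos _).le
    have h3 := havg n hn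
    have h4 : |f x| ≤ |f x - hierAvg ω κ f n x| + |hierAvg ω κ f n x| := by
      simpa using abs_add_le (f x - hierAvg ω κ f n x) (hierAvg ω κ f n x)
    linarith
  have hlim : Filter.Tendsto (fun n : ℕ => Real.exp (4 * ∑' i, δ i) * √D +
      2 * L * ((1 : ℝ) / N) ^ n) Filter.atTop (nhds (Real.exp (4 * ∑' i, δ i) * √D + 2 * L * 0)) :=
    ((tendsto_pow_atTop_nhds_zero_of_lt_one (by positivity)
      (by rw [div_lt_one (by linarith)]; exact hN)).const_mul _).const_add _
  rw [mul_zero, add_zero] at hlim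
  exact ge_of_tendsto hlim (Filter.eventually_atTop.2 ⟨n₀, hbound⟩)

end Poincare

end HierGroup

/-! ### Finite-dimensional independence for product Bernoulli measures. -/

section BernoulliField

variable {E : Type*}

/-- The law of independent Bernoulli variables with parameters `q e`. -/
def bernoulliField (q : E → unitInterval) : Measure (E → Bool) :=
  Measure.infinitePi fun e => bernoulliMeasure true false (q e)

instance (q : E → unitInterval) : IsProbabilityMeasure (bernoulliField q) := by
  unfold bernoulliField; infer_instance

theorem measurableSet_of_dependsOn {A : Set (E → Bool)} {I : Finset E}
    (h : DependsOn (fun ω => ω ∈ A) (I : Set E)) : MeasurableSet A := by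
  have : A = (I.restrict : (E → Bool) → I → Bool) ⁻¹' (I.restrict '' A) := by
    ext ω
    constructor
    · exact fun hω => ⟨ω, hω, rfl⟩
    · rintro ⟨ω', hω', he⟩
      have : (ω' ∈ A) = (ω ∈ A) := h fun e he' => congrFun he ⟨e, he'⟩
      exact this ▸ hω'
  rw [this]
  exact Finset.measurable_restrict I (Set.toFinite _).measurableSet

theorem measure_inter_of_dependsOn (q : E → unitInterval) {A B : Set (E → Bool)} {I J : Finset E}
    (hA : DependsOn (fun ω => ω ∈ A) (I : Set E)) (hB : DependsOn (fun ω => ω ∈ B) (J : Set E))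
    (hIJ : Disjoint I J) :
    (bernoulliField q).real (A ∩ B) = (bernoulliField q).real A * (bernoulliField q).real B := by
  have hind : iIndepFun (fun (e : E) (ω : E → Bool) => ω e) (bernoulliField q) :=
    iIndepFun_infinitePi (X := fun _ => id) fun _ => measurable_id
  have h2 := hind.indepFun_finset I J hIJ fun e => measurable_pi_apply e
  have key : ∀ {A : Set (E → Bool)} {I : Finset E}, DependsOn (fun ω => ω ∈ A) (I : Set E) →
      A = (fun (a : E → Bool) (i : I) => a i) ⁻¹' ((fun (a : E → Bool) (i : I) => a i) '' A) := by
    intro A I h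
    ext ω
    constructor
    · exact fun hω => ⟨ω, hω, rfl⟩
    · rintro ⟨ω', hω', he⟩
      have : (ω' ∈ A) = (ω ∈ A) := h fun e he' => congrFun he ⟨e, he'⟩
      exact this ▸ hω'
  have h3 := h2.measure_inter_preimage_eq_mul ((fun (a : E → Bool) (i : I) => a i) '' A)
    ((fun (a : E → Bool) (i : J) => a i) '' B) (Set.toFinite _).measurableSet
    (Set.toFinite _).measurableSet
  rw [← key hA, ← key hB] at h3
  rw [measureReal_def, h3, ENNReal.toReal_mul]; rfl

theorem dependsOn_forall_eq_false (F : Finset E) :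
    DependsOn (fun ω : E → Bool => ω ∈ {ω : E → Bool | ∀ e ∈ F, ω e = false}) (F : Set E) := by
  intro ω ω' h
  simp only [Set.mem_ofPred_eq, eq_iff_iff]
  exact forall₂_congr fun e he => by rw [h e he]

theorem measure_forall_eq_false (q : E → unitInterval) (F : Finset E) :
    (bernoulliField q).real {ω | ∀ e ∈ F, ω e = false} = ∏ e ∈ F, (1 - (q e : ℝ)) := by
  have : {ω : E → Bool | ∀ e ∈ F, ω e = false} = Set.pi F fun _ => {false} := by
    ext ω; simp [Set.mem_pi]
  rw [this, measureReal_def, bernoulliField,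
    Measure.infinitePi_pi _ fun _ _ => measurableSet_singleton _, ENNReal.toReal_prod]
  refine Finset.prod_congr rfl fun e _ => ?_
  rw [← measureReal_def, bernoulliMeasure_real_apply _ (measurableSet_singleton _)]
  simp

theorem measure_eq_true (q : E → unitInterval) (e : E) :
    bernoulliField q {ω | ω e = true} = ENNReal.ofReal (q e) := by
  have : {ω : E → Bool | ω e = true} = Set.pi (({e} : Finset E) : Set E) fun _ => {true} := by
    ext ω; simp
  rw [this, bernoulliField, Measure.infinitePi_pi _ fun _ _ => measurableSet_singleton _]
  rw [Finset.prod_singleton, bernoulliMeasure_apply _ (measurableSet_singleton _)]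
  simp
  exact (ENNReal.ofReal_eq_coe_nnreal _).symm

/-- A conditional probability bound: if, given the variables in `I`, the event `B` depends on
variables outside of `I` only and has probability at most `ε`, then it has conditional probability
at most `ε` given any event depending on `I`. -/
theorem measure_conditional_le (q : E → unitInterval) {A : Set (E → Bool)} {I : Finset E}
    (hA : DependsOn (fun ω => ω ∈ A) (I : Set E)) (B : (E → Bool) → Set (E → Bool))
    (hB : DependsOn B (I : Set E)) (J : (E → Bool) → Finset E)
    (hJ : ∀ ω ∈ A, DependsOn (fun ω' => ω' ∈ B ω) (J ω : Set E))
    (hIJ : ∀ ω ∈ A, Disjoint I (J ω)) {ε : ℝ}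
    (hε : ∀ ω ∈ A, (bernoulliField q).real (B ω) ≤ ε) :
    (bernoulliField q).real {ω | ω ∈ A ∧ ω ∈ B ω} ≤ ε * (bernoulliField q).real A := by
  classical
  set μ := bernoulliField q
  set r : (E → Bool) → (I → Bool) := fun ω i => ω i with hr
  set S : (I → Bool) → Set (E → Bool) := fun c => {ω | ω ∈ A ∧ r ω = c} with hS
  have hdep : ∀ c, DependsOn (fun ω => ω ∈ S c) (I : Set E) := by
    intro c ω ω' h
    have h1 : (ω ∈ A) = (ω' ∈ A) := hA h
    have h2 : r ω = r ω' := by ext i; exact h i i.2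
    simp only [hS, Set.mem_ofPred_eq, h1, h2]
  have h1 : {ω | ω ∈ A ∧ ω ∈ B ω} ⊆ ⋃ c ∈ (Finset.univ : Finset (I → Bool)),
      {ω | ω ∈ S c ∧ ω ∈ B ω} := by
    intro ω hω
    simp only [Finset.mem_univ, Set.iUnion_true, Set.mem_iUnion]
    exact ⟨r ω, ⟨hω.1, rfl⟩, hω.2⟩
  -- On an atom of the finitely many variables in `I` the random event `B ω` is one fixed event,
  -- depending only on variables outside `I`.
  have h2 : ∀ c, μ.real {ω | ω ∈ S c ∧ ω ∈ B ω} ≤ ε * μ.real (S c) := by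
    intro c
    by_cases hc : (S c).Nonempty
    · obtain ⟨ω₀, hω₀⟩ := hc
      have h3 : {ω | ω ∈ S c ∧ ω ∈ B ω} = S c ∩ B ω₀ := by
        ext ω
        simp only [Set.mem_ofPred_eq, Set.mem_inter_iff]
        refine and_congr_right fun hω => ?_
        rw [hB (x := ω) (y := ω₀) fun e he => congrFun (hω.2.trans hω₀.2.symm) ⟨e, he⟩]
      rw [h3, measure_inter_of_dependsOn q (hdep c) (hJ ω₀ hω₀.1) (hIJ ω₀ hω₀.1), mul_comm]
      exact mul_le_mul_of_nonneg_right (hε ω₀ hω₀.1) measureReal_nonneg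
    · rw [Set.not_nonempty_iff_eq_empty] at hc
      simp [hc]
  calc μ.real {ω | ω ∈ A ∧ ω ∈ B ω} ≤ μ.real (⋃ c ∈ (Finset.univ : Finset (I → Bool)),
        {ω | ω ∈ S c ∧ ω ∈ B ω}) := measureReal_mono h1 (measure_ne_top _ _)
    _ ≤ ∑ c, μ.real {ω | ω ∈ S c ∧ ω ∈ B ω} := measureReal_biUnion_finset_le _ _
    _ ≤ ∑ c, ε * μ.real (S c) := Finset.sum_le_sum fun c _ => h2 c
    _ = ε * ∑ c, μ.real (S c) := by rw [Finset.mul_sum]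
    _ = ε * μ.real (⋃ c ∈ (Finset.univ : Finset (I → Bool)), S c) := by
        rw [measureReal_biUnion_finset]
        · intro c _ c' _ hcc'
          refine Set.disjoint_left.2 fun ω h h' => hcc' (h.2.symm.trans h'.2)
        · exact fun c _ => measurableSet_of_dependsOn (hdep c)
    _ = ε * μ.real A := by
        congr 2
        ext ω
        simp [hS]

end BernoulliField

namespace HierGroup

/-! ### Probability that a ball is bad. -/

section BadBalls

variable {N : ℕ} [NeZero N] {κ : ℕ → ℕ}

/-- The construction only consults pairs inside the ball. Hence disjoint balls are independent, and
the pairs between them remain fresh once their clusters are known. -/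
theorem cluster_eq_of_agree (hκ : Monotone κ) (n : ℕ) :
    ∀ {ω ω' : Sym2 (HierGroup N) → Bool} (x : HierGroup N),
      (∀ e ∈ (hball (κ n) x).sym2, ω e = ω' e) → cluster ω κ n x = cluster ω' κ n x := by
  classical
  induction n using Nat.strong_induction_on with
  | _ n ih =>
  intro ω ω' x h
  cases n with
  | zero => rfl
  | succ n =>
    have hn : ∀ m ≤ n, ∀ y ∈ hball (κ (n + 1)) x, cluster ω κ m y = cluster ω' κ m y := by
      intro m hm y hy
      refine ih m (by omega) y fun e he => h e ?_
      exact Finset.sym2_mono (hball_subset_of_mem (hκ (by omega)) hy) he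
    have hM : Merges ω (κ n) (κ (n + 1)) (cluster ω κ (n - 1)) (cluster ω κ n) x ↔
        Merges ω' (κ n) (κ (n + 1)) (cluster ω' κ (n - 1)) (cluster ω' κ n) x := by
      unfold Merges
      refine and_congr (exists_congr fun w => forall₂_congr fun y hy => ?_)
        (forall₂_congr fun y hy => forall₂_congr fun z hz => imp_congr_right fun _ => ?_)
      · rw [hn n le_rfl y hy]
      · unfold Joined
        rw [hn (n - 1) (by omega) y hy, hn n le_rfl y hy, hn n le_rfl z hz]
        refine imp_congr_right fun _ => imp_congr_right fun _ => imp_congr_right fun _ => ?_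
        refine exists_congr fun u => and_congr_right fun hu => exists_congr fun v =>
          and_congr_right fun hv => ?_
        rw [h]
        refine Finset.mk_mem_sym2_iff.2 ⟨?_, ?_⟩
        · exact hball_subset_of_mem (hκ (by omega)) hy (cluster_subset hκ _ _ hu)
        · exact hball_subset_of_mem (hκ (by omega)) hz (cluster_subset hκ _ _ hv)
    rw [cluster_succ, cluster_succ, Finset.biUnion_congr rfl (hn n le_rfl)]
    by_cases h' : Merges ω (κ n) (κ (n + 1)) (cluster ω κ (n - 1)) (cluster ω κ n) x
    · rw [if_pos h', if_pos (hM.1 h')]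
    · rw [if_neg h', if_neg (fun h'' => h' (hM.2 h''))]

/-- The law of the open pairs when pairs at distance `k` are open with probability `p k`. -/
def edgeLaw (N : ℕ) (p : ℕ → unitInterval) : Measure (Sym2 (HierGroup N) → Bool) :=
  bernoulliField fun e => p (edgeLength e)

instance (p : ℕ → unitInterval) : IsProbabilityMeasure (edgeLaw N p) := by
  unfold edgeLaw; infer_instance

/-- The set of the pairs joining two sets of points. -/
def pairs (S T : Finset (HierGroup N)) : Finset (Sym2 (HierGroup N)) :=
  (S ×ˢ T).image fun z => s(z.1, z.2)

omit [NeZero N] in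
theorem mem_pairs {S T : Finset (HierGroup N)} {e : Sym2 (HierGroup N)} :
    e ∈ pairs S T ↔ ∃ u ∈ S, ∃ v ∈ T, s(u, v) = e := by
  simp [pairs, and_assoc]

omit [NeZero N] in
theorem prod_pairs {S T : Finset (HierGroup N)} (h : Disjoint S T)
    (g : Sym2 (HierGroup N) → ℝ) :
    ∏ e ∈ pairs S T, g e = ∏ u ∈ S, ∏ v ∈ T, g s(u, v) := by
  unfold pairs
  rw [Finset.prod_image, Finset.prod_product]
  rintro ⟨u, v⟩ huv ⟨u', v'⟩ huv' he
  simp only [Finset.coe_product, Set.mem_prod, Finset.mem_coe] at huv huv'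
  rcases Sym2.eq_iff.1 he with ⟨h1, h2⟩ | ⟨h1, h2⟩
  · exact Prod.ext h1 h2
  · have h1' : u = v' := h1
    subst h1'
    exact absurd huv'.2 (Finset.disjoint_left.1 h huv.1)

variable {p : ℕ → unitInterval} {C₂ α : ℝ}

theorem connection_lower_bound (hC₂ : 0 ≤ C₂) (hα : 0 ≤ α)
    (hp : ∀ k : ℕ, 1 ≤ k → 1 - (p k : ℝ) ≤ Real.exp (-(C₂ * (k : ℝ) ^ α / (N : ℝ) ^ (2 * k))))
    {a b : ℕ} {x u v : HierGroup N} (hu : u ∈ hball b x) (hv : v ∈ hball b x)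
    (huv : v ∉ hball a u) :
    1 - (p (hdist u v) : ℝ) ≤ Real.exp (-(C₂ * ((a : ℝ) + 1) ^ α / (N : ℝ) ^ (2 * b))) := by
  have h1 : a + 1 ≤ hdist u v := by
    rw [mem_hball_iff_hdist] at huv; omega
  have h2 : hdist u v ≤ b := by
    rw [← mem_hball_iff_hdist, hball_eq_of_mem hu]; exact hv
  have hN : (1 : ℝ) ≤ N := by exact_mod_cast NeZero.pos N
  refine (hp _ (by omega)).trans (Real.exp_le_exp.2 (neg_le_neg ?_))
  have h3 : (a : ℝ) + 1 ≤ hdist u v := by exact_mod_cast h1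
  gcongr

/-- The probability that two consecutive clusters of large size are not joined. -/
theorem measure_not_joined_le (hκ : StrictMono κ) (hκ0 : κ 0 = 0)
    (hM : ∀ n : ℕ, ((n : ℝ) + 2) ^ 2 * N ^ κ n ≤ N ^ κ (n + 1))
    (hC₂ : 0 ≤ C₂) (hα : 0 ≤ α)
    (hp : ∀ k : ℕ, 1 ≤ k → 1 - (p k : ℝ) ≤ Real.exp (-(C₂ * (k : ℝ) ^ α / (N : ℝ) ^ (2 * k))))
    (n : ℕ) {x y z : HierGroup N} (hy : y ∈ hball (κ (n + 1)) x) (hz : z ∈ hball (κ (n + 1)) x)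
    (hyz : z ∉ hball (κ n) y) :
    (edgeLaw N p).real {ω | ¬ Joined ω (cluster ω κ (n - 1)) (cluster ω κ n) y z} ≤
      Real.exp (-(C₂ * ((n : ℝ) + 1) ^ α * (N ^ κ (n - 1) * N ^ κ n) /
        (4 * (N : ℝ) ^ (2 * κ (n + 1))))) := by
  set ε := Real.exp (-(C₂ * ((n : ℝ) + 1) ^ α * (N ^ κ (n - 1) * N ^ κ n) /
        (4 * (N : ℝ) ^ (2 * κ (n + 1))))) with hε
  have hN : (0 : ℝ) < N := Nat.cast_pos.2 (NeZero.pos N)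
  set I : Finset (Sym2 (HierGroup N)) := (hball (κ n) y).sym2 ∪ (hball (κ n) z).sym2 with hI
  have hP : ∀ ω ω' : Sym2 (HierGroup N) → Bool, (∀ e ∈ (I : Set _), ω e = ω' e) →
      cluster ω κ (n - 1) y = cluster ω' κ (n - 1) y := fun ω ω' h =>
    cluster_eq_of_agree hκ.monotone _ _ fun e he => h e (Finset.mem_union_left _
      (Finset.sym2_mono (hball_mono (hκ.monotone (Nat.sub_le _ _)) y) he))
  have hQ' : ∀ ω ω' : Sym2 (HierGroup N) → Bool, (∀ e ∈ (I : Set _), ω e = ω' e) →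
      cluster ω κ n z = cluster ω' κ n z := fun ω ω' h =>
    cluster_eq_of_agree hκ.monotone _ _ fun e he => h e (Finset.mem_union_right _ he)
  have hsubP : ∀ ω, cluster ω κ (n - 1) y ⊆ hball (κ n) y := fun ω =>
    (cluster_subset hκ.monotone _ _).trans (hball_mono (hκ.monotone (Nat.sub_le _ _)) y)
  have hsubQ : ∀ ω, cluster ω κ n z ⊆ hball (κ n) z := fun ω => cluster_subset hκ.monotone _ _
  have hdisj : Disjoint (hball (κ n) y) (hball (κ n) z) := by
    rw [Finset.disjoint_left]
    intro w h1 h2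
    exact hyz (by rw [← hball_eq_of_mem h1]; exact mem_hball_comm.1 h2)
  set A : Set (Sym2 (HierGroup N) → Bool) := {ω | (cluster ω κ (n - 1) y).Nonempty ∧
    (cluster ω κ n z).Nonempty} with hA
  set J : (Sym2 (HierGroup N) → Bool) → Finset (Sym2 (HierGroup N)) := fun ω =>
    pairs (cluster ω κ (n - 1) y) (cluster ω κ n z) with hJ
  have hbound := measure_conditional_le (fun e => p (edgeLength e)) (A := A) (I := I) (ε := ε)
    (by
      intro ω ω' h
      simp only [hA, Set.mem_ofPred_eq, hP ω ω' h, hQ' ω ω' h])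
    (fun ω => {ω' | ∀ e ∈ J ω, ω' e = false})
    (by
      intro ω ω' h
      simp only [hJ, hP ω ω' h, hQ' ω ω' h])
    J (fun ω _ => dependsOn_forall_eq_false _)
    (by
      intro ω _
      rw [Finset.disjoint_right]
      intro e he
      obtain ⟨u, hu, v, hv, rfl⟩ := mem_pairs.1 he
      rw [hI, Finset.mem_union, Finset.mk_mem_sym2_iff, Finset.mk_mem_sym2_iff]
      rintro (h | h)
      · exact Finset.disjoint_left.1 hdisj h.2 (hsubQ ω hv)
      · exact Finset.disjoint_left.1 hdisj (hsubP ω hu) h.1)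
    (by
      intro ω hω
      rw [measure_forall_eq_false, prod_pairs (Finset.disjoint_of_subset_left (hsubP ω)
        (Finset.disjoint_of_subset_right (hsubQ ω) hdisj))]
      set θ := C₂ * ((n : ℝ) + 1) ^ α / (N : ℝ) ^ (2 * κ (n + 1)) with hθ
      have h1 : ∀ u ∈ cluster ω κ (n - 1) y, ∏ v ∈ cluster ω κ n z,
          (1 - (p (edgeLength s(u, v)) : ℝ)) ≤ Real.exp (-θ) ^ (cluster ω κ n z).card := by
        intro u hu
        rw [← Finset.prod_const]
        · refine Finset.prod_le_prod (fun v _ => sub_nonneg.2 (p _).2.2) fun v hv => ?_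
          refine (connection_lower_bound (a := κ n) (b := κ (n + 1)) hC₂ hα hp
            (hball_subset_of_mem (hκ.monotone n.le_succ) hy (hsubP ω hu))
            (hball_subset_of_mem (hκ.monotone n.le_succ) hz (hsubQ ω hv)) ?_).trans ?_
          · rw [hball_eq_of_mem (hsubP ω hu)]
            exact fun h => Finset.disjoint_left.1 hdisj h (hsubQ ω hv)
          · refine Real.exp_le_exp.2 (neg_le_neg ?_)
            -- Two points in different sub-balls are at distance at least κ n + 1, hence at least n
            -- + 1. This cruder bound suffices.
            have : (n : ℝ) ≤ κ n := by exact_mod_cast hκ.le_apply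
            rw [hθ]
            gcongr
      have h2 : ∏ u ∈ cluster ω κ (n - 1) y, ∏ v ∈ cluster ω κ n z,
          (1 - (p (edgeLength s(u, v)) : ℝ)) ≤
          (Real.exp (-θ) ^ (cluster ω κ n z).card) ^ (cluster ω κ (n - 1) y).card := by
        refine (Finset.prod_le_prod (fun u _ => Finset.prod_nonneg fun v _ =>
          sub_nonneg.2 (p _).2.2) h1).trans ?_
        rw [Finset.prod_const]
      refine h2.trans ?_
      rw [← Real.exp_nat_mul, ← Real.exp_nat_mul, hε]
      refine Real.exp_le_exp.2 ?_
      have hθ0 : 0 ≤ θ := by positivity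
      have h3 := half_le_card_cluster hκ.monotone hκ0 hM _ _ hω.1
      have h4 := half_le_card_cluster hκ.monotone hκ0 hM _ _ hω.2
      -- Both clusters fill half of their balls; this is the factor 4 in the exponent.
      have h5 : (1 / 2 * (N : ℝ) ^ κ (n - 1)) * (1 / 2 * (N : ℝ) ^ κ n) ≤
          (cluster ω κ (n - 1) y).card * (cluster ω κ n z).card := by
        gcongr
      have h6 : C₂ * ((n : ℝ) + 1) ^ α * (N ^ κ (n - 1) * N ^ κ n) /
          (4 * (N : ℝ) ^ (2 * κ (n + 1))) =
          θ * ((1 / 2 * (N : ℝ) ^ κ (n - 1)) * (1 / 2 * (N : ℝ) ^ κ n)) := by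
        rw [hθ]; field_simp; norm_num
      rw [h6]
      have := mul_le_mul_of_nonneg_left h5 hθ0
      nlinarith)
  refine le_trans (measureReal_mono ?_ (measure_ne_top _ _)) (hbound.trans ?_)
  · intro ω hω
    simp only [Joined, Set.mem_ofPred_eq] at hω
    push Not at hω
    obtain ⟨h1, h2, h3, h4⟩ := hω
    refine ⟨⟨h1, h3⟩, fun e he => ?_⟩
    obtain ⟨u, hu, v, hv, rfl⟩ := mem_pairs.1 he
    simpa using h4 u hu v hv
  · exact mul_le_of_le_one_right (Real.exp_pos _).le measureReal_le_one

/-- The recursion for the probabilities of bad balls. -/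
theorem measure_bad_succ_le (hN2 : 2 ≤ N) (hκ : StrictMono κ) (hκ0 : κ 0 = 0)
    {n : ℕ} {b ε : ℝ} (hb : ∀ y, (edgeLaw N p).real {ω | cluster ω κ n y = ∅} ≤ b)
    (x : HierGroup N) (hε0 : 0 ≤ ε)
    (hε : ∀ y ∈ hball (κ (n + 1)) x, ∀ z ∈ hball (κ (n + 1)) x, z ∉ hball (κ n) y →
      (edgeLaw N p).real {ω | ¬ Joined ω (cluster ω κ (n - 1)) (cluster ω κ n) y z} ≤ ε) :
    (edgeLaw N p).real {ω | cluster ω κ (n + 1) x = ∅} ≤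
      (N : ℝ) ^ (κ (n + 1) - κ n) * N ^ (κ (n + 1) - κ n) * (b * b) +
      N ^ (κ (n + 1) - κ (n - 1)) * N ^ (κ (n + 1) - κ n) * ε := by
  classical
  set μ := edgeLaw N p with hμ
  have hb0 : 0 ≤ b := le_trans measureReal_nonneg (hb x)
  obtain ⟨t, htsub, htcard, ht⟩ := exists_representatives (κ n) (κ (n + 1)) x
  obtain ⟨s, hssub, hscard, hs⟩ := exists_representatives (κ (n - 1)) (κ (n + 1)) x
  set T := (t ×ˢ t).filter fun a => a.2 ∉ hball (κ n) a.1 with hT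
  set S := (s ×ˢ t).filter fun a => a.2 ∉ hball (κ n) a.1 with hS
  -- A bad ball contains either two disjoint bad sub-balls, which are independent, or a failed join.
  -- The union bound runs over representatives of the sub-balls.
  have hcover : {ω | cluster ω κ (n + 1) x = ∅} ⊆
      (⋃ a ∈ T, {ω | cluster ω κ n a.1 = ∅} ∩ {ω | cluster ω κ n a.2 = ∅}) ∪
      ⋃ a ∈ S, {ω | ¬ Joined ω (cluster ω κ (n - 1)) (cluster ω κ n) a.1 a.2} := by
    intro ω hω
    rw [Set.mem_ofPred_eq, cluster_succ] at hω
    by_cases hbad : ∃ w, ∀ y ∈ hball (κ (n + 1)) x, cluster ω κ n y = ∅ → y ∈ hball (κ n) w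
    · right
      -- Merging with an empty result would make every sub-ball empty, whereas all empty ones fit
      -- into a single sub-ball.
      have hnm : ¬ Merges ω (κ n) (κ (n + 1)) (cluster ω κ (n - 1)) (cluster ω κ n) x := by
        intro hm
        rw [if_pos hm, ← Finset.not_nonempty_iff_eq_empty, Finset.biUnion_nonempty] at hω
        push Not at hω
        obtain ⟨w, hw⟩ := hbad
        have : hball (κ (n + 1)) x ⊆ hball (κ n) w := fun y hy => hw y hy (by simpa using hω y hy)
        have hc := Finset.card_le_card this
        rw [card_hball, card_hball] at hc
        exact absurd hc (not_le.2 (Nat.pow_lt_pow_right (by omega) (hκ n.lt_succ_self)))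
      have hnj : ∃ y ∈ hball (κ (n + 1)) x, ∃ z ∈ hball (κ (n + 1)) x, z ∉ hball (κ n) y ∧
          ¬ Joined ω (cluster ω κ (n - 1)) (cluster ω κ n) y z := by
        by_contra hcon
        push Not at hcon
        exact hnm ⟨hbad, hcon⟩
      obtain ⟨y, hy, z, hz, hyz, hj⟩ := hnj
      obtain ⟨y', hy', hyy'⟩ := hs y hy
      obtain ⟨z', hz', hzz'⟩ := ht z hz
      have hyy'' : y ∈ hball (κ n) y' := hball_mono (hκ.monotone (Nat.sub_le _ _)) _ hyy'
      refine Set.mem_biUnion (x := (y', z')) ?_ ?_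
      · simp only [hS, Finset.coe_filter, Finset.mem_product, Set.mem_ofPred_eq]
        refine ⟨⟨hy', hz'⟩, fun h => hyz ?_⟩
        rw [hball_eq_of_mem hyy'', ← hball_eq_of_mem h]
        exact hzz'
      · simp only [Set.mem_ofPred_eq, Joined] at hj ⊢
        rwa [← cluster_congr hκ0 _ hyy', ← cluster_congr hκ0 _ hyy'', ← cluster_congr hκ0 _ hzz']
    · left
      push Not at hbad
      -- The centre `x` is arbitrary here and only yields a first bad sub-ball; recentring at it
      -- yields a second one.
      obtain ⟨y, hy, hyb, -⟩ := hbad x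
      obtain ⟨z, hz, hzb, hzy⟩ := hbad y
      obtain ⟨y', hy', hyy'⟩ := ht y hy
      obtain ⟨z', hz', hzz'⟩ := ht z hz
      refine Set.mem_biUnion (x := (y', z')) ?_ ?_
      · simp only [hT, Finset.coe_filter, Finset.mem_product, Set.mem_ofPred_eq]
        refine ⟨⟨hy', hz'⟩, fun h => hzy ?_⟩
        rw [hball_eq_of_mem hyy', ← hball_eq_of_mem h]
        exact hzz'
      · rw [cluster_congr hκ0 _ hyy'] at hyb
        rw [cluster_congr hκ0 _ hzz'] at hzb
        exact ⟨hyb, hzb⟩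
  have hTcard : (T.card : ℝ) ≤ (N : ℝ) ^ (κ (n + 1) - κ n) * N ^ (κ (n + 1) - κ n) := by
    have := Finset.card_filter_le (t ×ˢ t) fun a => a.2 ∉ hball (κ n) a.1
    rw [Finset.card_product, htcard] at this
    exact_mod_cast this
  have hScard : (S.card : ℝ) ≤ (N : ℝ) ^ (κ (n + 1) - κ (n - 1)) * N ^ (κ (n + 1) - κ n) := by
    have := Finset.card_filter_le (s ×ˢ t) fun a => a.2 ∉ hball (κ n) a.1
    rw [Finset.card_product, htcard, hscard] at this
    exact_mod_cast this
  have hdep : ∀ y, DependsOn (fun ω => ω ∈ {ω | cluster ω κ n y = ∅})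
      ((hball (κ n) y).sym2 : Set (Sym2 (HierGroup N))) := by
    intro y ω ω' h
    simp only [Set.mem_ofPred_eq]
    rw [cluster_eq_of_agree hκ.monotone n y fun e he => h e he]
  have h1 : μ.real (⋃ a ∈ T, {ω | cluster ω κ n a.1 = ∅} ∩ {ω | cluster ω κ n a.2 = ∅}) ≤
      (N : ℝ) ^ (κ (n + 1) - κ n) * N ^ (κ (n + 1) - κ n) * (b * b) := by
    refine (measureReal_biUnion_finset_le _ _).trans ?_
    refine (Finset.sum_le_card_nsmul _ _ (b * b) fun a ha => ?_).trans ?_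
    · rw [hμ, edgeLaw, measure_inter_of_dependsOn _ (hdep a.1) (hdep a.2)]
      · exact mul_le_mul (hb _) (hb _) measureReal_nonneg hb0
      · rw [Finset.disjoint_left]
        intro e
        induction e using Sym2.ind with
        | _ u v =>
          rw [Finset.mk_mem_sym2_iff, Finset.mk_mem_sym2_iff]
          rintro ⟨hu, -⟩ ⟨hu', -⟩
          refine (Finset.mem_filter.1 ha).2 ?_
          rw [← hball_eq_of_mem hu]
          exact mem_hball_comm.1 hu'
    · rw [nsmul_eq_mul]
      exact mul_le_mul_of_nonneg_right hTcard (by positivity)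
  have h2 : μ.real (⋃ a ∈ S, {ω | ¬ Joined ω (cluster ω κ (n - 1)) (cluster ω κ n) a.1 a.2}) ≤
      (N : ℝ) ^ (κ (n + 1) - κ (n - 1)) * N ^ (κ (n + 1) - κ n) * ε := by
    refine (measureReal_biUnion_finset_le _ _).trans ?_
    refine (Finset.sum_le_card_nsmul _ _ ε fun a ha => ?_).trans ?_
    · rw [hS, Finset.mem_filter, Finset.mem_product] at ha
      exact (hε a.1 (hssub ha.1.1) a.2 (htsub ha.1.2) ha.2)
    · rw [nsmul_eq_mul]
      exact mul_le_mul_of_nonneg_right hScard hε0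
  exact (measureReal_mono hcover (measure_ne_top _ _)).trans
    ((measureReal_union_le _ _).trans (add_le_add h1 h2))

end BadBalls

/-! ### Choice of the scales and of the constants. -/

section Scales

/-- The increments of the scales: `N ^ scaleStep N θ n` is comparable to `(n + 2) ^ θ`. -/
def scaleStep (N : ℕ) (θ : ℝ) (n : ℕ) : ℕ := Nat.clog N ⌈((n : ℝ) + 2) ^ θ⌉₊

/-- The radii of the balls used in the renormalization. -/
def scale (N : ℕ) (θ : ℝ) (n : ℕ) : ℕ := ∑ i ∈ Finset.range n, scaleStep N θ i

variable {N : ℕ} {θ : ℝ}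

@[simp] theorem scale_zero : scale N θ 0 = 0 := by simp [scale]

theorem scale_succ (n : ℕ) : scale N θ (n + 1) = scale N θ n + scaleStep N θ n :=
  Finset.sum_range_succ _ _

theorem one_lt_rpow (hθ : 2 < θ) (n : ℕ) : 1 < ((n : ℝ) + 2) ^ θ :=
  Real.one_lt_rpow (by linarith [(Nat.cast_nonneg n : (0 : ℝ) ≤ n)]) (by linarith)

theorem rpow_le_pow_scaleStep (hN : 2 ≤ N) (n : ℕ) :
    ((n : ℝ) + 2) ^ θ ≤ (N : ℝ) ^ scaleStep N θ n := by
  have h1 : ⌈((n : ℝ) + 2) ^ θ⌉₊ ≤ N ^ scaleStep N θ n := Nat.le_pow_clog (by omega) _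
  exact (Nat.le_ceil _).trans (by exact_mod_cast h1)

theorem pow_scaleStep_le (hN : 2 ≤ N) (hθ : 2 < θ) (n : ℕ) :
    (N : ℝ) ^ scaleStep N θ n ≤ 2 * N * ((n : ℝ) + 2) ^ θ := by
  have h0 := one_lt_rpow hθ n
  have h1 : 1 < ⌈((n : ℝ) + 2) ^ θ⌉₊ := by
    rw [Nat.lt_ceil]; exact_mod_cast h0
  have h2 : N ^ (scaleStep N θ n).pred < ⌈((n : ℝ) + 2) ^ θ⌉₊ :=
    Nat.pow_pred_clog_lt_self (by omega) h1
  have h3 : 0 < scaleStep N θ n := Nat.clog_pos (by omega) h1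
  have h4 : (N : ℝ) ^ (scaleStep N θ n).pred ≤ ((n : ℝ) + 2) ^ θ + 1 := by
    refine le_trans (by exact_mod_cast h2.le) (Nat.ceil_lt_add_one (by linarith)).le
  calc (N : ℝ) ^ scaleStep N θ n = N * (N : ℝ) ^ (scaleStep N θ n).pred := by
        conv_lhs => rw [← Nat.succ_pred_eq_of_pos h3, pow_succ]
        ring
    _ ≤ N * (2 * ((n : ℝ) + 2) ^ θ) := by gcongr; linarith
    _ = _ := by ring

theorem scale_strictMono (hN : 2 ≤ N) (hθ : 2 < θ) : StrictMono (scale N θ) := by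
  refine strictMono_nat_of_lt_succ fun n => ?_
  rw [scale_succ]
  have : 1 < ⌈((n : ℝ) + 2) ^ θ⌉₊ := by
    rw [Nat.lt_ceil]; exact_mod_cast one_lt_rpow hθ n
  have := Nat.clog_pos (b := N) (by omega) this
  unfold scaleStep
  omega

theorem sq_mul_pow_scale_le (hN : 2 ≤ N) (hθ : 2 < θ) (n : ℕ) :
    ((n : ℝ) + 2) ^ 2 * (N : ℝ) ^ scale N θ n ≤ (N : ℝ) ^ scale N θ (n + 1) := by
  rw [scale_succ, pow_add, mul_comm]
  gcongr
  refine le_trans ?_ (rpow_le_pow_scaleStep hN n)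
  rw [← Real.rpow_natCast]
  exact Real.rpow_le_rpow_of_exponent_le (by linarith [(Nat.cast_nonneg n : (0 : ℝ) ≤ n)])
    (by push_cast; exact hθ.le)

/-- The rate at which the oscillation over the stages decays. -/
def oscRate (θ : ℝ) (n : ℕ) : ℝ := ((n : ℝ) + 1) ^ (-(θ / 2))

theorem oscRate_nonneg (n : ℕ) : 0 ≤ oscRate θ n := by unfold oscRate; positivity

theorem oscRate_le_one (hθ : 2 < θ) (n : ℕ) : oscRate θ n ≤ 1 :=
  Real.rpow_le_one_of_one_le_of_nonpos (by linarith [(Nat.cast_nonneg n : (0 : ℝ) ≤ n)])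
    (by linarith)

theorem oscRate_sq (n : ℕ) : oscRate θ n ^ 2 = (((n : ℝ) + 1) ^ θ)⁻¹ := by
  unfold oscRate
  rw [← Real.rpow_natCast, ← Real.rpow_mul (by positivity), ← Real.rpow_neg (by positivity)]
  congr 1; push_cast; ring

theorem summable_nat_add_rpow {c : ℝ} (hc : c < -1) :
    Summable fun n : ℕ => ((n : ℝ) + 1) ^ c := by
  have h := (summable_nat_add_iff 1).2 (Real.summable_nat_rpow.2 hc)
  exact_mod_cast h

theorem summable_oscRate (hθ : 2 < θ) : Summable (oscRate θ) :=
  summable_nat_add_rpow (by linarith)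

theorem pow_scale_le_oscRate (hN : 2 ≤ N) (hθ : 2 < θ) (n : ℕ) :
    (N : ℝ) ^ scale N θ n ≤ oscRate θ n ^ 2 * (N : ℝ) ^ scale N θ (n + 1) := by
  rw [oscRate_sq, inv_mul_eq_div, le_div_iff₀ (by positivity), scale_succ, pow_add]
  gcongr
  refine le_trans ?_ (rpow_le_pow_scaleStep hN n)
  gcongr
  · linarith

theorem pow_scale_pred_le_oscRate (hN : 2 ≤ N) (n : ℕ) :
    (N : ℝ) ^ scale N θ (n - 1) ≤ oscRate θ n ^ 2 * (N : ℝ) ^ scale N θ n := by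
  cases n with
  -- Both powers are equal at `n = 0`, so the rate must be 1 there, as the shift by 1 in `oscRate`
  -- ensures.
  | zero => simp [oscRate]
  | succ n =>
    rw [oscRate_sq, inv_mul_eq_div, le_div_iff₀ (by positivity), scale_succ, pow_add,
      Nat.add_sub_cancel]
    gcongr
    refine le_trans (le_of_eq ?_) (rpow_le_pow_scaleStep hN n)
    push_cast
    congr 1
    ring

/-- The upper bound for the probability that a ball of stage `n` is bad. -/
def badBound (a θ : ℝ) (n : ℕ) : ℝ := a * ((n : ℝ) + 1) ^ (-(2 * θ))

theorem pow_scale_sub_le (hN : 2 ≤ N) (hθ : 2 < θ) (n : ℕ) :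
    (N : ℝ) ^ (scale N θ (n + 1) - scale N θ n) ≤ 2 * N * ((n : ℝ) + 2) ^ θ := by
  rw [scale_succ, Nat.add_sub_cancel_left]
  exact pow_scaleStep_le hN hθ n

theorem pow_scale_sub_pred_le (hN : 2 ≤ N) (hθ : 2 < θ) (n : ℕ) :
    (N : ℝ) ^ (scale N θ (n + 1) - scale N θ (n - 1)) ≤ (2 * N * ((n : ℝ) + 2) ^ θ) ^ 2 := by
  have hN' : (2 : ℝ) ≤ N := by exact_mod_cast hN
  have h1 : (1 : ℝ) ≤ 2 * N * ((n : ℝ) + 2) ^ θ := by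
    have := one_lt_rpow hθ n
    nlinarith
  cases n with
  | zero =>
    refine (pow_scale_sub_le hN hθ 0).trans ?_
    rw [sq]
    exact le_mul_of_one_le_left (by linarith) h1
  | succ n =>
    have : scale N θ (n + 1 + 1) - scale N θ (n + 1 - 1) =
        scaleStep N θ n + scaleStep N θ (n + 1) := by
      rw [scale_succ, scale_succ, Nat.add_sub_cancel]; omega
    rw [this, pow_add, sq]
    refine mul_le_mul ((pow_scaleStep_le hN hθ n).trans ?_) (pow_scaleStep_le hN hθ (n + 1))
      (by positivity) (by linarith)
    gcongr
    · linarith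

/-- With t = n + 2, each summand is at most half of a t^(-2θ). The first is of order t^(2θ) (a
t^(-2θ))², so it suffices that a be small. The second is t^(3θ) times a stretched exponential in
t^(α-3θ), which is negligible because α > 3θ. -/
theorem exists_constants (hN : 2 ≤ N) (hθ : 2 < θ) {α : ℝ} (hα : 3 * θ < α) :
    ∃ C a : ℝ, 0 < C ∧ 0 < a ∧ ∀ C₂, C ≤ C₂ → ∀ n : ℕ,
      (N : ℝ) ^ (scale N θ (n + 1) - scale N θ n) * N ^ (scale N θ (n + 1) - scale N θ n) *
        (badBound a θ n * badBound a θ n) +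
      N ^ (scale N θ (n + 1) - scale N θ (n - 1)) * N ^ (scale N θ (n + 1) - scale N θ n) *
        Real.exp (-(C₂ * ((n : ℝ) + 1) ^ α * (N ^ scale N θ (n - 1) * N ^ scale N θ n) /
        (4 * (N : ℝ) ^ (2 * scale N θ (n + 1))))) ≤ badBound a θ (n + 1) := by
  have hN' : (2 : ℝ) ≤ N := by exact_mod_cast hN
  have hN0 : (0 : ℝ) < N := by linarith
  -- Makes 4 N² a² 2^(4θ) equal to a/2; the powers of 2 come from bounding n + 1 below by t/2.
  set a : ℝ := 1 / (8 * N ^ 2 * 2 ^ (4 * θ)) with ha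
  have ha0 : 0 < a := by positivity
  set c : ℝ := 1 / (32 * N ^ 3 * 2 ^ α) with hc
  have hc0 : 0 < c := by positivity
  set γ : ℝ := α - 3 * θ with hγ
  have hγ0 : 0 < γ := by simp only [hγ]; linarith
  -- Through exp Y ≥ Y^k / k! with kγ ≥ 5θ, the exponential gives t^(-5θ): 3θ for the number of
  -- joins and 2θ for the target. The constant `L` absorbs k! and the factor 16 N³/a.
  obtain ⟨k, hk⟩ := exists_nat_ge (5 * θ / γ)
  have hk' : 5 * θ ≤ k * γ := by rwa [div_le_iff₀ hγ0] at hk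
  have hk0 : k ≠ 0 := by
    rintro rfl
    simp at hk'; linarith
  set L : ℝ := max 1 (k.factorial * (16 * N ^ 3) / a) with hL
  have hL1 : 1 ≤ L := le_max_left _ _
  refine ⟨L / c, a, by positivity, ha0, fun C₂ hC₂ n => ?_⟩
  have hC₂' : L ≤ C₂ * c := by rwa [div_le_iff₀ hc0] at hC₂
  have hC₂0 : 0 < C₂ := lt_of_lt_of_le (by positivity) hC₂
  set t : ℝ := (n : ℝ) + 2 with ht
  have ht0 : 0 < t := by positivity
  have ht2 : t / 2 ≤ (n : ℝ) + 1 := by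
    have := (Nat.cast_nonneg n : (0 : ℝ) ≤ n)
    simp only [ht]; linarith
  set M : ℝ := (N : ℝ) ^ (scale N θ (n + 1) - scale N θ n) with hM
  set M' : ℝ := (N : ℝ) ^ (scale N θ (n + 1) - scale N θ (n - 1)) with hM'
  have hMle : M ≤ 2 * N * t ^ θ := pow_scale_sub_le hN hθ n
  have hM'le : M' ≤ (2 * N * t ^ θ) ^ 2 := pow_scale_sub_pred_le hN hθ n
  have hM0 : 0 < M := by positivity
  have hM'0 : 0 < M' := by positivity
  have hMM : M' * M ≤ 8 * N ^ 3 * t ^ (3 * θ) := by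
    calc M' * M ≤ (2 * N * t ^ θ) ^ 2 * (2 * N * t ^ θ) := by gcongr
      _ = 8 * N ^ 3 * (t ^ θ) ^ 3 := by ring
      _ = _ := by
        rw [← Real.rpow_natCast (t ^ θ), ← Real.rpow_mul ht0.le]
        congr 2; push_cast; ring
  have hb : badBound a θ n ≤ a * 2 ^ (2 * θ) * t ^ (-(2 * θ)) := by
    unfold badBound
    rw [mul_assoc]
    refine mul_le_mul_of_nonneg_left ?_ ha0.le
    have h1 : ((n : ℝ) + 1) ^ (-(2 * θ)) ≤ (t / 2) ^ (-(2 * θ)) :=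
      Real.rpow_le_rpow_of_nonpos (by positivity) ht2 (by linarith)
    refine h1.trans (le_of_eq ?_)
    rw [Real.div_rpow ht0.le (by norm_num), Real.rpow_neg (by norm_num : (0 : ℝ) ≤ 2)]
    field_simp
  have hb0 : 0 ≤ badBound a θ n := by unfold badBound; positivity
  have htarget : badBound a θ (n + 1) = a * t ^ (-(2 * θ)) := by
    unfold badBound
    congr 2
    simp only [ht]; push_cast; ring
  have hpart1 : M * M * (badBound a θ n * badBound a θ n) ≤ a / 2 * t ^ (-(2 * θ)) := by
    calc M * M * (badBound a θ n * badBound a θ n) ≤ (2 * N * t ^ θ) * (2 * N * t ^ θ) *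
          ((a * 2 ^ (2 * θ) * t ^ (-(2 * θ))) * (a * 2 ^ (2 * θ) * t ^ (-(2 * θ)))) := by gcongr
      _ = 4 * N ^ 2 * a ^ 2 * ((2 : ℝ) ^ (2 * θ) * 2 ^ (2 * θ)) *
          (t ^ θ * t ^ θ * t ^ (-(2 * θ)) * t ^ (-(2 * θ))) := by ring
      _ = 4 * N ^ 2 * a ^ 2 * (2 : ℝ) ^ (4 * θ) * t ^ (-(2 * θ)) := by
          rw [← Real.rpow_add two_pos, ← Real.rpow_add ht0, ← Real.rpow_add ht0,
            ← Real.rpow_add ht0]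
          congr 2
          · congr 1; ring
          · ring
      _ = a / 2 * t ^ (-(2 * θ)) := by
          rw [ha]; field_simp; norm_num
  set Y : ℝ := C₂ * ((n : ℝ) + 1) ^ α * (N ^ scale N θ (n - 1) * N ^ scale N θ n) /
        (4 * (N : ℝ) ^ (2 * scale N θ (n + 1))) with hY
  have hYeq : Y = C₂ * ((n : ℝ) + 1) ^ α / (4 * (M' * M)) := by
    have hmono := (scale_strictMono hN hθ).monotone
    have h1 : (N : ℝ) ^ scale N θ (n + 1) = M * N ^ scale N θ n := by
      rw [hM, ← pow_add, Nat.sub_add_cancel (hmono n.le_succ)]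
    have h2 : (N : ℝ) ^ scale N θ (n + 1) = M' * N ^ scale N θ (n - 1) := by
      rw [hM', ← pow_add, Nat.sub_add_cancel (hmono (by omega))]
    have h3 : (N : ℝ) ^ (2 * scale N θ (n + 1)) =
        (M' * N ^ scale N θ (n - 1)) * (M * N ^ scale N θ n) := by
      rw [two_mul, pow_add]; nth_rw 1 [h2]; rw [h1]
    rw [hY, h3]
    field_simp
  have hYge : L * t ^ γ ≤ Y := by
    rw [hYeq, le_div_iff₀ (by positivity)]
    calc L * t ^ γ * (4 * (M' * M)) ≤ (C₂ * c) * t ^ γ * (4 * (8 * N ^ 3 * t ^ (3 * θ))) := by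
          gcongr
      _ = C₂ * (c * 32 * N ^ 3) * (t ^ γ * t ^ (3 * θ)) := by ring
      _ = C₂ * (t ^ α / 2 ^ α) := by
          rw [← Real.rpow_add ht0, hγ, sub_add_cancel, hc]
          field_simp
      _ ≤ _ := by
          rw [← Real.div_rpow ht0.le (by norm_num)]
          gcongr
          linarith
  have hexp : Real.exp (-Y) ≤ a / (16 * N ^ 3) * t ^ (-(5 * θ)) := by
    have htγ : 0 < t ^ γ := by positivity
    have hY0 : 0 < Y := lt_of_lt_of_le (by positivity) hYge
    have h1 := Real.pow_div_factorial_le_exp Y hY0.le k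
    have h2 : L * t ^ (5 * θ) ≤ Y ^ k := by
      calc L * t ^ (5 * θ) ≤ L ^ k * (t ^ γ) ^ k := by
            have e1 : L ≤ L ^ k := le_self_pow₀ hL1 hk0
            have e2 : t ^ (5 * θ) ≤ (t ^ γ) ^ k := by
              rw [← Real.rpow_natCast (t ^ γ), ← Real.rpow_mul ht0.le]
              refine Real.rpow_le_rpow_of_exponent_le ?_ (by linarith)
              have := (Nat.cast_nonneg n : (0 : ℝ) ≤ n)
              simp only [ht]; linarith
            gcongr
        _ = (L * t ^ γ) ^ k := by rw [mul_pow]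
        _ ≤ Y ^ k := by gcongr
    have h3 : k.factorial * (16 * N ^ 3) / a * t ^ (5 * θ) ≤ Y ^ k :=
      le_trans (mul_le_mul_of_nonneg_right (le_max_right _ _) (by positivity)) h2
    have hfac : (0 : ℝ) < k.factorial := by positivity
    have h4 : (16 * N ^ 3) / a * t ^ (5 * θ) ≤ Real.exp Y := by
      refine le_trans ?_ h1
      rw [le_div_iff₀ hfac]
      refine le_trans (le_of_eq ?_) h3
      ring
    rw [Real.exp_neg, Real.rpow_neg ht0.le]
    rw [show a / (16 * N ^ 3) * (t ^ (5 * θ))⁻¹ = ((16 * N ^ 3) / a * t ^ (5 * θ))⁻¹ by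
      field_simp]
    gcongr
  have hpart2 : M' * M * Real.exp (-Y) ≤ a / 2 * t ^ (-(2 * θ)) := by
    calc M' * M * Real.exp (-Y) ≤ 8 * N ^ 3 * t ^ (3 * θ) *
          (a / (16 * N ^ 3) * t ^ (-(5 * θ))) := by gcongr
      _ = a / 2 * (t ^ (3 * θ) * t ^ (-(5 * θ))) := by field_simp; norm_num
      _ = _ := by rw [← Real.rpow_add ht0]; congr 2; ring
  rw [htarget]
  linarith

end Scales

/-! ### Good balls at all large stages. -/

section Eventually

variable {N : ℕ} [NeZero N] {θ α C₂ a : ℝ} {p : ℕ → unitInterval}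

theorem measure_bad_le (hN : 2 ≤ N) (hθ : 2 < θ) (hα : 0 ≤ α) (hC₂ : 0 ≤ C₂) (ha : 0 < a)
    (hp : ∀ k : ℕ, 1 ≤ k → 1 - (p k : ℝ) ≤ Real.exp (-(C₂ * (k : ℝ) ^ α / (N : ℝ) ^ (2 * k))))
    (hrec : ∀ n : ℕ,
      (N : ℝ) ^ (scale N θ (n + 1) - scale N θ n) * N ^ (scale N θ (n + 1) - scale N θ n) *
        (badBound a θ n * badBound a θ n) +
      N ^ (scale N θ (n + 1) - scale N θ (n - 1)) * N ^ (scale N θ (n + 1) - scale N θ n) *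
        Real.exp (-(C₂ * ((n : ℝ) + 1) ^ α * (N ^ scale N θ (n - 1) * N ^ scale N θ n) /
        (4 * (N : ℝ) ^ (2 * scale N θ (n + 1))))) ≤ badBound a θ (n + 1)) (n : ℕ) :
    ∀ x, (edgeLaw N p).real {ω | cluster ω (scale N θ) n x = ∅} ≤ badBound a θ n := by
  induction n with
  | zero =>
    intro x
    simp [badBound, ha.le]
  | succ n ih =>
    intro x
    refine (measure_bad_succ_le hN (scale_strictMono hN hθ) scale_zero ih x (Real.exp_pos _).le
      fun y hy z hz hyz => ?_).trans (hrec n)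
    exact measure_not_joined_le (scale_strictMono hN hθ) scale_zero (sq_mul_pow_scale_le hN hθ)
      hC₂ hα hp n hy hz hyz

/-- Almost surely, around each point, all the balls of stage `r` in the ball of stage `r + 1` are
good if `r` is large. -/
theorem ae_eventually_good (hN : 2 ≤ N) (hθ : 2 < θ) (ha : 0 < a)
    (hbad : ∀ n x, (edgeLaw N p).real {ω | cluster ω (scale N θ) n x = ∅} ≤ badBound a θ n)
    (x : HierGroup N) :
    ∀ᵐ ω ∂(edgeLaw N p), ∀ᶠ r in Filter.atTop, ∀ y ∈ hball (scale N θ (r + 1)) x,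
      (cluster ω (scale N θ) r y).Nonempty := by
  set B : ℕ → Set (Sym2 (HierGroup N) → Bool) := fun r =>
    {ω | ∃ y ∈ hball (scale N θ (r + 1)) x, cluster ω (scale N θ) r y = ∅} with hB
  -- About r^θ sub-balls, each bad with probability of order r^(-2θ): the bound r^(-θ) is summable.
  have hBle : ∀ r, (edgeLaw N p).real (B r) ≤
      2 * N * 2 ^ θ * a * ((r : ℝ) + 1) ^ (-θ) := by
    intro r
    obtain ⟨t, -, htcard, ht⟩ := exists_representatives (scale N θ r) (scale N θ (r + 1)) x
    have h1 : B r ⊆ ⋃ z ∈ t, {ω | cluster ω (scale N θ) r z = ∅} := by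
      rintro ω ⟨y, hy, hyb⟩
      obtain ⟨z, hz, hyz⟩ := ht y hy
      refine Set.mem_biUnion (x := z) hz ?_
      rwa [Set.mem_ofPred_eq, ← cluster_congr scale_zero _ hyz]
    refine (measureReal_mono h1 (measure_ne_top _ _)).trans
      ((measureReal_biUnion_finset_le _ _).trans ?_)
    refine (Finset.sum_le_card_nsmul _ _ _ fun z _ => hbad r z).trans ?_
    rw [nsmul_eq_mul, htcard]
    have h2 := pow_scale_sub_le hN hθ r
    have hr1 : (0 : ℝ) < (r : ℝ) + 1 := by positivity
    have h3 : ((r : ℝ) + 2) ^ θ ≤ 2 ^ θ * ((r : ℝ) + 1) ^ θ := by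
      rw [← Real.mul_rpow (by norm_num) hr1.le]
      gcongr
      linarith [(Nat.cast_nonneg r : (0 : ℝ) ≤ r)]
    push_cast
    calc (N : ℝ) ^ (scale N θ (r + 1) - scale N θ r) * badBound a θ r
        ≤ (2 * N * (2 ^ θ * ((r : ℝ) + 1) ^ θ)) * badBound a θ r := by
          have : 0 ≤ badBound a θ r := by unfold badBound; positivity
          gcongr
          exact h2.trans (by gcongr)
      _ = 2 * N * 2 ^ θ * a * (((r : ℝ) + 1) ^ θ * ((r : ℝ) + 1) ^ (-(2 * θ))) := by
          unfold badBound; ring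
      _ = _ := by rw [← Real.rpow_add hr1]; congr 2; ring
  have hsum : Summable fun r : ℕ => 2 * N * 2 ^ θ * a * ((r : ℝ) + 1) ^ (-θ) :=
    (summable_nat_add_rpow (by linarith)).mul_left _
  have hfin : ∑' r, (edgeLaw N p) (B r) ≠ ⊤ := by
    refine ne_top_of_le_ne_top hsum.tsum_ofReal_ne_top (ENNReal.tsum_le_tsum fun r => ?_)
    rw [← ofReal_measureReal]
    exact ENNReal.ofReal_le_ofReal (hBle r)
  filter_upwards [ae_eventually_notMem hfin] with ω hω
  filter_upwards [hω] with r hr y hy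
  by_contra h
  exact hr ⟨y, hy, Finset.not_nonempty_iff_eq_empty.1 h⟩

end Eventually

variable {N : ℕ} [NeZero N] {κ : ℕ → ℕ} {p : ℕ → unitInterval}

/-! ### Local finiteness and rarity of long edges. -/

section LocalFiniteness

/-- At most N^k points lie at distance k, so the right side bounds the expected degree. -/
theorem tsum_connProb_le (p : ℕ → unitInterval) (x : HierGroup N) :
    ∑' y, ENNReal.ofReal (p (hdist x y)) ≤ ∑' k : ℕ, (N : ENNReal) ^ k * ENNReal.ofReal (p k) := by
  rw [← ENNReal.tsum_fiberwise _ (fun y => hdist x y)]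
  refine ENNReal.tsum_le_tsum fun k => ?_
  calc ∑' b : (fun y => hdist x y) ⁻¹' {k}, ENNReal.ofReal (p (hdist x b))
      = ∑' b : (fun y => hdist x y) ⁻¹' {k}, ENNReal.ofReal (p k) :=
        tsum_congr fun b => by rw [show hdist x b = k from b.2]
    _ ≤ ∑' b : (hball k x : Set (HierGroup N)), ENNReal.ofReal (p k) :=
        ENNReal.tsum_mono_subtype (fun _ => ENNReal.ofReal (p k)) fun y hy =>
          mem_hball_iff_hdist.2 (le_of_eq hy)
    _ = (N : ENNReal) ^ k * ENNReal.ofReal (p k) := by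
        rw [Finset.tsum_subtype' (hball k x) fun _ => ENNReal.ofReal (p k)]
        simp

theorem ae_finite_open (hp : ∑' k : ℕ, (N : ENNReal) ^ k * ENNReal.ofReal (p k) ≠ ⊤)
    (x : HierGroup N) : ∀ᵐ ω ∂(edgeLaw N p), {y | ω s(x, y) = true}.Finite := by
  refine ae_finite_setOfPred_mem (s := fun y => {ω : Sym2 (HierGroup N) → Bool | ω s(x, y) = true}) ?_
  refine ne_top_of_le_ne_top hp (le_trans (ENNReal.tsum_le_tsum fun y => ?_)
    (tsum_connProb_le p x))
  rw [edgeLaw, measure_eq_true]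
  rfl

/-- The event that an open pair joins the ball of radius `k` around `x` to the complement of the
ball of radius `l`. -/
def longEdge (x : HierGroup N) (k l : ℕ) : Set (Sym2 (HierGroup N) → Bool) :=
  {ω | ∃ u ∈ hball k x, ∃ v, v ∉ hball l x ∧ ω s(u, v) = true}

/-- As m grows these events decrease to a null event, by local finiteness. The stages of the
exploration can thus be spaced so that edges jumping over a whole shell are eventually absent. -/
theorem exists_longEdge_le (hκ : StrictMono κ)
    (hp : ∑' k : ℕ, (N : ENNReal) ^ k * ENNReal.ofReal (p k) ≠ ⊤)
    (x : HierGroup N) (n : ℕ) {ε : ENNReal} (hε : 0 < ε) :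
    ∃ m, n < m ∧ edgeLaw N p (longEdge x (κ n) (κ m)) ≤ ε := by
  have hmeas : ∀ m, MeasurableSet (longEdge x (κ n) (κ m)) := by
    intro m
    have : longEdge x (κ n) (κ m) = ⋃ u ∈ hball (κ n) x, ⋃ v ∈ {v | v ∉ hball (κ m) x},
        (fun ω : Sym2 (HierGroup N) → Bool => ω s(u, v)) ⁻¹' {true} := by
      ext ω; simp [longEdge]
    rw [this]
    refine Finset.measurableSet_biUnion _ fun u _ => ?_
    exact MeasurableSet.biUnion (Set.to_countable _) fun v _ =>
      measurable_pi_apply _ (MeasurableSet.of_discrete)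
  have hanti : Antitone fun m => longEdge x (κ n) (κ m) := by
    rintro m m' hm ω ⟨u, hu, v, hv, h⟩
    exact ⟨u, hu, v, fun h' => hv (hball_mono (hκ.monotone hm) x h'), h⟩
  have hlim := tendsto_measure_iInter_atTop (μ := edgeLaw N p)
    (fun m => (hmeas m).nullMeasurableSet) hanti ⟨0, measure_ne_top _ _⟩
  have hzero : edgeLaw N p (⋂ m, longEdge x (κ n) (κ m)) = 0 := by
    have h : ∀ᵐ ω ∂(edgeLaw N p), ∀ u ∈ hball (κ n) x, {y | ω s(u, y) = true}.Finite := by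
      rw [Filter.eventually_all_finset]
      exact fun u _ => ae_finite_open hp u
    refine measure_mono_null ?_ h
    intro ω hω hfin
    rw [Set.mem_iInter] at hω
    have hF : (⋃ u ∈ hball (κ n) x, {y | ω s(u, y) = true}).Finite :=
      Set.Finite.biUnion (Finset.finite_toSet _) hfin
    obtain ⟨M, hM⟩ := (hF.image (hdist x)).bddAbove
    obtain ⟨u, hu, v, hv, huv⟩ := hω M
    refine hv (mem_hball_iff_hdist.2 ((hM ⟨v, ?_, rfl⟩).trans hκ.le_apply))
    exact Set.mem_biUnion hu huv
  rw [hzero] at hlim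
  obtain ⟨m, hm, hm'⟩ := ((hlim.eventually (gt_mem_nhds hε)).and
    (Filter.eventually_gt_atTop n)).exists
  exact ⟨m, hm', hm.le⟩

end LocalFiniteness

/-! ### Exploration of a component through shells. -/

section Exploration

/-- `u` and `v` are joined by an open pair inside the ball of radius `k` around `x`. -/
def InnerStep (ω : Sym2 (HierGroup N) → Bool) (k : ℕ) (x u v : HierGroup N) : Prop :=
  u ∈ hball k x ∧ v ∈ hball k x ∧ ω s(u, v) = true

open Classical in
/-- The points reachable from `x` inside the ball of radius `k` around `x`. -/
def innerComponent (ω : Sym2 (HierGroup N) → Bool) (k : ℕ) (x : HierGroup N) :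
    Finset (HierGroup N) :=
  (hball k x).filter fun v => Relation.ReflTransGen (InnerStep ω k x) x v

/-- The index of the annulus around `x` which contains `v`. -/
def annulus (κ : ℕ → ℕ) (x v : HierGroup N) : ℕ := sInf {r | v ∈ hball (κ (r + 1)) x}

/-- The points of the annuli between stages `a` and `b` around `x`. -/
def shell (κ : ℕ → ℕ) (x : HierGroup N) (a b : ℕ) : Finset (HierGroup N) :=
  hball (κ b) x \ hball (κ a) x

/-- The points of the shell which belong to the cluster of their annulus. -/
def target (ω : Sym2 (HierGroup N) → Bool) (κ : ℕ → ℕ) (x : HierGroup N) (a b : ℕ) :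
    Finset (HierGroup N) :=
  (shell κ x a b).filter fun v => v ∈ cluster ω κ (annulus κ x v) v

/-- The exploration of the component of `x` exits from stage `a` to the shell between the stages
`a` and `b` without meeting the target, although all the balls of the shell are good. -/
def missEvent (κ : ℕ → ℕ) (x : HierGroup N) (a b : ℕ) : Set (Sym2 (HierGroup N) → Bool) :=
  {ω | (∃ u ∈ innerComponent ω (κ a) x, ∃ v ∈ shell κ x a b, ω s(u, v) = true) ∧
    (∀ u ∈ innerComponent ω (κ a) x, ∀ v ∈ target ω κ x a b, ω s(u, v) = false) ∧
    ∀ v ∈ shell κ x a b, (cluster ω κ (annulus κ x v) v).Nonempty}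

theorem mem_innerComponent {ω : Sym2 (HierGroup N) → Bool} {k : ℕ} {x v : HierGroup N} :
    v ∈ innerComponent ω k x ↔ v ∈ hball k x ∧ Relation.ReflTransGen (InnerStep ω k x) x v := by
  classical
  unfold innerComponent
  rw [Finset.mem_filter]

theorem innerComponent_subset (ω : Sym2 (HierGroup N) → Bool) (k : ℕ) (x : HierGroup N) :
    innerComponent ω k x ⊆ hball k x :=
  fun _ hv => (mem_innerComponent.1 hv).1

theorem innerComponent_eq_of_agree {ω ω' : Sym2 (HierGroup N) → Bool} {k : ℕ} {x : HierGroup N}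
    (h : ∀ e ∈ (hball k x).sym2, ω e = ω' e) : innerComponent ω k x = innerComponent ω' k x := by
  have : InnerStep ω k x = InnerStep ω' k x := by
    ext u v
    refine and_congr_right fun hu => and_congr_right fun hv => ?_
    rw [h _ (Finset.mk_mem_sym2_iff.2 ⟨hu, hv⟩)]
  unfold innerComponent
  rw [this]

theorem annulus_spec (hκ : StrictMono κ) {x v : HierGroup N} {a b : ℕ} (hv : v ∈ shell κ x a b) :
    v ∈ hball (κ (annulus κ x v + 1)) x ∧ v ∉ hball (κ (annulus κ x v)) x ∧
      a ≤ annulus κ x v ∧ annulus κ x v < b := by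
  rw [shell, Finset.mem_sdiff] at hv
  have hab : a < b := by
    by_contra h
    exact hv.2 (hball_mono (hκ.monotone (not_lt.1 h)) x hv.1)
  have hmem : b - 1 ∈ {r | v ∈ hball (κ (r + 1)) x} := by
    have : b - 1 + 1 = b := by omega
    rw [Set.mem_ofPred_eq, this]; exact hv.1
  have h1 : v ∈ hball (κ (annulus κ x v + 1)) x := Nat.sInf_mem ⟨_, hmem⟩
  have h2 : annulus κ x v ≤ b - 1 := Nat.sInf_le hmem
  have h3 : a ≤ annulus κ x v := by
    by_contra h
    exact hv.2 (hball_mono (hκ.monotone (by omega)) x h1)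
  refine ⟨h1, fun h => ?_, h3, by omega⟩
  rcases Nat.eq_zero_or_pos (annulus κ x v) with h0 | h0
  · rw [h0] at h
    exact hv.2 (hball_mono (hκ.monotone (Nat.zero_le _)) x h)
  · have : annulus κ x v ≤ annulus κ x v - 1 := Nat.sInf_le (by
      rw [Set.mem_ofPred_eq, Nat.sub_add_cancel h0]; exact h)
    omega

/-- By ultrametricity a shell is a disjoint union of blocks, each of the radius belonging to its
annulus. -/
theorem annulus_congr (hκ : StrictMono κ) {x v w : HierGroup N} {a b : ℕ}
    (hv : v ∈ shell κ x a b) (hw : w ∈ hball (κ (annulus κ x v)) v) :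
    annulus κ x w = annulus κ x v ∧ w ∈ shell κ x a b := by
  obtain ⟨h1, h2, h3, h4⟩ := annulus_spec hκ hv
  have hwout : w ∉ hball (κ (annulus κ x v)) x := fun h =>
    h2 (by rw [← hball_eq_of_mem h]; exact mem_hball_comm.1 hw)
  have hwin : w ∈ hball (κ (annulus κ x v + 1)) x :=
    hball_subset_of_mem (hκ.monotone (Nat.le_succ _)) h1 hw
  refine ⟨le_antisymm (Nat.sInf_le hwin) ?_, ?_⟩
  · refine le_csInf ⟨_, hwin⟩ fun r hr => ?_
    by_contra h
    exact hwout (hball_mono (hκ.monotone (by omega)) x hr)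
  · rw [shell, Finset.mem_sdiff]
    exact ⟨hball_mono (hκ.monotone h4) x hwin, fun h => hwout (hball_mono (hκ.monotone h3) x h)⟩

theorem shell_ball_subset (hκ : StrictMono κ) {x v : HierGroup N} {a b : ℕ}
    (hv : v ∈ shell κ x a b) : hball (κ (annulus κ x v)) v ⊆ shell κ x a b :=
  fun _ hw => (annulus_congr hκ hv hw).2

/-- Block by block: `g` is constant on a block with value in [0, 1], and the block has at most twice
as many points as its part of the target. -/
theorem prod_target_sq_le (hκ : StrictMono κ) (hκ0 : κ 0 = 0)
    (hM : ∀ n : ℕ, ((n : ℝ) + 2) ^ 2 * N ^ κ n ≤ N ^ κ (n + 1))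
    {ω : Sym2 (HierGroup N) → Bool} {x : HierGroup N} {a b : ℕ}
    (hdens : ∀ v ∈ shell κ x a b, (cluster ω κ (annulus κ x v) v).Nonempty)
    {g : HierGroup N → ℝ} (hg0 : ∀ v, 0 ≤ g v) (hg1 : ∀ v, g v ≤ 1)
    (hg : ∀ v ∈ shell κ x a b, ∀ w ∈ hball (κ (annulus κ x v)) v, g w = g v) :
    (∏ v ∈ target ω κ x a b, g v) ^ 2 ≤ ∏ v ∈ shell κ x a b, g v := by
  classical
  set blk : HierGroup N → Finset (HierGroup N) := fun v => hball (κ (annulus κ x v)) v with hblk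
  have hTsub : target ω κ x a b ⊆ shell κ x a b := Finset.filter_subset _ _
  rw [← Finset.prod_fiberwise_of_maps_to (s := shell κ x a b) (t := (shell κ x a b).image blk)
      (g := blk) (fun v hv => Finset.mem_image_of_mem _ hv),
    ← Finset.prod_fiberwise_of_maps_to (s := target ω κ x a b) (t := (shell κ x a b).image blk)
      (g := blk) (fun v hv => Finset.mem_image_of_mem _ (hTsub hv)), ← Finset.prod_pow]
  refine Finset.prod_le_prod (fun _ _ => sq_nonneg _) fun B hB => ?_
  obtain ⟨w, hw, rfl⟩ := Finset.mem_image.1 hB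
  have hfib : ∀ v, v ∈ shell κ x a b → blk v = blk w → g v = g w := by
    intro v hv hvw
    refine hg w hw v ?_
    change v ∈ blk w
    rw [← hvw]; exact mem_hball_self _ _
  rw [Finset.prod_congr rfl fun v hv => hfib v (hTsub (Finset.mem_filter.1 hv).1)
      (Finset.mem_filter.1 hv).2,
    Finset.prod_congr rfl fun v hv => hfib v (Finset.mem_filter.1 hv).1
      (Finset.mem_filter.1 hv).2, Finset.prod_const, Finset.prod_const, ← pow_mul]
  refine pow_le_pow_of_le_one (hg0 w) (hg1 w) ?_
  have h1 : ((shell κ x a b).filter fun v => blk v = blk w).card ≤ N ^ κ (annulus κ x w) := by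
    rw [← card_hball (κ (annulus κ x w)) w]
    refine Finset.card_le_card fun v hv => ?_
    change v ∈ blk w
    rw [← (Finset.mem_filter.1 hv).2]; exact mem_hball_self _ _
  have h2 : (cluster ω κ (annulus κ x w) w).card ≤
      ((target ω κ x a b).filter fun v => blk v = blk w).card := by
    refine Finset.card_le_card fun v hv => ?_
    have hvw := cluster_subset hκ.monotone _ _ hv
    obtain ⟨h3, h4⟩ := annulus_congr hκ hw hvw
    refine Finset.mem_filter.2 ⟨Finset.mem_filter.2 ⟨h4, ?_⟩, ?_⟩
    · rw [h3]; exact mem_cluster_self_of_mem hκ.monotone hκ0 hv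
    · simp only [hblk, h3]
      exact hball_eq_of_mem hvw
  have h3 := half_le_card_cluster hκ.monotone hκ0 hM _ _ (hdens w hw)
  have h4 : N ^ κ (annulus κ x w) ≤ (cluster ω κ (annulus κ x w) w).card * 2 := by
    have : (N : ℝ) ^ κ (annulus κ x w) ≤ (cluster ω κ (annulus κ x w) w).card * 2 := by linarith
    exact_mod_cast this
  omega

theorem target_eq_of_agree (hκ : StrictMono κ) {ω ω' : Sym2 (HierGroup N) → Bool}
    {x : HierGroup N} {a b : ℕ} (h : ∀ e ∈ (shell κ x a b).sym2, ω e = ω' e) :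
    (∀ v ∈ shell κ x a b, cluster ω κ (annulus κ x v) v = cluster ω' κ (annulus κ x v) v) ∧
      target ω κ x a b = target ω' κ x a b := by
  have h1 : ∀ v ∈ shell κ x a b,
      cluster ω κ (annulus κ x v) v = cluster ω' κ (annulus κ x v) v := fun v hv =>
    cluster_eq_of_agree hκ.monotone _ _ fun e he =>
      h e (Finset.sym2_mono (shell_ball_subset hκ hv) he)
  exact ⟨h1, Finset.filter_congr fun v hv => by rw [h1 v hv]⟩

/-- Condition on the pairs inside the inner ball and inside the shell; the pairs between the inner
component and the shell are still fresh. If P is the probability that none reaches the target, the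
probability that none reaches the shell is at least P². Reaching the shell but not the target thus
has probability at most P - P² ≤ 1/4, however small the connection probabilities are. -/
theorem measure_inter_missEvent_le (hκ : StrictMono κ) (hκ0 : κ 0 = 0)
    (hM : ∀ n : ℕ, ((n : ℝ) + 2) ^ 2 * N ^ κ n ≤ N ^ κ (n + 1)) {x : HierGroup N} {a b : ℕ}
    {A : Set (Sym2 (HierGroup N) → Bool)}
    (hA : DependsOn (fun ω => ω ∈ A) ((hball (κ a) x).sym2 : Set (Sym2 (HierGroup N)))) :
    (edgeLaw N p).real (A ∩ missEvent κ x a b) ≤ 1 / 4 * (edgeLaw N p).real A := by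
  set I : Finset (Sym2 (HierGroup N)) := (hball (κ a) x).sym2 ∪ (shell κ x a b).sym2 with hI
  set A' : Set (Sym2 (HierGroup N) → Bool) := {ω | ω ∈ A ∧
    ∀ v ∈ shell κ x a b, (cluster ω κ (annulus κ x v) v).Nonempty} with hA'
  set S : (Sym2 (HierGroup N) → Bool) → Finset (HierGroup N) :=
    fun ω => innerComponent ω (κ a) x with hS
  have hagree1 : ∀ ω ω' : Sym2 (HierGroup N) → Bool, (∀ e ∈ (I : Set _), ω e = ω' e) →
      ∀ e ∈ (hball (κ a) x).sym2, ω e = ω' e :=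
    fun ω ω' h e he => h e (Finset.mem_union_left _ he)
  have hagree2 : ∀ ω ω' : Sym2 (HierGroup N) → Bool, (∀ e ∈ (I : Set _), ω e = ω' e) →
      ∀ e ∈ (shell κ x a b).sym2, ω e = ω' e :=
    fun ω ω' h e he => h e (Finset.mem_union_right _ he)
  have hdisj : ∀ ω, Disjoint (S ω) (shell κ x a b) := fun ω =>
    Finset.disjoint_of_subset_left (innerComponent_subset _ _ _) Finset.disjoint_sdiff
  have hTsub : ∀ ω, target ω κ x a b ⊆ shell κ x a b := fun ω => Finset.filter_subset _ _
  have hpairs : ∀ ω, pairs (S ω) (target ω κ x a b) ⊆ pairs (S ω) (shell κ x a b) := by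
    intro ω e he
    obtain ⟨u, hu, v, hv, rfl⟩ := mem_pairs.1 he
    exact mem_pairs.2 ⟨u, hu, v, hTsub ω hv, rfl⟩
  have hmain := measure_conditional_le (fun e => p (edgeLength e)) (A := A') (I := I) (ε := 1 / 4)
    (by
      intro ω ω' h
      have h1 : (ω ∈ A) = (ω' ∈ A) := hA fun e he => h e (Finset.mem_union_left _ he)
      simp only [hA', Set.mem_ofPred_eq, h1, eq_iff_iff]
      refine and_congr_right fun _ => forall₂_congr fun v hv => ?_
      rw [(target_eq_of_agree hκ (hagree2 ω ω' h)).1 v hv])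
    (fun ω => {ω' | ∀ e ∈ pairs (S ω) (target ω κ x a b), ω' e = false} \
      {ω' | ∀ e ∈ pairs (S ω) (shell κ x a b), ω' e = false})
    (by
      intro ω ω' h
      simp only [hS, innerComponent_eq_of_agree (hagree1 ω ω' h),
        (target_eq_of_agree hκ (hagree2 ω ω' h)).2])
    (fun ω => pairs (S ω) (shell κ x a b))
    (by
      intro ω _ ω₁ ω₂ h
      have h1 : (∀ e ∈ pairs (S ω) (shell κ x a b), ω₁ e = false) ↔
          ∀ e ∈ pairs (S ω) (shell κ x a b), ω₂ e = false :=
        forall₂_congr fun e he => by rw [h e he]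
      have h2 : (∀ e ∈ pairs (S ω) (target ω κ x a b), ω₁ e = false) ↔
          ∀ e ∈ pairs (S ω) (target ω κ x a b), ω₂ e = false :=
        forall₂_congr fun e he => by rw [h e (hpairs ω he)]
      simp only [Set.mem_sdiff, Set.mem_ofPred_eq, h1, h2])
    (by
      intro ω _
      rw [Finset.disjoint_right]
      intro e he
      obtain ⟨u, hu, v, hv, rfl⟩ := mem_pairs.1 he
      rw [hI, Finset.mem_union, Finset.mk_mem_sym2_iff, Finset.mk_mem_sym2_iff]
      rintro (h | h)
      · exact (Finset.mem_sdiff.1 hv).2 h.2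
      · exact (Finset.mem_sdiff.1 h.1).2 (innerComponent_subset _ _ _ hu))
    (by
      intro ω hω
      have hsub : {ω' : Sym2 (HierGroup N) → Bool |
          ∀ e ∈ pairs (S ω) (shell κ x a b), ω' e = false} ⊆
          {ω' | ∀ e ∈ pairs (S ω) (target ω κ x a b), ω' e = false} := by
        intro ω' h
        exact fun e he => h e (hpairs ω he)
      rw [measureReal_sdiff hsub
        (measurableSet_of_dependsOn (dependsOn_forall_eq_false _)), measure_forall_eq_false,
        measure_forall_eq_false, prod_pairs (hdisj ω),
        prod_pairs (Finset.disjoint_of_subset_right (hTsub ω) (hdisj ω))]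
      set P := ∏ u ∈ S ω, ∏ v ∈ target ω κ x a b, (1 - (p (edgeLength s(u, v)) : ℝ)) with hP
      have hsq : P ^ 2 ≤ ∏ u ∈ S ω, ∏ v ∈ shell κ x a b, (1 - (p (edgeLength s(u, v)) : ℝ)) := by
        rw [hP, ← Finset.prod_pow]
        refine Finset.prod_le_prod (fun _ _ => sq_nonneg _) fun u hu => ?_
        refine prod_target_sq_le hκ hκ0 hM hω.2 (g := fun v => 1 - (p (edgeLength s(u, v)) : ℝ))
          (fun v => sub_nonneg.2 (p _).2.2) (fun v => sub_le_self _ (p _).2.1) fun v hv w hw => ?_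
        obtain ⟨-, h2, h3, -⟩ := annulus_spec hκ hv
        have hu' := hball_mono (hκ.monotone h3) x (innerComponent_subset _ _ _ hu)
        have : edgeLength s(u, w) = edgeLength s(u, v) :=
          (hdist_congr_of_mem hu' h2 hw).trans
            (hdist_congr_of_mem hu' h2 (mem_hball_self _ _)).symm
        simp only [this]
      nlinarith [sq_nonneg (P - 1 / 2)])
  refine (measureReal_mono ?_ (measure_ne_top _ _)).trans (hmain.trans ?_)
  · rintro ω ⟨hωA, ⟨u, hu, v, hv, huv⟩, h2, h3⟩
    refine ⟨⟨hωA, h3⟩, ?_, fun h => ?_⟩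
    · intro e he
      obtain ⟨u, hu, v, hv, rfl⟩ := mem_pairs.1 he
      exact h2 u hu v hv
    · have := h s(u, v) (mem_pairs.2 ⟨u, hu, v, hv, rfl⟩)
      rw [huv] at this
      exact absurd this (by simp)
  · refine mul_le_mul_of_nonneg_left (measureReal_mono (fun ω h => h.1) (measure_ne_top _ _)) ?_
    norm_num

theorem missEvent_dependsOn (hκ : StrictMono κ) (x : HierGroup N) {a b : ℕ} (hab : a ≤ b) :
    DependsOn (fun ω => ω ∈ missEvent κ x a b)
      ((hball (κ b) x).sym2 : Set (Sym2 (HierGroup N))) := by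
  intro ω ω' h
  have hsub : hball (κ a) x ⊆ hball (κ b) x := hball_mono (hκ.monotone hab) x
  have hshell : shell κ x a b ⊆ hball (κ b) x := Finset.sdiff_subset
  have h1 := innerComponent_eq_of_agree (ω := ω) (ω' := ω') (k := κ a) (x := x)
    fun e he => h e (Finset.sym2_mono hsub he)
  obtain ⟨h2, h3⟩ := target_eq_of_agree (ω := ω) (ω' := ω') (a := a) (b := b) (x := x) hκ
    fun e he => h e (Finset.sym2_mono hshell he)
  have h4 : ∀ u ∈ innerComponent ω' (κ a) x, ∀ v ∈ shell κ x a b, ω s(u, v) = ω' s(u, v) :=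
    fun u hu v hv => h _ (Finset.mk_mem_sym2_iff.2
      ⟨hsub (innerComponent_subset _ _ _ hu), hshell hv⟩)
  simp only [missEvent, Set.mem_ofPred_eq, h1, h3, eq_iff_iff]
  refine and_congr (exists_congr fun u => and_congr_right fun hu => exists_congr fun v =>
    and_congr_right fun hv => by rw [h4 u hu v hv]) (and_congr ?_ ?_)
  · exact forall₂_congr fun u hu => forall₂_congr fun v hv => by
      rw [h4 u hu v (Finset.filter_subset _ _ hv)]
  · exact forall₂_congr fun v hv => by rw [h2 v hv]

/-- The first k misses are decided inside the next inner ball, so every further miss costs a factor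
1/4. -/
theorem measure_forall_missEvent_eq_zero (hκ : StrictMono κ) (hκ0 : κ 0 = 0)
    (hM : ∀ n : ℕ, ((n : ℝ) + 2) ^ 2 * N ^ κ n ≤ N ^ κ (n + 1)) (x : HierGroup N) {s : ℕ → ℕ}
    (hs : Monotone s) (i : ℕ) :
    edgeLaw N p {ω | ∀ j, i ≤ j → ω ∈ missEvent κ x (s j) (s (j + 1))} = 0 := by
  set A : ℕ → Set (Sym2 (HierGroup N) → Bool) := fun k =>
    {ω | ∀ j, i ≤ j → j < i + k → ω ∈ missEvent κ x (s j) (s (j + 1))} with hA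
  have hdep : ∀ k, DependsOn (fun ω => ω ∈ A k)
      ((hball (κ (s (i + k))) x).sym2 : Set (Sym2 (HierGroup N))) := by
    intro k ω ω' h
    simp only [hA, Set.mem_ofPred_eq, eq_iff_iff]
    refine forall_congr' fun j => forall_congr' fun hj => forall_congr' fun hj' => ?_
    rw [← eq_iff_iff]
    refine missEvent_dependsOn hκ x (hs j.le_succ) fun e he => h e ?_
    exact Finset.sym2_mono (hball_mono (hκ.monotone (hs (by omega))) x) he
  have hle : ∀ k, (edgeLaw N p).real (A k) ≤ (1 / 4) ^ k := by
    intro k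
    induction k with
    | zero => simp
    | succ k ih =>
      have hsub : A (k + 1) ⊆ A k ∩ missEvent κ x (s (i + k)) (s (i + k + 1)) :=
        fun ω h => ⟨fun j hj hj' => h j hj (by omega), h (i + k) (by omega) (by omega)⟩
      refine (measureReal_mono hsub (measure_ne_top _ _)).trans
        ((measure_inter_missEvent_le hκ hκ0 hM (hdep k)).trans ?_)
      rw [pow_succ, mul_comm]
      gcongr
  have hreal : (edgeLaw N p).real {ω | ∀ j, i ≤ j → ω ∈ missEvent κ x (s j) (s (j + 1))} ≤ 0 := by
    have hsub : ∀ k, {ω : Sym2 (HierGroup N) → Bool |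
        ∀ j, i ≤ j → ω ∈ missEvent κ x (s j) (s (j + 1))} ⊆ A k := by
      intro k ω h
      exact fun j hj _ => h j hj
    refine ge_of_tendsto' (tendsto_pow_atTop_nhds_zero_of_lt_one (r := (1 / 4 : ℝ)) (by norm_num)
      (by norm_num)) fun k => (measureReal_mono (hsub k)
        (measure_ne_top _ _)).trans (hle k)
  exact (measureReal_eq_zero_iff (measure_ne_top _ _)).1
    (le_antisymm hreal measureReal_nonneg)

end Exploration

/-! ### Infinite components reach the clusters. -/

section Uniqueness

variable {ω : Sym2 (HierGroup N) → Bool} {x : HierGroup N}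

omit [NeZero N] in
theorem percGraph_adj {u v : HierGroup N} :
    (percGraph ω).Adj u v ↔ ω s(u, v) = true ∧ u ≠ v := by
  simp [percGraph]

omit [NeZero N] in
theorem reachable_of_open {u v : HierGroup N} (h : ω s(u, v) = true) :
    (percGraph ω).Reachable u v := by
  by_cases huv : u = v
  · rw [huv]
  · exact (percGraph_adj.2 ⟨h, huv⟩).reachable

theorem reachable_of_mem_innerComponent {k : ℕ} {v : HierGroup N}
    (h : v ∈ innerComponent ω k x) : (percGraph ω).Reachable x v := by
  have := (mem_innerComponent.1 h).2
  induction this with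
  | refl => exact SimpleGraph.Reachable.refl _
  | tail h1 h2 ih =>
    exact (ih (mem_innerComponent.2 ⟨h2.1, h1⟩)).trans (reachable_of_open h2.2.2)

theorem exists_exit {k : ℕ} {w : HierGroup N} (hw : (percGraph ω).Reachable x w)
    (hout : w ∉ hball k x) :
    ∃ u ∈ innerComponent ω k x, ∃ v, v ∉ hball k x ∧ ω s(u, v) = true := by
  by_contra hcon
  push Not at hcon
  have key : ∀ v, Relation.ReflTransGen (percGraph ω).Adj x v → v ∈ innerComponent ω k x := by
    intro v hv
    induction hv with
    | refl => exact mem_innerComponent.2 ⟨mem_hball_self _ _, Relation.ReflTransGen.refl⟩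
    | @tail b c _ h2 ih =>
      have hopen := (percGraph_adj.1 h2).1
      have hc : c ∈ hball k x := by
        by_contra hc
        exact hcon b ih c hc hopen
      have hb := mem_innerComponent.1 ih
      exact mem_innerComponent.2 ⟨hc, hb.2.tail ⟨hb.1, hc, hopen⟩⟩
  exact hout (innerComponent_subset _ _ _
    (key w ((SimpleGraph.reachable_iff_reflTransGen _ _).1 hw)))

/-- Almost surely, if the connected component of `x` is infinite, it contains the clusters of all
large stages around `x`. -/
theorem ae_reachable_cluster (hκ : StrictMono κ) (hκ0 : κ 0 = 0)
    (hM : ∀ n : ℕ, ((n : ℝ) + 2) ^ 2 * N ^ κ n ≤ N ^ κ (n + 1))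
    (hp : ∑' k : ℕ, (N : ENNReal) ^ k * ENNReal.ofReal (p k) ≠ ⊤) (x : HierGroup N)
    (hgood : ∀ᵐ ω ∂(edgeLaw N p), ∀ᶠ r in Filter.atTop, ∀ y ∈ hball (κ (r + 1)) x,
      (cluster ω κ r y).Nonempty) :
    ∀ᵐ ω ∂(edgeLaw N p), {v | (percGraph ω).Reachable x v}.Infinite →
      ∃ n₀, ∀ n, n₀ ≤ n → ∀ v ∈ cluster ω κ n x, (percGraph ω).Reachable x v := by
  have hstep : ∀ (i n : ℕ), ∃ m, n < m ∧
      edgeLaw N p (longEdge x (κ n) (κ m)) ≤ (2⁻¹ : ENNReal) ^ i := fun i n =>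
    exists_longEdge_le hκ hp x n (by simp [pos_iff_ne_zero])
  choose next hnext1 hnext2 using hstep
  -- The i-th jump over a shell has probability at most 2^(-i), so Borel-Cantelli excludes all late
  -- ones.
  set s : ℕ → ℕ := fun i => Nat.rec 0 (fun j n => next j n) i with hs
  have hs_succ : ∀ i, s (i + 1) = next i (s i) := fun i => rfl
  have hsmono : StrictMono s := strictMono_nat_of_lt_succ fun i => by
    rw [hs_succ]; exact hnext1 _ _
  have hlong : ∀ᵐ ω ∂(edgeLaw N p), ∀ᶠ i in Filter.atTop,
      ω ∉ longEdge x (κ (s i)) (κ (s (i + 1))) := by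
    have hgeom : ∑' i : ℕ, (2⁻¹ : ENNReal) ^ i ≠ ⊤ := by
      rw [ENNReal.tsum_geometric]
      simp
    exact ae_eventually_notMem (ne_top_of_le_ne_top hgeom
      (ENNReal.tsum_le_tsum fun i => hnext2 i (s i)))
  have hmiss : ∀ᵐ ω ∂(edgeLaw N p), ∀ i,
      ¬ ∀ j, i ≤ j → ω ∈ missEvent κ x (s j) (s (j + 1)) := by
    rw [ae_all_iff]
    intro i
    rw [ae_iff]
    simp only [not_not]
    exact measure_forall_missEvent_eq_zero hκ hκ0 hM x hsmono.monotone i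
  filter_upwards [hgood, hlong, hmiss] with ω h1 h2 h3 hinf
  obtain ⟨r₀, hr₀⟩ := Filter.eventually_atTop.1 h1
  obtain ⟨i₀, hi₀⟩ := Filter.eventually_atTop.1 h2
  have hne : ∀ n, r₀ ≤ n → (cluster ω κ n x).Nonempty := fun n hn =>
    hr₀ n hn x (mem_hball_self _ _)
  have hexists : ∃ n, r₀ ≤ n ∧ ∃ w ∈ cluster ω κ n x, (percGraph ω).Reachable x w := by
    by_contra hcon
    push Not at hcon
    -- If the component never met a large cluster around `x`, every late shell would be a miss: the
    -- infinite component exits, no edge jumps over the shell, and an edge into the target would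
    -- reach a cluster of the next stage around `x`.
    refine h3 (max r₀ i₀) fun j hj => ?_
    have hsj : r₀ ≤ s j := le_trans (le_trans (le_max_left _ _) hj) hsmono.le_apply
    have hdens : ∀ v ∈ shell κ x (s j) (s (j + 1)),
        (cluster ω κ (annulus κ x v) v).Nonempty := fun v hv => by
      obtain ⟨a1, -, a3, -⟩ := annulus_spec hκ hv
      exact hr₀ _ (hsj.trans a3) v a1
    refine ⟨?_, ?_, hdens⟩
    · obtain ⟨w, hw, hw'⟩ := hinf.exists_notMem_finset (hball (κ (s j)) x)
      obtain ⟨u, hu, v, hv, huv⟩ := exists_exit hw hw'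
      refine ⟨u, hu, v, ?_, huv⟩
      rw [shell, Finset.mem_sdiff]
      refine ⟨?_, hv⟩
      by_contra hv'
      exact hi₀ j (le_trans (le_max_right _ _) hj)
        ⟨u, innerComponent_subset _ _ _ hu, v, hv', huv⟩
    · intro u hu v hv
      rw [target, Finset.mem_filter] at hv
      obtain ⟨a1, -, a3, -⟩ := annulus_spec hκ hv.1
      by_contra huv
      refine hcon (annulus κ x v + 1) (by omega) v ?_
        ((reachable_of_mem_innerComponent hu).trans (reachable_of_open (by simpa using huv)))
      exact cluster_subset_succ a1 (hne _ (by omega)) hv.2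
  obtain ⟨n₀, hn₀, w, hw, hxw⟩ := hexists
  refine ⟨n₀, fun n hn v hv => hxw.trans ?_⟩
  have hwn : w ∈ cluster ω κ n x := by
    clear hv
    induction n, hn using Nat.le_induction with
    | base => exact hw
    | succ n hn ih => exact cluster_subset_succ (mem_hball_self _ _) (hne _ (by omega)) ih
  exact cluster_reachable hκ.monotone hκ0 n x hwn hv

end Uniqueness

end HierGroup

/-! ### Markov chain trajectories and a supermartingale bound. -/

section Trajectories

variable {V : Type*} [MeasurableSpace V]
  (κ : (n : ℕ) → Kernel ((i : Finset.Iic n) → V) V) [∀ n, IsMarkovKernel (κ n)] (x : V)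

theorem trajMeasure_dirac :
    Kernel.trajMeasure (X := fun _ => V) (Measure.dirac x) κ =
      Kernel.traj (X := fun _ => V) κ 0 (fun _ => x) := by
  unfold Kernel.trajMeasure
  have h : Measure.map (MeasurableEquiv.piUnique fun i : Finset.Iic 0 => (fun _ : ℕ => V) i).symm
      (Measure.dirac x) = Measure.dirac (fun _ => x) := by
    refine (Measure.map_dirac' (MeasurableEquiv.measurable _) x).trans ?_
    congr 1
  refine (congrArg (fun μ => Measure.bind μ (Kernel.traj (X := fun _ => V) κ 0)) h).trans ?_
  exact Measure.dirac_bind (Kernel.measurable _) _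

/-- A path started from δ_x is at x at time 0, in a form that can be used under the integral. -/
theorem lintegral_trajMeasure_dirac {F : (ℕ → V) → ENNReal} (hF : Measurable F) :
    ∫⁻ path, F path ∂(Kernel.trajMeasure (X := fun _ => V) (Measure.dirac x) κ) =
      ∫⁻ path, F (Function.update path 0 x)
        ∂(Kernel.trajMeasure (X := fun _ => V) (Measure.dirac x) κ) := by
  rw [trajMeasure_dirac, Kernel.lintegral_traj _ hF]
  refine lintegral_congr fun path => ?_
  congr 1
  ext i
  by_cases hi : i = 0
  · subst hi
    simp [Function.updateFinset]
  · simp [Function.updateFinset, hi]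

theorem lintegral_trajMeasure_succ (n : ℕ) (G : ((i : Finset.Iic n) → V) → V → ENNReal)
    (hG : Measurable (Function.uncurry G)) :
    ∫⁻ path, G (Preorder.frestrictLe (π := fun _ => V) n path) (path (n + 1))
      ∂(Kernel.trajMeasure (X := fun _ => V) (Measure.dirac x) κ) =
    ∫⁻ path, ∫⁻ z, G (Preorder.frestrictLe (π := fun _ => V) n path) z
        ∂(κ n (Preorder.frestrictLe (π := fun _ => V) n path))
      ∂(Kernel.trajMeasure (X := fun _ => V) (Measure.dirac x) κ) := by
  have h := Kernel.map_frestrictLe_trajMeasure_compProd_eq_map_trajMeasure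
    (X := fun _ => V) (κ := κ) (μ₀ := Measure.dirac x) (a := n)
  have h1 := congrArg (fun μ => ∫⁻ q, Function.uncurry G q ∂μ) h
  rw [Measure.lintegral_compProd hG, lintegral_map _ (Preorder.measurable_frestrictLe _),
    lintegral_map hG] at h1
  · exact h1.symm
  · exact (Preorder.measurable_frestrictLe _).prodMk (measurable_pi_apply _)
  · exact hG.lintegral_kernel_prod_right

/-- If `U` is superharmonic off `x` for the Markov chain with transition kernel `P`, and `U x = 1`,
then the chain started at `x` returns to `x` with probability at most `P U (x)`. -/
theorem trajMeasure_return_le [DiscreteMeasurableSpace V] (P : Kernel V V) [IsMarkovKernel P]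
    (U : V → ENNReal) (hUx : U x = 1) (hU : ∀ y, y ≠ x → ∫⁻ z, U z ∂(P y) ≤ U y) :
    Kernel.trajMeasure (X := fun _ => V) (Measure.dirac x) (fun n => P.comap
      (fun path : (i : Finset.Iic n) → V => path ⟨n, by simp⟩) (measurable_pi_apply _))
      {path | ∃ n : ℕ, 1 ≤ n ∧ path n = x} ≤ ∫⁻ z, U z ∂(P x) := by
  classical
  set μ := Kernel.trajMeasure (X := fun _ => V) (Measure.dirac x) (fun n => P.comap
      (fun path : (i : Finset.Iic n) → V => path ⟨n, by simp⟩) (measurable_pi_apply _)) with hμ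
  set A : ℕ → Set (ℕ → V) := fun m => {path | ∃ j, 1 ≤ j ∧ j ≤ m ∧ path j = x} with hA
  have hUm : Measurable U := Measurable.of_discrete
  have hAm : ∀ m, MeasurableSet (A m) := by
    intro m
    have : A m = ⋃ j ∈ Set.Icc 1 m, (fun path : ℕ → V => path j) ⁻¹' {x} := by
      ext path; simp [hA, and_assoc]
    rw [this]
    exact MeasurableSet.biUnion (Set.to_countable _) fun j _ =>
      measurable_pi_apply j (MeasurableSet.of_discrete)
  -- Optional stopping: U along the walk, frozen at the value 1 = U x at the first return, has
  -- nonincreasing expectation from time 1 on.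
  have key : ∀ m, 1 ≤ m →
      ∫⁻ path, (if path ∈ A m then 1 else U (path m)) ∂μ ≤ ∫⁻ z, U z ∂(P x) := by
    intro m hm
    induction m, hm using Nat.le_induction with
    | base =>
      have h0 : ∀ path : ℕ → V, (if path ∈ A 1 then 1 else U (path 1)) = U (path (0 + 1)) := by
        intro path
        split_ifs with h
        · obtain ⟨j, h1, h2, h3⟩ := h
          obtain rfl : j = 1 := le_antisymm h2 h1
          rw [zero_add, h3, hUx]
        · rfl
      simp_rw [h0]
      rw [hμ, lintegral_trajMeasure_succ _ x 0 (fun _ z => U z) (hUm.comp measurable_snd),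
        lintegral_trajMeasure_dirac]
      · simp [Kernel.comap_apply]
      · have h1 : Measurable fun y => ∫⁻ z, U z ∂(P y) := Measurable.of_discrete
        exact h1.comp (measurable_pi_apply 0)
    | succ m hm ih =>
      refine le_trans ?_ ih
      set A' : Set ((i : Finset.Iic m) → V) := {h | ∃ j, 1 ≤ j ∧ ∃ hj : j ≤ m,
        h ⟨j, by simpa using hj⟩ = x} with hA'
      have hA'm : MeasurableSet A' := by
        have : A' = ⋃ j : Finset.Iic m, {h | 1 ≤ j.1 ∧ h j = x} := by
          ext h
          simp only [hA', Set.mem_ofPred_eq, Set.mem_iUnion]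
          constructor
          · rintro ⟨j, h1, h2, h3⟩
            exact ⟨⟨j, by simpa using h2⟩, h1, h3⟩
          · rintro ⟨j, h1, h3⟩
            exact ⟨j, h1, Finset.mem_Iic.1 j.2, h3⟩
        rw [this]
        refine MeasurableSet.iUnion fun j => (MeasurableSet.const _).inter ?_
        exact (MeasurableSet.of_discrete (s := {x})).preimage (measurable_pi_apply j)
      have hiff : ∀ path : ℕ → V,
          Preorder.frestrictLe (π := fun _ => V) m path ∈ A' ↔ path ∈ A m := by
        intro path
        simp [hA', hA, Preorder.frestrictLe]
      have h0 : ∀ path : ℕ → V, (if path ∈ A (m + 1) then 1 else U (path (m + 1))) =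
          if Preorder.frestrictLe (π := fun _ => V) m path ∈ A' then 1 else U (path (m + 1)) := by
        intro path
        by_cases h : path ∈ A m
        · have h' : path ∈ A (m + 1) := by
            obtain ⟨j, h1, h2, h3⟩ := h
            exact ⟨j, h1, by omega, h3⟩
          rw [if_pos h', if_pos ((hiff path).2 h)]
        · rw [if_neg (fun h' => h ((hiff path).1 h'))]
          split_ifs with h'
          · obtain ⟨j, h1, h2, h3⟩ := h'
            obtain rfl : j = m + 1 := by
              by_contra hj
              exact h ⟨j, h1, by omega, h3⟩
            rw [h3, hUx]
          · rfl
      simp_rw [h0]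
      rw [hμ, lintegral_trajMeasure_succ _ x m (fun h z => if h ∈ A' then 1 else U z)]
      · refine lintegral_mono fun path => ?_
        dsimp only
        by_cases h : path ∈ A m
        · rw [if_pos h]
          simp only [(hiff path).2 h, if_true, lintegral_const, one_mul, measure_univ, le_refl]
        · rw [if_neg h]
          simp only [mt (hiff path).1 h, if_false]
          refine hU (path m) fun hx => h ⟨m, hm, le_rfl, hx⟩
      · refine Measurable.ite (measurable_fst hA'm) measurable_const (hUm.comp measurable_snd)
  have hunion : {path : ℕ → V | ∃ n : ℕ, 1 ≤ n ∧ path n = x} = ⋃ m, A (m + 1) := by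
    ext path
    simp only [hA, Set.mem_ofPred_eq, Set.mem_iUnion]
    constructor
    · rintro ⟨n, h1, h2⟩
      exact ⟨n, n, h1, by omega, h2⟩
    · rintro ⟨m, j, h1, -, h3⟩
      exact ⟨j, h1, h3⟩
  rw [hunion, Monotone.measure_iUnion]
  · refine iSup_le fun m => le_trans ?_ (key (m + 1) (by omega))
    rw [← lintegral_indicator_one (hAm _)]
    refine lintegral_mono fun path => ?_
    dsimp only
    by_cases h : path ∈ A (m + 1)
    · simp [h]
    · simp [h]
  · refine monotone_nat_of_le_succ fun m => ?_
    rintro path ⟨j, h1, h2, h3⟩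
    exact ⟨j, h1, by omega, h3⟩

end Trajectories

/-! ### Transience from an energy bound on point evaluations. -/

section Criterion

variable {V : Type*}

theorem lintegral_srwKernel (H : SimpleGraph V) (hfin : ∀ y, (H.neighborSet y).Finite)
    (hne : ∀ y, (H.neighborSet y).Nonempty) (U : V → ENNReal) (y : V) :
    @lintegral V ⊤ (srwKernel H y) U =
      (∑ z ∈ (hfin y).toFinset, U z) / ((hfin y).toFinset.card : ENNReal) := by
  let _ : MeasurableSpace V := ⊤
  change ∫⁻ z, U z ∂(srwStep H y) = _
  unfold srwStep
  rw [if_pos ⟨hfin y, hne y⟩, uniformOn, ProbabilityTheory.cond, lintegral_smul_measure,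
    Measure.count_apply_finite _ (hfin y)]
  have : H.neighborSet y = ((hfin y).toFinset : Set V) := by simp
  conv_lhs =>
    enter [2, 1, 2]
    rw [this]
  rw [lintegral_finset]
  simp [div_eq_mul_inv, mul_comm]

theorem srwLaw_return_le (H : SimpleGraph V) (hfin : ∀ y, (H.neighborSet y).Finite)
    (hne : ∀ y, (H.neighborSet y).Nonempty) (x : V) (U : V → ENNReal) (hUx : U x = 1)
    (hU : ∀ y, y ≠ x →
      (∑ z ∈ (hfin y).toFinset, U z) / ((hfin y).toFinset.card : ENNReal) ≤ U y) :
    srwLaw H x {path | ∃ n : ℕ, 1 ≤ n ∧ path n = x} ≤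
      (∑ z ∈ (hfin x).toFinset, U z) / ((hfin x).toFinset.card : ENNReal) := by
  let _ : MeasurableSpace V := ⊤
  have : DiscreteMeasurableSpace V := ⟨fun _ => trivial⟩
  rw [← lintegral_srwKernel H hfin hne]
  refine trajMeasure_return_le x (srwKernel H) U hUx fun y hy => ?_
  rw [lintegral_srwKernel H hfin hne]
  exact hU y hy

open Classical in
/-- The probability that the simple random walk started at `y` hits `x` by time `n`. -/
def hitProb (H : SimpleGraph V) (hfin : ∀ y, (H.neighborSet y).Finite) (x : V) : ℕ → V → ℝ
  | 0, y => if y = x then 1 else 0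
  | n + 1, y => if y = x then 1 else
      (∑ z ∈ (hfin y).toFinset, hitProb H hfin x n z) / (hfin y).toFinset.card

variable {H : SimpleGraph V} {hfin : ∀ y, (H.neighborSet y).Finite} {x : V}

theorem hitProb_self (n : ℕ) : hitProb H hfin x n x = 1 := by
  cases n <;> simp [hitProb]

theorem hitProb_succ (n : ℕ) {y : V} (hy : y ≠ x) : hitProb H hfin x (n + 1) y =
    (∑ z ∈ (hfin y).toFinset, hitProb H hfin x n z) / (hfin y).toFinset.card := by
  simp [hitProb, hy]

theorem hitProb_nonneg (n : ℕ) (y : V) : 0 ≤ hitProb H hfin x n y := by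
  induction n generalizing y with
  | zero => unfold hitProb; split_ifs <;> norm_num
  | succ n ih =>
    by_cases hy : y = x
    · rw [hy, hitProb_self]; norm_num
    · rw [hitProb_succ n hy]
      exact div_nonneg (Finset.sum_nonneg fun z _ => ih z) (Nat.cast_nonneg _)

theorem hitProb_le_one (n : ℕ) (y : V) : hitProb H hfin x n y ≤ 1 := by
  induction n generalizing y with
  | zero => unfold hitProb; split_ifs <;> norm_num
  | succ n ih =>
    by_cases hy : y = x
    · rw [hy, hitProb_self]
    · rw [hitProb_succ n hy]
      refine div_le_one_of_le₀ ?_ (Nat.cast_nonneg _)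
      simpa using Finset.sum_le_card_nsmul (hfin y).toFinset _ 1 fun z _ => ih z

/-- Together with `hitProb_succ` this says that the function is subharmonic off x, which fixes the
sign in Green's identity. -/
theorem hitProb_le_succ (n : ℕ) (y : V) : hitProb H hfin x n y ≤ hitProb H hfin x (n + 1) y := by
  induction n generalizing y with
  | zero =>
    by_cases hy : y = x
    · rw [hy, hitProb_self, hitProb_self]
    · have : hitProb H hfin x 0 y = 0 := by simp [hitProb, hy]
      rw [this]; exact hitProb_nonneg _ _
  | succ n ih =>
    by_cases hy : y = x
    · rw [hy, hitProb_self, hitProb_self]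
    · rw [hitProb_succ n hy, hitProb_succ (n + 1) hy]
      gcongr
      exact ih _

/-- The finite time horizon makes the hitting probabilities admissible test functions in a locally
finite graph. -/
theorem hitProb_support_finite (n : ℕ) : (hitProb H hfin x n).support.Finite := by
  induction n with
  | zero =>
    refine (Set.finite_singleton x).subset fun y hy => ?_
    by_contra h
    simp at h
    simp [hitProb, h] at hy
  | succ n ih =>
    refine ((Set.finite_singleton x).union (ih.biUnion fun z _ => hfin z)).subset fun y hy => ?_
    by_cases h : y = x
    · exact Or.inl h
    · right
      rw [Function.mem_support, hitProb_succ n h] at hy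
      have : ∑ z ∈ (hfin y).toFinset, hitProb H hfin x n z ≠ 0 := fun h0 => hy (by rw [h0, zero_div])
      obtain ⟨z, hz, hz0⟩ := Finset.exists_ne_zero_of_sum_ne_zero this
      refine Set.mem_biUnion (x := z) hz0 ?_
      simpa [SimpleGraph.adj_comm] using hz

open Classical in
/-- The Dirichlet energy of `f` on the edges of `H` inside `S`, each edge counted twice. -/
def dirichletEnergy (H : SimpleGraph V) (f : V → ℝ) (S : Finset V) : ℝ :=
  ∑ u ∈ S, ∑ v ∈ S, if H.Adj u v then (f u - f v) ^ 2 else 0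

theorem dirichletEnergy_mono (f : V → ℝ) {S T : Finset V} (h : S ⊆ T) :
    dirichletEnergy H f S ≤ dirichletEnergy H f T := by
  classical
  have h0 : ∀ u v, 0 ≤ if H.Adj u v then (f u - f v) ^ 2 else 0 := fun u v => by
    split_ifs <;> positivity
  unfold dirichletEnergy
  refine (Finset.sum_le_sum fun u _ => ?_).trans (Finset.sum_le_sum_of_subset_of_nonneg h
    fun _ _ _ => Finset.sum_nonneg fun _ _ => h0 _ _)
  exact Finset.sum_le_sum_of_subset_of_nonneg h fun _ _ _ => h0 _ _

/-- Green's identity for finitely supported functions. -/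
theorem dirichletEnergy_le (hfin : ∀ y, (H.neighborSet y).Finite) (f : V → ℝ)
    (hf : f.support.Finite) (S : Finset V) :
    dirichletEnergy H f S ≤ 2 * ∑ u ∈ hf.toFinset, f u *
      ((hfin u).toFinset.card * f u - ∑ v ∈ (hfin u).toFinset, f v) := by
  classical
  set T : Finset V := S ∪ hf.toFinset ∪ hf.toFinset.biUnion fun u => (hfin u).toFinset with hT
  have hfT : hf.toFinset ⊆ T := fun u hu => by simp only [hT, Finset.mem_union]; tauto
  refine (dirichletEnergy_mono f (T := T) (fun u hu => by
    simp only [hT, Finset.mem_union]; tauto)).trans (le_of_eq ?_)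
  have h1 : dirichletEnergy H f T =
      2 * ∑ u ∈ T, f u * ∑ v ∈ T, if H.Adj u v then f u - f v else 0 := by
    unfold dirichletEnergy
    have h2 : ∑ u ∈ T, ∑ v ∈ T, (if H.Adj u v then f u * (f u - f v) else 0) =
        ∑ u ∈ T, ∑ v ∈ T, (if H.Adj u v then f v * (f v - f u) else 0) := by
      rw [Finset.sum_comm]
      simp_rw [SimpleGraph.adj_comm]
    have h3 : ∑ u ∈ T, f u * ∑ v ∈ T, (if H.Adj u v then f u - f v else 0) =
        ∑ u ∈ T, ∑ v ∈ T, (if H.Adj u v then f u * (f u - f v) else 0) := by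
      simp_rw [Finset.mul_sum, mul_ite, mul_zero]
    rw [h3, two_mul]
    nth_rw 2 [h2]
    simp_rw [← Finset.sum_add_distrib]
    refine Finset.sum_congr rfl fun u _ => Finset.sum_congr rfl fun v _ => ?_
    split_ifs <;> ring
  rw [h1]
  congr 1
  rw [← Finset.sum_subset hfT fun u _ hu => by
    have : f u = 0 := by simpa using hu
    rw [this, zero_mul]]
  refine Finset.sum_congr rfl fun u hu => ?_
  congr 1
  have hsub : (hfin u).toFinset ⊆ T := fun v hv => by
    simp only [hT, Finset.mem_union, Finset.mem_biUnion]
    exact Or.inr ⟨u, hu, hv⟩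
  rw [← Finset.sum_filter]
  have : T.filter (fun v => H.Adj u v) = (hfin u).toFinset := by
    ext v
    simp only [Finset.mem_filter, Set.Finite.mem_toFinset, SimpleGraph.mem_neighborSet]
    exact ⟨fun h => h.2, fun h => ⟨hsub (by simpa using h), h⟩⟩
  rw [this, Finset.sum_sub_distrib, Finset.sum_const, nsmul_eq_mul]

/-- If point evaluations are bounded by the Dirichlet energy, the simple random walk is
transient. -/
theorem srwTransient_of_sq_le (H : SimpleGraph V) (hfin : ∀ y, (H.neighborSet y).Finite)
    (hne : ∀ y, (H.neighborSet y).Nonempty)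
    (h : ∀ x, ∃ C : ℝ, ∀ f : V → ℝ, f.support.Finite → ∀ D : ℝ,
      (∀ S, dirichletEnergy H f S ≤ D) → f x ^ 2 ≤ C * D) : SRWTransient H := by
  classical
  intro x
  obtain ⟨C, hC⟩ := h x
  set d : V → ℝ := fun y => (hfin y).toFinset.card with hd
  have hd0 : ∀ y, 0 < d y := fun y => by
    simp only [hd, Nat.cast_pos, Finset.card_pos]
    simpa using hne y
  set s : ℕ → V → ℝ := fun n y => ∑ z ∈ (hfin y).toFinset, hitProb H hfin x n z with hs
  have hs_le : ∀ n y, s n y ≤ d y := fun n y => by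
    simpa using Finset.sum_le_card_nsmul (hfin y).toFinset _ 1 fun z _ => hitProb_le_one n z
  -- The energy bound is tested on the hitting probability. In Green's identity all terms off x are
  -- nonpositive, so the energy is at most twice d x times the probability of not returning within n
  -- + 1 steps. That probability is therefore bounded below uniformly in n.
  have hbound : ∀ n, 1 ≤ max C 1 * (2 * (d x - s n x)) := by
    intro n
    have hD0 : 0 ≤ 2 * (d x - s n x) := by linarith [hs_le n x]
    have h1 := hC (hitProb H hfin x n) (hitProb_support_finite n) (2 * (d x - s n x)) fun S => by
      refine (dirichletEnergy_le hfin _ (hitProb_support_finite n) S).trans ?_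
      gcongr
      have hx : x ∈ (hitProb_support_finite (H := H) (hfin := hfin) (x := x) n).toFinset := by
        simp [hitProb_self]
      rw [← Finset.add_sum_erase _ _ hx, hitProb_self, one_mul, mul_one]
      have : ∑ u ∈ (hitProb_support_finite (H := H) (hfin := hfin) (x := x) n).toFinset.erase x,
          hitProb H hfin x n u * ((hfin u).toFinset.card * hitProb H hfin x n u -
            ∑ v ∈ (hfin u).toFinset, hitProb H hfin x n v) ≤ 0 := by
        refine Finset.sum_nonpos fun u hu => ?_
        refine mul_nonpos_of_nonneg_of_nonpos (hitProb_nonneg _ _) ?_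
        have h2 := hitProb_le_succ (H := H) (hfin := hfin) (x := x) n u
        rw [hitProb_succ n (Finset.ne_of_mem_erase hu), le_div_iff₀ (hd0 u)] at h2
        linarith
      linarith
    rw [hitProb_self, one_pow] at h1
    exact h1.trans (mul_le_mul_of_nonneg_right (le_max_left _ _) hD0)
  set c : ℝ := 1 / (2 * max C 1) with hc
  have hC1 : 0 < max C 1 := lt_of_lt_of_le one_pos (le_max_right _ _)
  have hc0 : 0 < c := by positivity
  have hs_le' : ∀ n, s n x ≤ d x - c := by
    intro n
    have := hbound n
    have h2 : c ≤ d x - s n x := by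
      rw [hc, div_le_iff₀ (by positivity)]; linarith
    linarith
  have hmono : ∀ y, Monotone fun n => hitProb H hfin x n y :=
    fun y => monotone_nat_of_le_succ fun n => hitProb_le_succ n y
  -- The limit is superharmonic off x, and the uniform bound keeps its neighbour average at x below
  -- 1.
  set U : V → ℝ := fun y => ⨆ n, hitProb H hfin x n y with hUdef
  have hlim : ∀ y, Filter.Tendsto (fun n => hitProb H hfin x n y) Filter.atTop (nhds (U y)) :=
    fun y => tendsto_atTop_ciSup (hmono y) ⟨1, by rintro _ ⟨n, rfl⟩; exact hitProb_le_one n y⟩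
  have hU0 : ∀ y, 0 ≤ U y := fun y => ge_of_tendsto' (hlim y) fun n => hitProb_nonneg n y
  have hslim : ∀ y, Filter.Tendsto (fun n => s n y) Filter.atTop
      (nhds (∑ z ∈ (hfin y).toFinset, U z)) := fun y => tendsto_finsetSum _ fun z _ => hlim z
  have hUx : U x = 1 := by
    have := hlim x
    simp_rw [hitProb_self] at this
    exact tendsto_nhds_unique this tendsto_const_nhds
  have hU : ∀ y, y ≠ x → (∑ z ∈ (hfin y).toFinset, U z) / d y ≤ U y := by
    intro y hy
    refine le_of_tendsto_of_tendsto' ((hslim y).div_const (d y))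
      ((hlim y).comp (Filter.tendsto_add_atTop_nat 1)) fun n => ?_
    simp only [Function.comp_apply]
    rw [hitProb_succ n hy]
  have hPx : (∑ z ∈ (hfin x).toFinset, U z) / d x < 1 := by
    rw [div_lt_one (hd0 x)]
    have := le_of_tendsto' (hslim x) hs_le'
    linarith
  have hcoe : ∀ y, (∑ z ∈ (hfin y).toFinset, ENNReal.ofReal (U z)) /
      ((hfin y).toFinset.card : ENNReal) =
      ENNReal.ofReal ((∑ z ∈ (hfin y).toFinset, U z) / d y) := by
    intro y
    rw [ENNReal.ofReal_div_of_pos (hd0 y), ENNReal.ofReal_sum_of_nonneg fun z _ => hU0 z,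
      hd, ENNReal.ofReal_natCast]
  refine (srwLaw_return_le H hfin hne x (fun y => ENNReal.ofReal (U y)) (by simp [hUx])
    fun y hy => ?_).trans_lt ?_
  · rw [hcoe]
    exact ENNReal.ofReal_le_ofReal (hU y hy)
  · rw [hcoe]
    exact ENNReal.ofReal_lt_one.2 hPx

end Criterion

namespace HierGroup

/-! ### Bounds on the connection probabilities. -/

section ConnectionProbabilities

theorem connCoeff_ge {C₀ C₁ C₂ α : ℝ} (h₀ : 0 ≤ C₀) (h₁ : 0 ≤ C₁) (k : ℕ) :
    C₂ * (k : ℝ) ^ α ≤ connCoeff C₀ C₁ C₂ α k := by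
  unfold connCoeff
  have := mul_nonneg h₁ (Real.log_natCast_nonneg k)
  linarith

theorem one_sub_connProb_le (N : ℕ) {C₀ C₁ C₂ α : ℝ} (h₀ : 0 ≤ C₀) (h₁ : 0 ≤ C₁) (k : ℕ) :
    1 - (connProb N C₀ C₁ C₂ α k : ℝ) ≤ Real.exp (-(C₂ * (k : ℝ) ^ α / (N : ℝ) ^ (2 * k))) := by
  set z := C₂ * (k : ℝ) ^ α / (N : ℝ) ^ (2 * k) with hz
  have h : min 1 z ≤ (connProb N C₀ C₁ C₂ α k : ℝ) := by
    unfold connProb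
    rw [Set.coe_projIcc]
    refine le_trans ?_ (le_max_right _ _)
    refine min_le_min le_rfl ?_
    exact div_le_div_of_nonneg_right (connCoeff_ge h₀ h₁ k) (by positivity)
  rcases le_total z 1 with h1 | h1
  · rw [min_eq_right h1] at h
    linarith [Real.one_sub_le_exp_neg z]
  · rw [min_eq_left h1] at h
    linarith [Real.exp_pos (-z)]

/-- The k-th term is at most a polynomial in k times N^(-k). -/
theorem tsum_connProb_ne_top {N : ℕ} (hN : 2 ≤ N) {C₀ C₁ C₂ α : ℝ} (h₀ : 0 ≤ C₀) (h₁ : 0 ≤ C₁)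
    (h₂ : 0 ≤ C₂) (hα : 0 < α) :
    ∑' k : ℕ, (N : ENNReal) ^ k * ENNReal.ofReal (connProb N C₀ C₁ C₂ α k) ≠ ⊤ := by
  have hN' : (2 : ℝ) ≤ N := by exact_mod_cast hN
  have hN0 : (0 : ℝ) < N := by linarith
  set m := ⌈α⌉₊ with hm
  set r : ℝ := 1 / N with hr
  have hr1 : ‖r‖ < 1 := by
    rw [Real.norm_of_nonneg (by positivity), hr, div_lt_one hN0]; linarith
  have hsum : Summable fun k : ℕ => C₀ * ((k : ℝ) ^ 0 * r ^ k) + C₁ * ((k : ℝ) ^ 1 * r ^ k) +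
      C₂ * ((k : ℝ) ^ m * r ^ k) :=
    (((summable_pow_mul_geometric_of_norm_lt_one 0 hr1).mul_left _).add
      ((summable_pow_mul_geometric_of_norm_lt_one 1 hr1).mul_left _)).add
      ((summable_pow_mul_geometric_of_norm_lt_one m hr1).mul_left _)
  refine ne_top_of_le_ne_top hsum.tsum_ofReal_ne_top (ENNReal.tsum_le_tsum fun k => ?_)
  have hNk : (N : ENNReal) ^ k = ENNReal.ofReal ((N : ℝ) ^ k) := by
    rw [ENNReal.ofReal_pow hN0.le, ENNReal.ofReal_natCast]
  rw [hNk, ← ENNReal.ofReal_mul (by positivity)]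
  refine ENNReal.ofReal_le_ofReal ?_
  have hc0 : 0 ≤ connCoeff C₀ C₁ C₂ α k := le_trans (by positivity) (connCoeff_ge h₀ h₁ k)
  have h1 : (connProb N C₀ C₁ C₂ α k : ℝ) ≤ connCoeff C₀ C₁ C₂ α k / (N : ℝ) ^ (2 * k) := by
    unfold connProb
    rw [Set.coe_projIcc]
    exact max_le (by positivity) (min_le_right _ _)
  have h2 : connCoeff C₀ C₁ C₂ α k ≤ C₀ + C₁ * k + C₂ * (k : ℝ) ^ m := by
    unfold connCoeff
    have h3 : (k : ℝ) ^ α ≤ (k : ℝ) ^ m := by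
      rcases Nat.eq_zero_or_pos k with h | h
      · rw [h, Nat.cast_zero, Real.zero_rpow hα.ne']; positivity
      · rw [← Real.rpow_natCast]
        exact Real.rpow_le_rpow_of_exponent_le (by exact_mod_cast h) (Nat.le_ceil α)
    have h4 := Real.log_le_self (Nat.cast_nonneg k : (0 : ℝ) ≤ k)
    gcongr
  calc (N : ℝ) ^ k * connProb N C₀ C₁ C₂ α k
      ≤ (N : ℝ) ^ k * ((C₀ + C₁ * k + C₂ * (k : ℝ) ^ m) / (N : ℝ) ^ (2 * k)) := by
        gcongr
        exact h1.trans (by gcongr)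
    _ = _ := by
        rw [hr, two_mul, pow_add, one_div, inv_pow]
        field_simp

end ConnectionProbabilities

/-! ### From good configurations to the percolation cluster. -/

section Deterministic

variable {N : ℕ} [NeZero N] {κ : ℕ → ℕ} {ω : Sym2 (HierGroup N) → Bool}

open Classical in
/-- The extension by zero of a function on a connected component. -/
def extendZero (K : (percGraph ω).ConnectedComponent) (f : K → ℝ) (v : HierGroup N) : ℝ :=
  if h : v ∈ K.supp then f ⟨v, h⟩ else 0

/-- No open edge leaves a component, so extension by zero creates no energy. -/
theorem ballEnergy_extendZero_le (K : (percGraph ω).ConnectedComponent) (f : K → ℝ) {D : ℝ}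
    (hD : ∀ S, dirichletEnergy K.toSimpleGraph f S ≤ D) (k : ℕ) (x : HierGroup N) :
    ballEnergy ω (extendZero K f) k x ≤ D := by
  classical
  refine le_trans (le_of_eq ?_) (hD ((hball k x).subtype fun v => v ∈ K.supp))
  have hzero : ∀ u v, ¬ (u ∈ K.supp ∧ v ∈ K.supp) → edgeEnergy ω (extendZero K f) u v = 0 := by
    intro u v huv
    unfold edgeEnergy
    split_ifs with h
    · have hiff : u ∈ K.supp ↔ v ∈ K.supp := by
        rw [SimpleGraph.ConnectedComponent.mem_supp_iff,
          SimpleGraph.ConnectedComponent.mem_supp_iff,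
          SimpleGraph.ConnectedComponent.sound (reachable_of_open h)]
      have hu : u ∉ K.supp := fun h' => huv ⟨h', hiff.1 h'⟩
      have hv : v ∉ K.supp := fun h' => hu (hiff.2 h')
      simp [extendZero, hu, hv]
    · rfl
  have hpair : ∀ u v : K, edgeEnergy ω (extendZero K f) u v =
      if K.toSimpleGraph.Adj u v then (f u - f v) ^ 2 else 0 := by
    intro u v
    have hu : extendZero K f u = f u := by simp [extendZero]
    have hv : extendZero K f v = f v := by simp [extendZero]
    unfold edgeEnergy
    rw [hu, hv]
    by_cases huv : u = v
    · simp [huv]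
    · have : K.toSimpleGraph.Adj u v ↔ ω s((u : HierGroup N), (v : HierGroup N)) = true := by
        have h1 : K.toSimpleGraph.Adj u v ↔ (percGraph ω).Adj u v := Iff.rfl
        rw [h1, percGraph_adj]
        exact and_iff_left fun h => huv (Subtype.ext h)
      simp only [this]
  have hsub : ∀ g : HierGroup N → ℝ,
      ∑ u ∈ ((hball k x).subtype (fun v => v ∈ K.supp) : Finset K), g u =
        ∑ u ∈ hball k x, if u ∈ K.supp then g u else 0 := fun g => by
    rw [← Finset.sum_filter]
    exact Finset.sum_subtype_eq_sum_filter g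
  unfold ballEnergy dirichletEnergy
  simp_rw [← hpair]
  refine Eq.trans ?_ (hsub fun u => ∑ v ∈ ((hball k x).subtype (fun v => v ∈ K.supp) : Finset K),
    edgeEnergy ω (extendZero K f) u v).symm
  refine Finset.sum_congr rfl fun u _ => ?_
  rw [hsub fun v => edgeEnergy ω (extendZero K f) u v]
  split_ifs with hu
  · refine Finset.sum_congr rfl fun v _ => ?_
    split_ifs with hv
    · rfl
    · exact hzero u v fun h => hv h.2
  · exact Finset.sum_eq_zero fun v _ => hzero u v fun h => hu h.1

theorem edgeEnergy_le_of_ballEnergy_le {f : HierGroup N → ℝ} {D : ℝ}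
    (hD : ∀ k x, ballEnergy ω f k x ≤ D) (u v : HierGroup N) : edgeEnergy ω f u v ≤ D := by
  obtain ⟨k, hk⟩ := exists_mem_hball u v
  refine le_trans ?_ (hD k u)
  refine le_trans ?_ (Finset.single_le_sum
    (f := fun a => ∑ b ∈ hball k u, edgeEnergy ω f a b)
    (fun _ _ => Finset.sum_nonneg fun _ _ => edgeEnergy_nonneg _ _) (mem_hball_self k u))
  exact Finset.single_le_sum (f := fun b => edgeEnergy ω f u b)
    (fun _ _ => edgeEnergy_nonneg _ _) hk

theorem abs_sub_le_walk_length {f : HierGroup N → ℝ} {D : ℝ}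
    (hD : ∀ k x, ballEnergy ω f k x ≤ D) {u v : HierGroup N} (w : (percGraph ω).Walk u v) :
    |f u - f v| ≤ w.length * √D := by
  induction w with
  | nil => simp
  | @cons a b c h w ih =>
    have h1 : (f a - f b) ^ 2 ≤ D := by
      have := edgeEnergy_le_of_ballEnergy_le hD a b
      rwa [edgeEnergy, if_pos (percGraph_adj.1 h).1] at this
    have h2 : |f a - f b| ≤ √D := Real.abs_le_sqrt h1
    rw [SimpleGraph.Walk.length_cons]
    push_cast
    calc |f a - f c| ≤ |f a - f b| + |f b - f c| := abs_sub_le _ _ _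
      _ ≤ _ := by linarith

/-- The energy bound is available at `x₀`, which lies in its clusters of all large stages. It
spreads to any other vertex along a walk, each edge of which changes the function by at most √D. -/
theorem srwTransient_toSimpleGraph (hκ : StrictMono κ) (hκ0 : κ 0 = 0) (hN2 : 2 ≤ N)
    (hM : ∀ n : ℕ, ((n : ℝ) + 2) ^ 2 * N ^ κ n ≤ N ^ κ (n + 1)) {δ : ℕ → ℝ}
    (hδ1 : ∀ n, (N : ℝ) ^ κ (n - 1) ≤ δ n ^ 2 * N ^ κ n)
    (hδ2 : ∀ n, (N : ℝ) ^ κ n ≤ δ n ^ 2 * N ^ κ (n + 1))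
    (hδ : ∀ n, 0 ≤ δ n) (hδ' : ∀ n, δ n ≤ 1) (hs : Summable δ)
    (hfin : ∀ x, ((percGraph ω).neighborSet x).Finite)
    (K : (percGraph ω).ConnectedComponent) (hK : K.supp.Infinite) {x₀ : HierGroup N}
    (hx₀K : x₀ ∈ K.supp) {n₀ : ℕ} (hx₀ : x₀ ∈ cluster ω κ n₀ x₀)
    (hne : ∀ n, n₀ ≤ n → (cluster ω κ n x₀).Nonempty) : SRWTransient K.toSimpleGraph := by
  have hpre : K.toSimpleGraph.Connected := K.connected_toSimpleGraph
  refine srwTransient_of_sq_le _ (fun y => ?_) (fun y => ?_) fun x => ?_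
  · exact ((hfin y).preimage Subtype.val_injective.injOn).subset fun z hz => hz
  · have : Infinite K := hK.to_subtype
    have : Nontrivial K := inferInstance
    obtain ⟨z, hz⟩ := hpre.preconnected.exists_adj_of_nontrivial y
    exact ⟨z, hz⟩
  · have hxx₀ : (percGraph ω).Reachable x x₀ := SimpleGraph.ConnectedComponent.exact
      ((SimpleGraph.ConnectedComponent.mem_supp_iff _ _).1 x.2 |>.trans
        ((SimpleGraph.ConnectedComponent.mem_supp_iff _ _).1 hx₀K).symm)
    obtain ⟨w⟩ := hxx₀
    set A : ℝ := Real.exp (4 * ∑' i, δ i) with hA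
    refine ⟨(w.length + A) ^ 2, fun f hf D hD => ?_⟩
    have hE := ballEnergy_extendZero_le K f hD
    have hD0 : 0 ≤ D := by simpa [dirichletEnergy] using hD ∅
    have hF : (extendZero K f).support.Finite := by
      refine (hf.image Subtype.val).subset fun v hv => ?_
      by_cases h : v ∈ K.supp
      · exact ⟨⟨v, h⟩, by simpa [extendZero, h] using hv, rfl⟩
      · simp [extendZero, h] at hv
    have h1 := abs_le_of_ballEnergy_le hκ hκ0 hN2 hM hδ1 hδ2 hδ hδ' hs hx₀ hne
      (fun k => hE k x₀) hF
    have h2 := abs_sub_le_walk_length hE w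
    have h3 : |extendZero K f x| ≤ (w.length + A) * √D := by
      have := abs_sub_abs_le_abs_sub (extendZero K f x) (extendZero K f x₀)
      linarith
    have h4 : extendZero K f x = f x := by simp [extendZero]
    rw [h4] at h3
    have h5 := pow_le_pow_left₀ (abs_nonneg _) h3 2
    rwa [sq_abs, mul_pow, Real.sq_sqrt hD0] at h5

theorem percolation_of_good (hκ : StrictMono κ) (hκ0 : κ 0 = 0) (hN2 : 2 ≤ N)
    (hM : ∀ n : ℕ, ((n : ℝ) + 2) ^ 2 * N ^ κ n ≤ N ^ κ (n + 1)) {δ : ℕ → ℝ}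
    (hδ1 : ∀ n, (N : ℝ) ^ κ (n - 1) ≤ δ n ^ 2 * N ^ κ n)
    (hδ2 : ∀ n, (N : ℝ) ^ κ n ≤ δ n ^ 2 * N ^ κ (n + 1))
    (hδ : ∀ n, 0 ≤ δ n) (hδ' : ∀ n, δ n ≤ 1) (hs : Summable δ)
    (hfin : ∀ x, ((percGraph ω).neighborSet x).Finite)
    (hgood : ∀ᶠ r in Filter.atTop, ∀ y ∈ hball (κ (r + 1)) 0, (cluster ω κ r y).Nonempty)
    (hreach : ∀ x, {v | (percGraph ω).Reachable x v}.Infinite →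
      ∃ n₀, ∀ n, n₀ ≤ n → ∀ v ∈ cluster ω κ n x, (percGraph ω).Reachable x v) :
    ∃ K : (percGraph ω).ConnectedComponent, K.supp.Infinite ∧
      (∀ K' : (percGraph ω).ConnectedComponent, K'.supp.Infinite → K' = K) ∧
      SRWTransient K.toSimpleGraph := by
  obtain ⟨n₀, hn₀⟩ := Filter.eventually_atTop.1 hgood
  have hne : ∀ n, n₀ ≤ n → (cluster ω κ n 0).Nonempty := fun n hn =>
    hn₀ n hn 0 (mem_hball_self _ _)
  obtain ⟨x₀, hx₀⟩ := hne n₀ le_rfl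
  have hx₀ball : ∀ n, n₀ ≤ n → x₀ ∈ hball (κ n) 0 := fun n hn =>
    hball_mono (hκ.monotone hn) 0 (cluster_subset hκ.monotone _ _ hx₀)
  have hx₀n : ∀ n, n₀ ≤ n → x₀ ∈ cluster ω κ n 0 := by
    intro n hn
    induction n, hn using Nat.le_induction with
    | base => exact hx₀
    | succ n hn ih => exact cluster_subset_succ (mem_hball_self _ _) (hne _ (by omega)) ih
  set K := (percGraph ω).connectedComponentMk x₀ with hKdef
  have hsub : ∀ n, n₀ ≤ n → ∀ v ∈ cluster ω κ n 0, v ∈ K.supp := by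
    intro n hn v hv
    rw [SimpleGraph.ConnectedComponent.mem_supp_iff]
    exact SimpleGraph.ConnectedComponent.sound
      (cluster_reachable hκ.monotone hκ0 n 0 hv (hx₀n n hn))
  have hK : K.supp.Infinite := by
    intro hKfin
    set c := hKfin.toFinset.card with hc
    -- Large enough that half the volume, at least N^n / 2, exceeds the supposed finite size `c`.
    set n := n₀ + 2 * c with hn
    have h1 : (cluster ω κ n 0).card ≤ c := Finset.card_le_card fun v hv => by
      simpa using hsub n (by omega) v hv
    have h2 := half_le_card_cluster hκ.monotone hκ0 hM n 0 (hne n (by omega))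
    have h3 : n < N ^ κ n := (hκ.le_apply (x := n)).trans_lt (Nat.lt_pow_self (by omega))
    have h4 : (N ^ κ n : ℝ) ≤ 2 * c := by
      have : ((cluster ω κ n 0).card : ℝ) ≤ c := by exact_mod_cast h1
      linarith
    have h5 : N ^ κ n ≤ 2 * c := by exact_mod_cast h4
    omega
  refine ⟨K, hK, fun K' hK' => ?_, ?_⟩
  · induction K' using SimpleGraph.ConnectedComponent.ind with
    | _ x =>
    have hinf : {v | (percGraph ω).Reachable x v}.Infinite := by
      refine hK'.mono fun v hv => ?_
      exact (SimpleGraph.ConnectedComponent.exact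
        ((SimpleGraph.ConnectedComponent.mem_supp_iff _ _).1 hv)).symm
    obtain ⟨n₁, hn₁⟩ := hreach x hinf
    obtain ⟨k, hk⟩ := exists_mem_hball x 0
    -- At this stage the balls around `x` and 0 coincide, hence so do their clusters.
    set n := n₀ + n₁ + k with hn
    have h0 : (0 : HierGroup N) ∈ hball (κ n) x :=
      hball_mono (le_trans (by omega) (hκ.le_apply (x := n))) x hk
    have hx₀' := hx₀n n (by omega)
    rw [cluster_congr hκ0 n h0] at hx₀'
    exact SimpleGraph.ConnectedComponent.sound (hn₁ n (by omega) x₀ hx₀')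
  · refine srwTransient_toSimpleGraph hκ hκ0 hN2 hM hδ1 hδ2 hδ hδ' hs hfin K hK rfl
      (mem_cluster_self_of_mem hκ.monotone hκ0 hx₀) fun n hn => ?_
    rw [cluster_congr hκ0 n (hx₀ball n hn)]
    exact hne n hn

end Deterministic

end HierGroup

end

theorem theoremT (N : ℕ) (hN : 2 ≤ N) (α : ℝ) (hα : 6 < α) :
    ∃ C : ℝ, 0 < C ∧ ∀ C₂ : ℝ, C ≤ C₂ → ∀ C₀ C₁ : ℝ, 0 ≤ C₀ → 0 ≤ C₁ →
      ∀ᵐ ω ∂(percMeasure N C₀ C₁ C₂ α),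
        (∀ x : HierGroup N, ((percGraph ω).neighborSet x).Finite) ∧
        ∃ K : (percGraph ω).ConnectedComponent,
          K.supp.Infinite ∧
          (∀ K' : (percGraph ω).ConnectedComponent, K'.supp.Infinite → K' = K) ∧
          SRWTransient K.toSimpleGraph := by
  have : NeZero N := ⟨by omega⟩
  -- The midpoint of 2 and α/3; such a θ exists exactly when α > 6.
  obtain ⟨θ, hθ, hθα⟩ : ∃ θ : ℝ, 2 < θ ∧ 3 * θ < α :=
    ⟨(2 + α / 3) / 2, by linarith, by linarith⟩
  obtain ⟨C, a, hC, ha, hrec⟩ := HierGroup.exists_constants hN hθ hθα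
  refine ⟨C, hC, fun C₂ hC₂ C₀ C₁ h₀ h₁ => ?_⟩
  have hC₂0 : 0 ≤ C₂ := hC.le.trans hC₂
  have hα0 : 0 < α := by linarith
  set p := connProb N C₀ C₁ C₂ α with hp
  change ∀ᵐ ω ∂(HierGroup.edgeLaw N p), _
  have hsum := HierGroup.tsum_connProb_ne_top hN h₀ h₁ hC₂0 hα0
  have hbad := HierGroup.measure_bad_le (p := p) hN hθ hα0.le hC₂0 ha
    (fun k _ => HierGroup.one_sub_connProb_le N h₀ h₁ k) (hrec C₂ hC₂)
  have hκ := HierGroup.scale_strictMono hN hθ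
  have hM := HierGroup.sq_mul_pow_scale_le hN hθ
  have hgood := HierGroup.ae_eventually_good hN hθ ha hbad
  filter_upwards [ae_all_iff.2 (HierGroup.ae_finite_open hsum), hgood 0, ae_all_iff.2 fun x =>
    HierGroup.ae_reachable_cluster hκ HierGroup.scale_zero hM hsum x (hgood x)] with ω h1 h2 h3
  have hfin : ∀ x : HierGroup N, ((percGraph ω).neighborSet x).Finite := fun x =>
    (h1 x).subset fun y hy => (HierGroup.percGraph_adj.1 hy).1
  exact ⟨hfin, HierGroup.percolation_of_good hκ HierGroup.scale_zero hN hM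
    (HierGroup.pow_scale_pred_le_oscRate hN) (HierGroup.pow_scale_le_oscRate hN hθ)
    HierGroup.oscRate_nonneg (HierGroup.oscRate_le_one hθ) (HierGroup.summable_oscRate hθ)
    hfin h2 h3⟩
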